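/- For $\beta\in\mathbb R$ let $\mathcal F'_\beta$ be the equation $$u_t+xu_y=|x|^\beta u_{xx}$$ for an unknown function $u=u(t,x,y)$, considered at all points $(t,x,y)\in\mathbb R^3$ if $\beta\ge 0$ and at the points with $x\neq0$ if $\beta<0$; solutions are $C^\infty$ functions on open sets. A point transformation is a $C^\infty$ diffeomorphism $\Phi\colon(t,x,y,u)\mapsto(\tilde t,\tilde x,\tilde y,\tilde u)$ between two open subsets of $\mathbb R^4_{t,x,y,u}$ (lying in $\{x\ne0\}$ if $\beta<0$). The point symmetry pseudogroup $G_\beta$ of $\mathcal F'_\beta$ is the set of all point transformations $\Phi$ such that, whenever $\Phi$ maps the graph of a smooth function $h$ defined on an open set onto the graph of a smooth function $\tilde h$ defined on an open set, $h$ is a solution of $\mathcal F'_\beta$ if and only if $\tilde h$ is. We say that $\Phi$ has a certain form if its restriction to every connected open subset $M$ of its domain that meets each line $(t,x,y)=\mathrm{const}$ in a connected (possibly empty) set has this form; the constants and the function $f$ may depend on $M$. (If the domain of $\Phi$ is itself such a set, this means that $\Phi$ has the form on its whole domain.) (i) For $\beta\in\mathbb R\setminus\{0,2,5/2,3,5\}$,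 the pseudogroup $G_\beta$ consists of exactly the point transformations of the form $$\tilde t=|\alpha|^{2-\beta}t+\lambda_0,\qquad \tilde x=\alpha x,\qquad \tilde y=\alpha|\alpha|^{2-\beta}y+\lambda_1,\qquad \tilde u=\sigma u+f(t,x,y),$$ where $\alpha,\lambda_0,\lambda_1,\sigma$ are arbitrary real constants with $\alpha\sigma\neq0$ and $f$ is an arbitrary solution of $\mathcal F'_\beta$ on the projection of $M$ to $\mathbb R^3_{t,x,y}$. (ii) The pseudogroup $G_{5/2}$ consists of exactly the point transformations that on each such $M$ either have the form in (i) with $\beta=5/2$, or have the form $$\tilde t=\operatorname{sgn}(x)\,|\alpha|^{-1/2}y+\lambda_0,\qquad \tilde x=\frac{\alpha}{x},\qquad \tilde y=\operatorname{sgn}(x)\,\alpha|\alpha|^{-1/2}t+\lambda_1,\qquad \tilde u=\frac{\sigma u+f(t,x,y)}{x}$$ with $x\neq0$ on $M$, where again $\alpha,\lambda_0,\lambda_1,\sigma$ are arbitrary real constants with $\alpha\sigma\ne0$ and $f$ is an arbitrary solution of $\mathcal F'_{5/2}$ on the projection of $M$ to $\mathbb R^3_{t,x,y}$. -/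

import Mathlib

open scoped ContDiff

noncomputable section

namespace UltraparabolicSymmetry

/-- The space with coordinates `(t, x, y)` of the independent variables. -/
abbrev Base : Type := ℝ × ℝ × ℝ

/-- The space with coordinates `(t, x, y, u)` of the independent and dependent variables. -/
abbrev Total : Type := ℝ × ℝ × ℝ × ℝ

/-- The natural projection `(t, x, y, u) ↦ (t, x, y)`. -/
def proj (p : Total) : Base := (p.1, p.2.1, p.2.2.1)

/-- The graph `{(t, x, y, h (t, x, y)) : (t, x, y) ∈ Ω}` of a function over `Ω`. -/
def graphOver (h : Base → ℝ) (Ω : Set Base) : Set Total :=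
  (fun z : Base => (z.1, z.2.1, z.2.2, h z)) '' Ω

/-- `h` is a smooth solution on the (open) set `Ω` of the equation
`u_t + x u_y = |x|^β u_xx`. -/
def IsSolutionOn (β : ℝ) (h : Base → ℝ) (Ω : Set Base) : Prop :=
  ContDiffOn ℝ ∞ h Ω ∧
    ∀ t x y : ℝ, (t, x, y) ∈ Ω →
      deriv (fun s => h (s, x, y)) t + x * deriv (fun s => h (t, x, s)) y
        = |x| ^ β * deriv (deriv (fun s => h (t, s, y))) x

/-- The part of the `(t, x, y, u)`-space over which the coefficient `|x|^β` is defined: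
the points with `x = 0` are left out exactly when `β` is negative. -/
def coeffDomain (β : ℝ) : Set Total := {p | 0 ≤ β ∨ p.2.1 ≠ 0}

/-- Point transformations: smooth diffeomorphisms between two open subsets of the
`(t, x, y, u)`-space over which the equation is defined. All components may depend on
all of `t`, `x`, `y`, `u`. -/
structure IsPointTransformation (β : ℝ) (Φ : OpenPartialHomeomorph Total Total) : Prop where
  source_subset : Φ.source ⊆ coeffDomain β
  target_subset : Φ.target ⊆ coeffDomain β
  contDiffOn : ContDiffOn ℝ ∞ Φ Φ.source
  contDiffOn_symm : ContDiffOn ℝ ∞ Φ.symm Φ.target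

/-- `Φ` and its inverse map solutions to solutions: whenever `Φ` maps the graph of a smooth
function `h` (over an open set) onto the graph of a smooth function `k` (over an open set),
`h` is a solution if and only if `k` is. -/
def PreservesSolutions (β : ℝ) (Φ : OpenPartialHomeomorph Total Total) : Prop :=
  ∀ (Ω Ω' : Set Base) (h k : Base → ℝ), IsOpen Ω → IsOpen Ω' →
    ContDiffOn ℝ ∞ h Ω → ContDiffOn ℝ ∞ k Ω' →
    graphOver h Ω ⊆ Φ.source → Φ '' graphOver h Ω = graphOver k Ω' →
    (IsSolutionOn β h Ω ↔ IsSolutionOn β k Ω')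

/-- The point symmetry pseudogroup of the equation `u_t + x u_y = |x|^β u_xx`. -/
def pointSymmetryPseudogroup (β : ℝ) : Set (OpenPartialHomeomorph Total Total) :=
  {Φ | IsPointTransformation β Φ ∧ PreservesSolutions β Φ}

/-- On `M`, the map `Φ` has the form
`t̃ = |α|^(2-β) t + a`, `x̃ = α x`, `ỹ = α |α|^(2-β) y + b`, `ũ = σ u + f(t, x, y)`
with constants `α ≠ 0`, `σ ≠ 0`, `a`, `b` and a solution `f`. -/
def HasScalingForm (β : ℝ) (Φ : Total → Total) (M : Set Total) : Prop :=
  ∃ (α σ a b : ℝ) (f : Base → ℝ), α ≠ 0 ∧ σ ≠ 0 ∧ IsSolutionOn β f (proj '' M) ∧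
    ∀ t x y u : ℝ, (t, x, y, u) ∈ M →
      Φ (t, x, y, u) =
        (|α| ^ (2 - β) * t + a, α * x, α * |α| ^ (2 - β) * y + b, σ * u + f (t, x, y))

/-- On `M`, which does not meet `x = 0`, the map `Φ` has the form
`t̃ = sgn(x) |α|^(2-β) y + a`, `x̃ = α / x`, `ỹ = sgn(x) α |α|^(2-β) t + b`,
`ũ = (σ u + f(t, x, y)) / x` with constants `α ≠ 0`, `σ ≠ 0`, `a`, `b` and a solution `f`. -/
def HasInversionForm (β : ℝ) (Φ : Total → Total) (M : Set Total) : Prop :=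
  ∃ (α σ a b : ℝ) (f : Base → ℝ), α ≠ 0 ∧ σ ≠ 0 ∧ IsSolutionOn β f (proj '' M) ∧
    ∀ t x y u : ℝ, (t, x, y, u) ∈ M → x ≠ 0 ∧
      Φ (t, x, y, u) =
        (Real.sign x * |α| ^ (2 - β) * y + a, α / x,
          Real.sign x * (α * |α| ^ (2 - β)) * t + b, (σ * u + f (t, x, y)) / x)

/-- The sets on which a transformation is described by one formula: connected open subsets
of the `(t, x, y, u)`-space whose intersections with the vertical lines
`(t, x, y) = const` are connected (possibly empty), e.g. open boxes. -/
structure IsVerticalDomain (M : Set Total) : Prop where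
  isOpen : IsOpen M
  isConnected : IsConnected M
  fibre : ∀ t x y : ℝ, IsPreconnected {u : ℝ | (t, x, y, u) ∈ M}

end UltraparabolicSymmetry

end

noncomputable section

open Filter Topology Set

namespace UltraparabolicSymmetry

/-! ### Derivatives along curves and lines. -/

section Calculus

variable {E : Type*} [NormedAddCommGroup E] [NormedSpace ℝ E]

/-! This is Lie's direct method, carried out for finite transformations. Write Φ = (T, X, Y, U). Off
x = 0 the equation fixes only h_xx, so there are local solutions h with any 1-jet at a point and any
values of h_tt, h_yy there (`exists_solution_jet`). Where the image of the graph of h is again the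
graph of some k, this k is a solution, and differentiating U = k(T, X, Y) twice along the graph
turns the equation for k into an identity in the jet of h (`jet_relation`). The jet is free, so the
identity splits. Independence of h_tt and h_yy makes T and Y functions of t, y alone
(`fderiv_x_u_eq_zero`). Comparing the dependence on h_t, h_y and h_x then gives X_u = 0, X = (Y_t +
x Y_y)/(T_t + x T_y), (T_t + x T_y)|X|^β = X_x²|x|^β, and a residual equation for U
(`determining_equations`).

So X is a Möbius map in x with coefficients depending on t, y. The logarithmic x-derivative of the
scaling equation is β T_t Y_t + (2β-5) T_y Y_t x + (β-5) T_y Y_y x² = 0. For β ≠ 0, 5 each of the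
three terms vanishes, and the nonzero Jacobian leaves T_y = Y_t = 0, or else β = 5/2 and T_t = Y_y =
0 (`DeterminingSystem.dichotomy`). In the first case T_t depends on t, Y_y on y, and (3-β) log T_t =
(2-β) log|Y_y|; for β ≠ 2, 3 both are constant. In the second case |T_y Y_t| = 1 has the same
effect. The residual equation then says that U, respectively xU, is σu + f with a solution f
(`fderiv_du_eq_zero`, `exists_solution_of_affine`).

All this needs x ≠ 0 and X ≠ 0. A limit argument shows that x ≠ 0 forces X ≠ 0
(`X_ne_zero_of_x_ne_zero`). On a connected set the quantity T_y²|xX| keeps the two branches apart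
(`hasForm_of_mem_pseudogroup`), and continuity carries the scaling form across x = 0.

Conversely, both forms intertwine the operator ∂_t + x∂_y - |x|^β ∂_x² with itself up to a
nonvanishing factor (`operator_scaling`, `operator_inversion`), so being a solution transfers point
by point (`preservesSolutions_of_forms`). -/

theorem hasDerivAt_comp_curve {f : E → ℝ} {γ δ : ℝ → E} {s₀ : ℝ}
    (hf : ContDiffAt ℝ 2 f (γ s₀)) (hγ : ∀ᶠ s in 𝓝 s₀, HasDerivAt γ (δ s) s) :
    ∀ᶠ s in 𝓝 s₀, HasDerivAt (fun s => f (γ s)) (fderiv ℝ f (γ s) (δ s)) s := by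
  have hcont : ContinuousAt γ s₀ := hγ.self_of_nhds.continuousAt
  have h1 : ∀ᶠ p in 𝓝 (γ s₀), ContDiffAt ℝ 2 f p := hf.eventually (by simp)
  filter_upwards [hγ, hcont.eventually h1] with s hs hs'
  exact (hs'.differentiableAt (by simp)).hasFDerivAt.comp_hasDerivAt s hs

/-- The second derivative along a curve is the Hessian on the velocity plus the gradient on the
acceleration. For curves on a graph the second term is where the second derivatives of h enter. -/
theorem hasDerivAt_fderiv_curve {f : E → ℝ} {γ δ : ℝ → E} {δ' : E} {s₀ : ℝ}
    (hf : ContDiffAt ℝ 2 f (γ s₀)) (hγ : HasDerivAt γ (δ s₀) s₀) (hδ : HasDerivAt δ δ' s₀) :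
    HasDerivAt (fun s => fderiv ℝ f (γ s) (δ s))
      (fderiv ℝ (fderiv ℝ f) (γ s₀) (δ s₀) (δ s₀) + fderiv ℝ f (γ s₀) δ') s₀ := by
  have h1 : ContDiffAt ℝ 1 (fderiv ℝ f) (γ s₀) := hf.fderiv_right (by norm_num)
  have h2 := (h1.differentiableAt (by simp)).hasFDerivAt.comp_hasDerivAt s₀ hγ
  exact h2.clm_apply hδ

theorem fderiv_eq_of_line {f : E → ℝ} {z v : E} {g : ℝ → ℝ} {g' : ℝ}
    (hf : ContDiffAt ℝ 2 f z) (hg : (fun s : ℝ => f (z + s • v)) =ᶠ[𝓝 0] g)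
    (hg' : HasDerivAt g g' 0) : fderiv ℝ f z v = g' := by
  have hl : HasDerivAt (fun s : ℝ => z + s • v) v 0 := by
    simpa using ((hasDerivAt_id (0 : ℝ)).smul_const v).const_add z
  have hz : z + (0 : ℝ) • v = z := by simp
  have hf' : HasFDerivAt f (fderiv ℝ f z) (z + (0 : ℝ) • v) := by
    rw [hz]; exact (hf.differentiableAt (by simp)).hasFDerivAt
  have h1 := hf'.comp_hasDerivAt 0 hl
  exact h1.unique (hg'.congr_of_eventuallyEq hg)

theorem fderiv_fderiv_eq_of_line {f : E → ℝ} {z v : E} {g g' : ℝ → ℝ} {g'' : ℝ}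
    (hf : ContDiffAt ℝ 2 f z) (hg : (fun s : ℝ => f (z + s • v)) =ᶠ[𝓝 0] g)
    (hg' : ∀ᶠ s in 𝓝 0, HasDerivAt g (g' s) s) (hg'' : HasDerivAt g' g'' 0) :
    fderiv ℝ (fderiv ℝ f) z v v = g'' := by
  have hl : ∀ s : ℝ, HasDerivAt (fun s : ℝ => z + s • v) v s := fun s => by
    simpa using ((hasDerivAt_id s).smul_const v).const_add z
  have hz : z + (0 : ℝ) • v = z := by simp
  have hf0 : ContDiffAt ℝ 2 f (z + (0 : ℝ) • v) := by rwa [hz]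
  have h1 := hasDerivAt_comp_curve (γ := fun s : ℝ => z + s • v) (δ := fun _ => v) hf0
    (Eventually.of_forall hl)
  have h2 := hasDerivAt_fderiv_curve (γ := fun s : ℝ => z + s • v) (δ := fun _ => v) hf0
    (hl 0) (hasDerivAt_const 0 v)
  simp only [hz, map_zero, add_zero] at h2
  have h3 : (fun s : ℝ => fderiv ℝ f (z + s • v) v) =ᶠ[𝓝 0] g' := by
    filter_upwards [h1, hg', hg.eventuallyEq_nhds] with s hs hs' he
    exact hs.unique (hs'.congr_of_eventuallyEq he)
  exact h2.unique (hg''.congr_of_eventuallyEq h3)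

theorem fderiv_fderiv_apply {f : E → ℝ} {p : E} (hf : ContDiffAt ℝ 2 f p) (v w : E) :
    fderiv ℝ (fun q => fderiv ℝ f q v) p w = fderiv ℝ (fderiv ℝ f) p w v := by
  have h1 : ContDiffAt ℝ 1 (fderiv ℝ f) p := hf.fderiv_right (by norm_num)
  have h2 := (h1.differentiableAt (by simp)).hasFDerivAt.clm_apply (hasFDerivAt_const v p)
  rw [h2.fderiv]
  simp

theorem fderiv_fderiv_comm {f : E → ℝ} {p : E} (hf : ContDiffAt ℝ 2 f p) (v w : E) :
    fderiv ℝ (fun q => fderiv ℝ f q v) p w = fderiv ℝ (fun q => fderiv ℝ f q w) p v := by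
  rw [fderiv_fderiv_apply hf, fderiv_fderiv_apply hf]
  exact (hf.isSymmSndFDerivAt (by simp)) w v

end Calculus

/-! ### Local solutions with a prescribed jet. -/

/-- The one-variable double antiderivative on an interval. -/
theorem exists_double_antiderivative {I : Set ℝ} (hI : IsOpen I) (hc : I.OrdConnected)
    {x₀ : ℝ} (hx₀ : x₀ ∈ I) {g : ℝ → ℝ} (hg : ContDiffOn ℝ ∞ g I) :
    ∃ F F' : ℝ → ℝ, F x₀ = 0 ∧ F' x₀ = 0 ∧ ContDiffOn ℝ ∞ F I ∧
      (∀ x ∈ I, HasDerivAt F (F' x) x) ∧ ∀ x ∈ I, HasDerivAt F' (g x) x := by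
  have key : ∀ g : ℝ → ℝ, ContDiffOn ℝ ∞ g I → ∃ F : ℝ → ℝ, F x₀ = 0 ∧ ContDiffOn ℝ ∞ F I ∧
      ∀ x ∈ I, HasDerivAt F (g x) x := by
    intro g hg
    have hd : ∀ x ∈ I, HasDerivAt (fun x => ∫ s in x₀..x, g s) (g x) x := by
      intro x hx
      have hsub : uIcc x₀ x ⊆ I := hc.uIcc_subset hx₀ hx
      apply intervalIntegral.integral_hasDerivAt_right
      · exact (hg.continuousOn.mono hsub).intervalIntegrable
      · exact hg.continuousOn.stronglyMeasurableAtFilter hI x hx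
      · exact hg.continuousOn.continuousAt (hI.mem_nhds hx)
    refine ⟨fun x => ∫ s in x₀..x, g s, by simp, ?_, hd⟩
    rw [contDiffOn_infty_iff_deriv_of_isOpen hI]
    refine ⟨fun x hx => (hd x hx).differentiableAt.differentiableWithinAt, ?_⟩
    exact hg.congr fun x hx => (hd x hx).deriv
  obtain ⟨F', h0, hs, hd⟩ := key g hg
  obtain ⟨F, h0', hs', hd'⟩ := key F' hs
  exact ⟨F, F', h0', h0, hs', hd', hd⟩

theorem contDiffAt_abs_rpow {x : ℝ} (hx : x ≠ 0) (β : ℝ) :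
    ContDiffAt ℝ ∞ (fun s : ℝ => |s| ^ β) x :=
  (contDiffAt_abs hx).rpow_const_of_ne (abs_ne_zero.mpr hx)

theorem two_le_infty : (2 : WithTop ℕ∞) ≤ ∞ :=
  WithTop.coe_le_coe.mpr le_top

theorem deriv_line_t {h : Base → ℝ} {t x y : ℝ} (hd : DifferentiableAt ℝ h (t, x, y)) :
    HasDerivAt (fun s => h (s, x, y)) (fderiv ℝ h (t, x, y) (1, 0, 0)) t :=
  hd.hasFDerivAt.comp_hasDerivAt t
    ((hasDerivAt_id t).prodMk ((hasDerivAt_const t x).prodMk (hasDerivAt_const t y)))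

theorem deriv_line_y {h : Base → ℝ} {t x y : ℝ} (hd : DifferentiableAt ℝ h (t, x, y)) :
    HasDerivAt (fun s => h (t, x, s)) (fderiv ℝ h (t, x, y) (0, 0, 1)) y :=
  hd.hasFDerivAt.comp_hasDerivAt (f := fun s => ((t, x, s) : Base)) y
    ((hasDerivAt_const y t).prodMk ((hasDerivAt_const y x).prodMk (hasDerivAt_id y)))

theorem deriv_deriv_line_x {h : Base → ℝ} {t x y : ℝ} (hd : ContDiffAt ℝ 2 h (t, x, y)) :
    deriv (deriv (fun s => h (t, s, y))) x
      = fderiv ℝ (fderiv ℝ h) (t, x, y) (0, 1, 0) (0, 1, 0) := by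
  have hγ : ∀ s : ℝ, HasDerivAt (fun s : ℝ => ((t, s, y) : Base)) (0, 1, 0) s := fun s =>
    (hasDerivAt_const s t).prodMk ((hasDerivAt_id s).prodMk (hasDerivAt_const s y))
  have h1 := hasDerivAt_comp_curve (γ := fun s : ℝ => ((t, s, y) : Base))
    (δ := fun _ => (0, 1, 0)) hd (Eventually.of_forall hγ)
  have h2 := hasDerivAt_fderiv_curve (γ := fun s : ℝ => ((t, s, y) : Base))
    (δ := fun _ => (0, 1, 0)) hd (hγ x) (hasDerivAt_const x _)
  rw [map_zero, add_zero] at h2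
  have h3 : deriv (fun s => h (t, s, y)) =ᶠ[𝓝 x] fun s => fderiv ℝ h (t, s, y) (0, 1, 0) :=
    h1.mono fun s hs => hs.deriv
  rw [h3.deriv_eq]
  exact h2.deriv

/-- The equation at a point, in terms of Fréchet derivatives. -/
theorem equation_iff_fderiv {β : ℝ} {h : Base → ℝ} {t x y : ℝ}
    (hd : ContDiffAt ℝ 2 h (t, x, y)) :
    (deriv (fun s => h (s, x, y)) t + x * deriv (fun s => h (t, x, s)) y
        = |x| ^ β * deriv (deriv (fun s => h (t, s, y))) x) ↔
    fderiv ℝ h (t, x, y) (1, 0, 0) + x * fderiv ℝ h (t, x, y) (0, 0, 1)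
      = |x| ^ β * fderiv ℝ (fderiv ℝ h) (t, x, y) (0, 1, 0) (0, 1, 0) := by
  have h1 := hd.differentiableAt (by simp)
  rw [(deriv_line_t h1).deriv, (deriv_line_y h1).deriv, deriv_deriv_line_x hd]

theorem exists_interval_of_ne_zero {x₀ : ℝ} (hx₀ : x₀ ≠ 0) :
    ∃ I : Set ℝ, IsOpen I ∧ I.OrdConnected ∧ x₀ ∈ I ∧ ∀ x ∈ I, x ≠ 0 := by
  rcases hx₀.lt_or_gt with h | h
  · exact ⟨Iio 0, isOpen_Iio, ordConnected_Iio, h, fun x hx => ne_of_lt hx⟩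
  · exact ⟨Ioi 0, isOpen_Ioi, ordConnected_Ioi, h, fun x hx => ne_of_gt hx⟩

/-- Off `x = 0` there are solutions with an arbitrary 1-jet at a given point, and with
prescribed values of the second derivatives `h_tt` and `h_yy`. -/
theorem exists_solution_jet (β t₀ y₀ u₀ c₁ c₂ c₃ e₁ e₂ : ℝ) {x₀ : ℝ} (hx₀ : x₀ ≠ 0) :
    ∃ (h : Base → ℝ) (Ω : Set Base), IsOpen Ω ∧ (t₀, x₀, y₀) ∈ Ω ∧ IsSolutionOn β h Ω ∧
      h (t₀, x₀, y₀) = u₀ ∧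
      (∀ v : Base, fderiv ℝ h (t₀, x₀, y₀) v = c₁ * v.1 + c₃ * v.2.1 + c₂ * v.2.2) ∧
      ∀ v : Base, fderiv ℝ (fderiv ℝ h) (t₀, x₀, y₀) v v
        = |x₀| ^ (-β) * (c₁ + c₂ * x₀) * v.2.1 ^ 2 + 2 * e₁ * v.1 ^ 2 + 2 * e₂ * v.2.2 ^ 2 := by
  obtain ⟨I, hI, hIc, hxI, hI0⟩ := exists_interval_of_ne_zero hx₀
  have hκ : ContDiffOn ℝ ∞ (fun s : ℝ => |s| ^ (-β)) I := fun x hx =>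
    (contDiffAt_abs_rpow (hI0 x hx) _).contDiffWithinAt
  obtain ⟨F, F', hF0, hF0', hFs, hF, hF'⟩ := exists_double_antiderivative hI hIc hxI
    (g := fun s => |s| ^ (-β) * (c₁ + c₂ * s)) (hκ.mul (by fun_prop))
  obtain ⟨A, A', hA0, hA0', hAs, hA, hA'⟩ := exists_double_antiderivative hI hIc hxI hκ
  obtain ⟨B, B', hB0, hB0', hBs, hB, hB'⟩ := exists_double_antiderivative hI hIc hxI
    (g := fun s => |s| ^ (-β) * (2 * A s)) (hκ.mul (by fun_prop))
  obtain ⟨C, C', hC0, hC0', hCs, hC, hC'⟩ := exists_double_antiderivative hI hIc hxI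
    (g := fun s => |s| ^ (-β) * s) (hκ.mul (by fun_prop))
  obtain ⟨D, D', hD0, hD0', hDs, hD, hD'⟩ := exists_double_antiderivative hI hIc hxI
    (g := fun s => |s| ^ (-β) * (2 * s * C s)) (hκ.mul (by fun_prop))
  -- The e₁ and e₂ brackets are analogues of heat polynomials: the corrections A, B and C, D absorb
  -- what the operator leaves of (t-t₀)² and (y-y₀)². All antiderivatives vanish to first order at
  -- x₀, so they disturb neither the 1-jet nor h_tt, h_yy, and produce no mixed second derivatives
  -- there.
  set h : Base → ℝ := fun z => u₀ + c₁ * (z.1 - t₀) + c₃ * (z.2.1 - x₀) + c₂ * (z.2.2 - y₀)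
    + F z.2.1 + e₁ * ((z.1 - t₀) ^ 2 + 2 * (z.1 - t₀) * A z.2.1 + B z.2.1)
    + e₂ * ((z.2.2 - y₀) ^ 2 + 2 * (z.2.2 - y₀) * C z.2.1 + D z.2.1) with hh
  set Ω : Set Base := {z | z.2.1 ∈ I} with hΩ
  have hπ : ContDiffOn ℝ ∞ (fun z : Base => z.2.1) Ω := by fun_prop
  have hm : MapsTo (fun z : Base => z.2.1) Ω I := fun z hz => hz
  have hsm : ContDiffOn ℝ ∞ h Ω := by
    have h1 := hFs.comp hπ hm
    have h2 := hAs.comp hπ hm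
    have h3 := hBs.comp hπ hm
    have h4 := hCs.comp hπ hm
    have h5 := hDs.comp hπ hm
    have key : ∀ f₁ f₂ f₃ f₄ f₅ : Base → ℝ, ContDiffOn ℝ ∞ f₁ Ω → ContDiffOn ℝ ∞ f₂ Ω →
        ContDiffOn ℝ ∞ f₃ Ω → ContDiffOn ℝ ∞ f₄ Ω → ContDiffOn ℝ ∞ f₅ Ω →
        ContDiffOn ℝ ∞ (fun z : Base => u₀ + c₁ * (z.1 - t₀) + c₃ * (z.2.1 - x₀)
          + c₂ * (z.2.2 - y₀) + f₁ z + e₁ * ((z.1 - t₀) ^ 2 + 2 * (z.1 - t₀) * f₂ z + f₃ z)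
          + e₂ * ((z.2.2 - y₀) ^ 2 + 2 * (z.2.2 - y₀) * f₄ z + f₅ z)) Ω := by
      intros
      fun_prop
    exact key _ _ _ _ _ h1 h2 h3 h4 h5
  have hΩo : IsOpen Ω := hI.preimage (by fun_prop)
  have hz0 : (t₀, x₀, y₀) ∈ Ω := hxI
  have h2 : ContDiffAt ℝ 2 h (t₀, x₀, y₀) :=
    (hsm.contDiffAt (hΩo.mem_nhds hz0)).of_le two_le_infty
  refine ⟨h, Ω, hΩo, hz0, ⟨hsm, ?_⟩, by simp [hh, hF0, hB0, hD0], ?_⟩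
  · intro t x y hz
    have hx : x ∈ I := hz
    have d1 : HasDerivAt (fun s => h (s, x, y)) (c₁ + e₁ * (2 * (t - t₀) + 2 * A x)) t := by
      simp only [hh]
      have hs : HasDerivAt (fun s : ℝ => s - t₀) 1 t := (hasDerivAt_id t).sub_const t₀
      have := (((((((hs.const_mul c₁).const_add u₀).add_const (c₃ * (x - x₀))).add_const
        (c₂ * (y - y₀))).add_const (F x)).add
        ((((hs.pow 2).add ((hs.const_mul 2).mul_const (A x))).add_const (B x)).const_mul
          e₁)).add_const (e₂ * ((y - y₀) ^ 2 + 2 * (y - y₀) * C x + D x)))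
      refine this.congr_deriv ?_
      simp
    have d2 : HasDerivAt (fun s => h (t, x, s)) (c₂ + e₂ * (2 * (y - y₀) + 2 * C x)) y := by
      simp only [hh]
      have hs : HasDerivAt (fun s : ℝ => s - y₀) 1 y := (hasDerivAt_id y).sub_const y₀
      have := ((((hs.const_mul c₂).const_add (u₀ + c₁ * (t - t₀) + c₃ * (x - x₀))).add_const
        (F x)).add_const (e₁ * ((t - t₀) ^ 2 + 2 * (t - t₀) * A x + B x))).add
        ((((hs.pow 2).add ((hs.const_mul 2).mul_const (C x))).add_const (D x)).const_mul e₂)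
      refine this.congr_deriv ?_
      simp
    have d3 : ∀ s ∈ I, HasDerivAt (fun s => h (t, s, y)) (c₃ + F' s
        + e₁ * (2 * (t - t₀) * A' s + B' s) + e₂ * (2 * (y - y₀) * C' s + D' s)) s := by
      intro s hs
      simp only [hh]
      have hid : HasDerivAt (fun s : ℝ => s - x₀) 1 s := (hasDerivAt_id s).sub_const x₀
      have := (((((hid.const_mul c₃).const_add (u₀ + c₁ * (t - t₀))).add_const
        (c₂ * (y - y₀))).add (hF s hs)).add
        (((((hA s hs).const_mul (2 * (t - t₀))).const_add ((t - t₀) ^ 2)).add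
          (hB s hs)).const_mul e₁)).add
        (((((hC s hs).const_mul (2 * (y - y₀))).const_add ((y - y₀) ^ 2)).add
          (hD s hs)).const_mul e₂)
      refine this.congr_deriv ?_
      simp
    have d4 : HasDerivAt (fun s => c₃ + F' s
        + e₁ * (2 * (t - t₀) * A' s + B' s) + e₂ * (2 * (y - y₀) * C' s + D' s))
        (|x| ^ (-β) * ((c₁ + c₂ * x) + e₁ * (2 * (t - t₀) + 2 * A x)
          + e₂ * (2 * (y - y₀) * x + 2 * x * C x))) x := by
      have := (((hF' x hx).const_add c₃).add
        ((((hA' x hx).const_mul (2 * (t - t₀))).add (hB' x hx)).const_mul e₁)).add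
        ((((hC' x hx).const_mul (2 * (y - y₀))).add (hD' x hx)).const_mul e₂)
      refine this.congr_deriv ?_
      ring
    have d3' : deriv (fun s => h (t, s, y)) =ᶠ[𝓝 x] fun s => c₃ + F' s
        + e₁ * (2 * (t - t₀) * A' s + B' s) + e₂ * (2 * (y - y₀) * C' s + D' s) :=
      eventually_of_mem (hI.mem_nhds hx) fun s hs => (d3 s hs).deriv
    rw [d1.deriv, d2.deriv, d3'.deriv_eq, d4.deriv, ← mul_assoc, ← Real.rpow_add
      (abs_pos.mpr (hI0 x hx))]
    simp
    ring
  · have hIv : ∀ v : Base, ∀ᶠ s in 𝓝 (0 : ℝ), x₀ + s * v.2.1 ∈ I := fun v => by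
      have : ContinuousAt (fun s : ℝ => x₀ + s * v.2.1) 0 := by fun_prop
      exact this.eventually (by simpa using hI.mem_nhds hxI)
    have main : ∀ v : Base, ∃ g' : ℝ → ℝ,
        (∀ᶠ s in 𝓝 (0 : ℝ), HasDerivAt (fun s : ℝ => h ((t₀, x₀, y₀) + s • v)) (g' s) s) ∧
        g' 0 = c₁ * v.1 + c₃ * v.2.1 + c₂ * v.2.2 ∧
        HasDerivAt g' (|x₀| ^ (-β) * (c₁ + c₂ * x₀) * v.2.1 ^ 2 + 2 * e₁ * v.1 ^ 2
          + 2 * e₂ * v.2.2 ^ 2) 0 := by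
      intro v
      obtain ⟨a, b, c⟩ := v
      have hl : ∀ s : ℝ, HasDerivAt (fun s : ℝ => x₀ + s * b) b s := fun s => by
        simpa using ((hasDerivAt_id s).mul_const b).const_add x₀
      have hco : ∀ {K K' : ℝ → ℝ}, (∀ x ∈ I, HasDerivAt K (K' x) x) → ∀ s : ℝ,
          x₀ + s * b ∈ I → HasDerivAt (fun s => K (x₀ + s * b)) (K' (x₀ + s * b) * b) s :=
        fun hK s hs => (hK _ hs).comp s (hl s)
      refine ⟨fun s => c₁ * a + c₃ * b + c₂ * c + F' (x₀ + s * b) * b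
        + e₁ * (2 * s * a ^ 2 + 2 * a * (A (x₀ + s * b) + s * (A' (x₀ + s * b) * b))
          + B' (x₀ + s * b) * b)
        + e₂ * (2 * s * c ^ 2 + 2 * c * (C (x₀ + s * b) + s * (C' (x₀ + s * b) * b))
          + D' (x₀ + s * b) * b), ?_, ?_, ?_⟩
      · filter_upwards [hIv (a, b, c)] with s hs
        simp only [hh, Prod.smul_mk, Prod.mk_add_mk, smul_eq_mul, add_sub_cancel_left]
        have hid := hasDerivAt_id' s
        have l1 := hid.mul_const a
        have l2 := hid.mul_const b
        have l3 := hid.mul_const c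
        have := ((((((l1.const_mul c₁).const_add u₀).add (l2.const_mul c₃)).add
          (l3.const_mul c₂)).add (hco hF s hs)).add
          ((((l1.pow 2).add ((l1.const_mul 2).mul (hco hA s hs))).add
            (hco hB s hs)).const_mul e₁)).add
          ((((l3.pow 2).add ((l3.const_mul 2).mul (hco hC s hs))).add
            (hco hD s hs)).const_mul e₂)
        refine this.congr_deriv ?_
        simp
        ring
      · simp [hF0', hA0, hC0, hB0', hD0']
      · have hs : x₀ + 0 * b ∈ I := by simpa using hxI
        have hid := hasDerivAt_id' (0 : ℝ)
        have := ((((hco hF' 0 hs).mul_const b).const_add (c₁ * a + c₃ * b + c₂ * c)).add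
          (((((hid.const_mul 2).mul_const (a ^ 2)).add
            (((hco hA 0 hs).add (hid.mul ((hco hA' 0 hs).mul_const b))).const_mul (2 * a))).add
            ((hco hB' 0 hs).mul_const b)).const_mul e₁)).add
          (((((hid.const_mul 2).mul_const (c ^ 2)).add
            (((hco hC 0 hs).add (hid.mul ((hco hC' 0 hs).mul_const b))).const_mul (2 * c))).add
            ((hco hD' 0 hs).mul_const b)).const_mul e₂)
        refine this.congr_deriv ?_
        simp [hA0, hA0', hC0, hC0']
        ring
    constructor <;> intro v <;> obtain ⟨g', hg, h0, hg'⟩ := main v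
    · rw [fderiv_eq_of_line h2 EventuallyEq.rfl hg.self_of_nhds, h0]
    · exact fderiv_fderiv_eq_of_line h2 EventuallyEq.rfl hg hg'

/-! ### Transformed graphs and the relation between jets. -/

/-- The point of the graph of `h` over `z`. -/
def lift (h : Base → ℝ) (z : Base) : Total := (z.1, z.2.1, z.2.2, h z)

theorem contDiffOn_lift {h : Base → ℝ} {Ω : Set Base} (hh : ContDiffOn ℝ ∞ h Ω) :
    ContDiffOn ℝ ∞ (lift h) Ω := by
  unfold lift
  fun_prop

theorem contDiff_proj : ContDiff ℝ ∞ proj := by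
  unfold proj
  fun_prop

/-- The condition `hinj` makes z ↦ (t̃, x̃, ỹ) along the graph a local diffeomorphism, so near the
given point the image of the graph is again a graph, and the symmetry property of Φ applies to it.
-/
theorem exists_transformed_solution {β : ℝ} {Φ : OpenPartialHomeomorph Total Total}
    (hΦ : Φ ∈ pointSymmetryPseudogroup β) {h : Base → ℝ} {Ω₀ : Set Base} {z₀ : Base}
    (hΩ₀ : IsOpen Ω₀) (hz₀ : z₀ ∈ Ω₀) (hh : IsSolutionOn β h Ω₀)
    (hs : lift h z₀ ∈ Φ.source)
    (hinj : ∀ v, fderiv ℝ (fun z => proj (Φ (lift h z))) z₀ v = 0 → v = 0) :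
    ∃ (k : Base → ℝ) (Ω' : Set Base), IsOpen Ω' ∧ proj (Φ (lift h z₀)) ∈ Ω' ∧
      IsSolutionOn β k Ω' ∧
      ∀ᶠ z in 𝓝 z₀, k (proj (Φ (lift h z))) = (Φ (lift h z)).2.2.2 := by
  set G : Base → Base := fun z => proj (Φ (lift h z)) with hG
  have hlift := contDiffOn_lift hh.1
  set S : Set Base := Ω₀ ∩ lift h ⁻¹' Φ.source with hS
  have hSo : IsOpen S := hlift.continuousOn.isOpen_inter_preimage hΩ₀ Φ.open_source
  have hz₀S : z₀ ∈ S := ⟨hz₀, hs⟩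
  have hΦl : ContDiffOn ℝ ∞ (fun z => Φ (lift h z)) S :=
    hΦ.1.contDiffOn.comp (hlift.mono inter_subset_left) fun z hz => hz.2
  have hGs : ContDiffOn ℝ ∞ G S := contDiff_proj.comp_contDiffOn hΦl
  have hGat : ∀ z ∈ S, ContDiffAt ℝ ∞ G z := fun z hz => hGs.contDiffAt (hSo.mem_nhds hz)
  have hGd : ∀ z ∈ S, HasFDerivAt G (fderiv ℝ G z) z := fun z hz =>
    ((hGat z hz).differentiableAt (by simp)).hasFDerivAt
  set L : Base ≃L[ℝ] Base := (LinearEquiv.ofInjectiveEndo (fderiv ℝ G z₀ : Base →ₗ[ℝ] Base)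
    ((injective_iff_map_eq_zero _).mpr hinj)).toContinuousLinearEquiv with hL
  have hLc : (L : Base →L[ℝ] Base) = fderiv ℝ G z₀ := by
    exact ContinuousLinearMap.ext fun v => rfl
  have hd0 : HasFDerivAt G (L : Base →L[ℝ] Base) z₀ := hLc ▸ hGd z₀ hz₀S
  set e := (hGat z₀ hz₀S).toOpenPartialHomeomorph G hd0 (by simp) with he
  have heG : ∀ z, e z = G z := fun z => rfl
  have hze : z₀ ∈ e.source := (hGat z₀ hz₀S).mem_toOpenPartialHomeomorph_source hd0 (by simp)
  have hcont : ContinuousOn (fderiv ℝ G) S :=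
    hGs.continuousOn_fderiv_of_isOpen hSo (by simp)
  -- The symmetry condition asks for smoothness of k on its whole open domain, so Ω is cut down to
  -- points where the derivative of G is invertible; there the local inverse is smooth.
  set W : Set Base := S ∩ fderiv ℝ G ⁻¹' range ((↑) : (Base ≃L[ℝ] Base) → Base →L[ℝ] Base)
    with hW
  have hWo : IsOpen W := hcont.isOpen_inter_preimage hSo ContinuousLinearEquiv.isOpen
  set Ω : Set Base := e.source ∩ W with hΩ
  have hΩo : IsOpen Ω := e.open_source.inter hWo
  have hzΩ : z₀ ∈ Ω := ⟨hze, hz₀S, L, hLc⟩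
  have hΩ'o : IsOpen (e '' Ω) := e.isOpen_image_of_subset_source hΩo inter_subset_left
  set k : Base → ℝ := fun w => (Φ (lift h (e.symm w))).2.2.2 with hk
  have hkG : ∀ z ∈ Ω, k (G z) = (Φ (lift h z)).2.2.2 := fun z hz => by
    rw [hk, ← heG]
    simp only [e.left_inv hz.1]
  have hks : ContDiffOn ℝ ∞ k (e '' Ω) := by
    rintro w ⟨z, hz, rfl⟩
    obtain ⟨Lz, hLz⟩ := hz.2.2
    have hsz : e.symm (e z) = z := e.left_inv hz.1
    have h1 : ContDiffAt ℝ ∞ e.symm (e z) := by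
      apply e.contDiffAt_symm (e.map_source hz.1) (f₀' := Lz)
      · rw [hsz, hLz]; exact hGd z hz.2.1
      · rw [hsz]; exact hGat z hz.2.1
    have h2 : ContDiffAt ℝ ∞ (fun z => (Φ (lift h z)).2.2.2) (e.symm (e z)) := by
      rw [hsz]
      exact ((hΦl.contDiffAt (hSo.mem_nhds hz.2.1)).snd.snd).snd
    exact (h2.comp (e z) h1).contDiffWithinAt
  have himg : Φ '' graphOver h Ω = graphOver k (e '' Ω) := by
    have hpt : ∀ z ∈ Ω, Φ (lift h z) = lift k (e z) := fun z hz => by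
      have h1 := hkG z hz
      have h2 : e z = proj (Φ (lift h z)) := heG z
      rw [← heG] at h1
      simp only [lift] at h1 ⊢
      rw [h1, h2]
      rfl
    ext q
    constructor
    · rintro ⟨_, ⟨z, hz, rfl⟩, rfl⟩
      exact ⟨e z, mem_image_of_mem _ hz, (hpt z hz).symm⟩
    · rintro ⟨_, ⟨z, hz, rfl⟩, rfl⟩
      exact ⟨lift h z, ⟨z, hz, rfl⟩, hpt z hz⟩
  have hsub : Ω ⊆ Ω₀ := fun z hz => hz.2.1.1
  have hsol := hΦ.2 Ω (e '' Ω) h k hΩo hΩ'o (hh.1.mono hsub) hks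
    (by rintro _ ⟨z, hz, rfl⟩; exact hz.2.1.2) himg
  refine ⟨k, e '' Ω, hΩ'o, mem_image_of_mem _ hzΩ, hsol.mp ⟨hh.1.mono hsub, ?_⟩, ?_⟩
  · exact fun t x y hz => hh.2 t x y (hsub hz)
  · exact eventually_of_mem (hΩo.mem_nhds hzΩ) hkG

/-- The tangent vector over `v` of the graph of a function with gradient `(c₁, c₃, c₂)`. -/
def jetVec (c₁ c₂ c₃ : ℝ) (v : Base) : Total :=
  (v.1, v.2.1, v.2.2, c₁ * v.1 + c₃ * v.2.1 + c₂ * v.2.2)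

/-- The second derivative of `f` at `p` in direction `V`. -/
def D2 (f : Total → ℝ) (p V : Total) : ℝ := fderiv ℝ (fderiv ℝ f) p V V

/-- The numbers qT, qX, qY are the first derivatives of the transformed solution k, and the first
conclusion is the chain rule for U = k(T, X, Y) on the graph. A vector v that is mapped to ∂_x̃
makes the Hessian term of the second derivative exactly k_x̃x̃, which the equation for k replaces by
first derivatives. Here η is the second derivative of h along v, the only place where e₁ and e₂
occur. -/
theorem jet_relation {β : ℝ} {Φ : OpenPartialHomeomorph Total Total}
    (hΦ : Φ ∈ pointSymmetryPseudogroup β) {T X Y U : Total → ℝ}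
    (hΦc : ∀ p, Φ p = (T p, X p, Y p, U p)) {t x y u : ℝ}
    (hp : (t, x, y, u) ∈ Φ.source) (hx : x ≠ 0) (c₁ c₂ c₃ e₁ e₂ : ℝ)
    (hinj : ∀ v : Base, fderiv ℝ T (t, x, y, u) (jetVec c₁ c₂ c₃ v) = 0 →
      fderiv ℝ X (t, x, y, u) (jetVec c₁ c₂ c₃ v) = 0 →
      fderiv ℝ Y (t, x, y, u) (jetVec c₁ c₂ c₃ v) = 0 → v = 0) :
    ∃ qT qX qY : ℝ,
      (∀ v : Base, fderiv ℝ U (t, x, y, u) (jetVec c₁ c₂ c₃ v)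
        = qT * fderiv ℝ T (t, x, y, u) (jetVec c₁ c₂ c₃ v)
          + qX * fderiv ℝ X (t, x, y, u) (jetVec c₁ c₂ c₃ v)
          + qY * fderiv ℝ Y (t, x, y, u) (jetVec c₁ c₂ c₃ v)) ∧
      ∀ v : Base, fderiv ℝ T (t, x, y, u) (jetVec c₁ c₂ c₃ v) = 0 →
        fderiv ℝ X (t, x, y, u) (jetVec c₁ c₂ c₃ v) = 1 →
        fderiv ℝ Y (t, x, y, u) (jetVec c₁ c₂ c₃ v) = 0 → ∀ η : ℝ,
        η = |x| ^ (-β) * (c₁ + c₂ * x) * v.2.1 ^ 2 + 2 * e₁ * v.1 ^ 2 + 2 * e₂ * v.2.2 ^ 2 →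
        qT + X (t, x, y, u) * qY = |X (t, x, y, u)| ^ β *
          (D2 U (t, x, y, u) (jetVec c₁ c₂ c₃ v) + fderiv ℝ U (t, x, y, u) (0, 0, 0, η)
          - (qT * (D2 T (t, x, y, u) (jetVec c₁ c₂ c₃ v)
              + fderiv ℝ T (t, x, y, u) (0, 0, 0, η))
            + qX * (D2 X (t, x, y, u) (jetVec c₁ c₂ c₃ v)
              + fderiv ℝ X (t, x, y, u) (0, 0, 0, η))
            + qY * (D2 Y (t, x, y, u) (jetVec c₁ c₂ c₃ v)
              + fderiv ℝ Y (t, x, y, u) (0, 0, 0, η)))) := by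
  obtain ⟨h, Ω₀, hΩ₀, hz₀, hh, hu, hj1, hj2⟩ := exists_solution_jet β t y u c₁ c₂ c₃ e₁ e₂ hx
  set p : Total := (t, x, y, u) with hpdef
  set z₀ : Base := (t, x, y) with hz₀def
  have hlz : lift h z₀ = p := by simp only [lift, hz₀def, hpdef, ← hu]
  have hΦat : ContDiffAt ℝ ∞ Φ p := hΦ.1.contDiffOn.contDiffAt (Φ.open_source.mem_nhds hp)
  have hT : ContDiffAt ℝ 2 T p :=
    ((hΦat.fst).congr_of_eventuallyEq (.of_forall fun q => by simp [hΦc])).of_le two_le_infty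
  have hX : ContDiffAt ℝ 2 X p := ((hΦat.snd.fst).congr_of_eventuallyEq
    (.of_forall fun q => by simp [hΦc])).of_le two_le_infty
  have hY : ContDiffAt ℝ 2 Y p := ((hΦat.snd.snd.fst).congr_of_eventuallyEq
    (.of_forall fun q => by simp [hΦc])).of_le two_le_infty
  have hU : ContDiffAt ℝ 2 U p := ((hΦat.snd.snd.snd).congr_of_eventuallyEq
    (.of_forall fun q => by simp [hΦc])).of_le two_le_infty
  have hhat : ContDiffAt ℝ 2 h z₀ := (hh.1.contDiffAt (hΩ₀.mem_nhds hz₀)).of_le two_le_infty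
  -- the curve on the graph over a straight line
  have hl : ∀ (v : Base) (s : ℝ), HasDerivAt (fun s : ℝ => z₀ + s • v) v s := fun v s => by
    simpa using ((hasDerivAt_id s).smul_const v).const_add z₀
  have hl0 : ∀ v : Base, z₀ + (0 : ℝ) • v = z₀ := fun v => by simp
  have hγ : ∀ v : Base, ∀ᶠ s in 𝓝 (0 : ℝ), HasDerivAt (fun s : ℝ => lift h (z₀ + s • v))
      (v.1, v.2.1, v.2.2, fderiv ℝ h (z₀ + s • v) v) s := fun v => by
    have h1 := hasDerivAt_comp_curve (γ := fun s : ℝ => z₀ + s • v) (δ := fun _ => v)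
      (s₀ := 0) (by rwa [hl0]) (Eventually.of_forall (hl v))
    filter_upwards [h1] with s hs
    have h2 := hl v s
    exact h2.fst.prodMk (h2.snd.fst.prodMk (h2.snd.snd.prodMk hs))
  have hδ : ∀ v : Base, HasDerivAt
      (fun s : ℝ => ((v.1, v.2.1, v.2.2, fderiv ℝ h (z₀ + s • v) v) : Total))
      (0, 0, 0, fderiv ℝ (fderiv ℝ h) z₀ v v) 0 := fun v => by
    have h1 := hasDerivAt_fderiv_curve (γ := fun s : ℝ => z₀ + s • v) (δ := fun _ => v)
      (s₀ := 0) (by rwa [hl0]) (hl v 0) (hasDerivAt_const _ _)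
    simp only [hl0, map_zero, add_zero] at h1
    exact (hasDerivAt_const _ _).prodMk ((hasDerivAt_const _ _).prodMk
      ((hasDerivAt_const _ _).prodMk h1))
  have hjv : ∀ v : Base, ((v.1, v.2.1, v.2.2, fderiv ℝ h (z₀ + (0 : ℝ) • v) v) : Total)
      = jetVec c₁ c₂ c₃ v := fun v => by rw [hl0, hj1]; rfl
  have hγ0 : ∀ v : Base, lift h (z₀ + (0 : ℝ) • v) = p := fun v => by rw [hl0, hlz]
  have hfirst : ∀ (f : Total → ℝ), ContDiffAt ℝ 2 f p → ∀ v : Base,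
      ∀ᶠ s in 𝓝 (0 : ℝ), HasDerivAt (fun s : ℝ => f (lift h (z₀ + s • v)))
        (fderiv ℝ f (lift h (z₀ + s • v))
          (v.1, v.2.1, v.2.2, fderiv ℝ h (z₀ + s • v) v)) s := fun f hf v =>
    hasDerivAt_comp_curve (γ := fun s : ℝ => lift h (z₀ + s • v))
      (δ := fun s => (v.1, v.2.1, v.2.2, fderiv ℝ h (z₀ + s • v) v)) (by rwa [hγ0]) (hγ v)
  have hsecond : ∀ (f : Total → ℝ), ContDiffAt ℝ 2 f p → ∀ v : Base,
      HasDerivAt (fun s : ℝ => fderiv ℝ f (lift h (z₀ + s • v))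
          (v.1, v.2.1, v.2.2, fderiv ℝ h (z₀ + s • v) v))
        (D2 f p (jetVec c₁ c₂ c₃ v)
          + fderiv ℝ f p (0, 0, 0, fderiv ℝ (fderiv ℝ h) z₀ v v)) 0 := fun f hf v => by
    have h1 := hasDerivAt_fderiv_curve (f := f) (γ := fun s : ℝ => lift h (z₀ + s • v))
      (δ := fun s => (v.1, v.2.1, v.2.2, fderiv ℝ h (z₀ + s • v) v)) (by rwa [hγ0])
      (hγ v).self_of_nhds (hδ v)
    rw [hγ0, hjv] at h1
    exact h1
  have hfirst0 : ∀ (f : Total → ℝ), ContDiffAt ℝ 2 f p → ∀ v : Base,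
      HasDerivAt (fun s : ℝ => f (lift h (z₀ + s • v))) (fderiv ℝ f p (jetVec c₁ c₂ c₃ v)) 0 :=
    fun f hf v => by
      have h1 := (hfirst f hf v).self_of_nhds
      rwa [hγ0, hjv] at h1
  have hZ : ∀ z, proj (Φ (lift h z)) = (T (lift h z), X (lift h z), Y (lift h z)) := fun z => by
    rw [hΦc]; rfl
  -- nondegeneracy of the transformed independent variables
  have hGdiff : DifferentiableAt ℝ (fun z => proj (Φ (lift h z))) z₀ := by
    have h1 : DifferentiableAt ℝ (lift h) z₀ :=
      ((contDiffOn_lift hh.1).contDiffAt (hΩ₀.mem_nhds hz₀)).differentiableAt (by simp)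
    have h2 : DifferentiableAt ℝ Φ (lift h z₀) := by
      rw [hlz]; exact hΦat.differentiableAt (by simp)
    exact (contDiff_proj.differentiable (by simp) _).comp z₀ (h2.comp z₀ h1)
  have hGv : ∀ v, fderiv ℝ (fun z => proj (Φ (lift h z))) z₀ v
      = (fderiv ℝ T p (jetVec c₁ c₂ c₃ v), fderiv ℝ X p (jetVec c₁ c₂ c₃ v),
          fderiv ℝ Y p (jetVec c₁ c₂ c₃ v)) := fun v => by
    have h1 : HasDerivAt (fun s : ℝ => proj (Φ (lift h (z₀ + s • v))))
        (fderiv ℝ (fun z => proj (Φ (lift h z))) z₀ v) 0 := by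
      have h2 : HasFDerivAt (fun z => proj (Φ (lift h z)))
          (fderiv ℝ (fun z => proj (Φ (lift h z))) z₀) (z₀ + (0 : ℝ) • v) := by
        rw [hl0]; exact hGdiff.hasFDerivAt
      exact h2.comp_hasDerivAt 0 (hl v 0)
    simp only [hZ] at h1 ⊢
    exact h1.unique ((hfirst0 T hT v).prodMk ((hfirst0 X hX v).prodMk (hfirst0 Y hY v)))
  obtain ⟨k, Ω', hΩ', hw, hk, hkU⟩ := exists_transformed_solution hΦ hΩ₀ hz₀ hh
    (by rw [hlz]; exact hp) (fun v hv => by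
      rw [hGv] at hv
      simp only [Prod.mk_eq_zero] at hv
      exact hinj v hv.1 hv.2.1 hv.2.2)
  simp only [hΦc, proj] at hw hkU
  rw [hlz] at hw
  have hkat : ContDiffAt ℝ 2 k (T p, X p, Y p) :=
    (hk.1.contDiffAt (hΩ'.mem_nhds hw)).of_le two_le_infty
  have heq := (equation_iff_fderiv hkat).mp (hk.2 _ _ _ hw)
  set K := fderiv ℝ k (T p, X p, Y p) with hK
  have hKlin : ∀ a b c : ℝ, K (a, b, c) = K (1, 0, 0) * a + K (0, 1, 0) * b + K (0, 0, 1) * c :=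
    fun a b c => by
      have : ((a, b, c) : Base) = a • (1, 0, 0) + b • (0, 1, 0) + c • (0, 0, 1) := by simp
      rw [this]
      simp only [map_add, map_smul, smul_eq_mul]
      ring
  have hkUv : ∀ v : Base, (fun s : ℝ => k (T (lift h (z₀ + s • v)), X (lift h (z₀ + s • v)),
      Y (lift h (z₀ + s • v)))) =ᶠ[𝓝 0] fun s => U (lift h (z₀ + s • v)) := fun v => by
    have hc : ContinuousAt (fun s : ℝ => z₀ + s • v) 0 := (hl v 0).continuousAt
    have := hc.eventually (by simpa only [hl0] using hkU)
    exact this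
  have hζ : ∀ v : Base, ∀ᶠ s in 𝓝 (0 : ℝ), HasDerivAt
      (fun s : ℝ => ((T (lift h (z₀ + s • v)), X (lift h (z₀ + s • v)),
        Y (lift h (z₀ + s • v))) : Base))
      (fderiv ℝ T (lift h (z₀ + s • v)) (v.1, v.2.1, v.2.2, fderiv ℝ h (z₀ + s • v) v),
        fderiv ℝ X (lift h (z₀ + s • v)) (v.1, v.2.1, v.2.2, fderiv ℝ h (z₀ + s • v) v),
        fderiv ℝ Y (lift h (z₀ + s • v)) (v.1, v.2.1, v.2.2, fderiv ℝ h (z₀ + s • v) v)) s :=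
    fun v => by
      filter_upwards [hfirst T hT v, hfirst X hX v, hfirst Y hY v] with s h1 h2 h3
      exact h1.prodMk (h2.prodMk h3)
  have hkat0 : ∀ v : Base, ContDiffAt ℝ 2 k (T (lift h (z₀ + (0 : ℝ) • v)),
      X (lift h (z₀ + (0 : ℝ) • v)), Y (lift h (z₀ + (0 : ℝ) • v))) := fun v => by
    rw [hγ0]; exact hkat
  have hkfirst := fun v : Base => hasDerivAt_comp_curve (f := k) (hkat0 v) (hζ v)
  refine ⟨K (1, 0, 0), K (0, 1, 0), K (0, 0, 1), fun v => ?_, fun v h1 h2 h3 η hη => ?_⟩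
  · have h1 := (hkfirst v).self_of_nhds
    rw [hγ0, hjv, ← hK, hKlin] at h1
    exact (((hfirst0 U hU v).congr_of_eventuallyEq (hkUv v)).unique h1)
  · have hsec := hasDerivAt_fderiv_curve (f := k) (hkat0 v)
      (hζ v).self_of_nhds ((hsecond T hT v).prodMk ((hsecond X hX v).prodMk (hsecond Y hY v)))
    rw [hγ0, hjv, h1, h2, h3, ← hK, hKlin] at hsec
    have hUsec := (hsecond U hU v).congr_of_eventuallyEq (f₁ := fun s : ℝ => fderiv ℝ k
        (T (lift h (z₀ + s • v)), X (lift h (z₀ + s • v)), Y (lift h (z₀ + s • v)))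
        (fderiv ℝ T (lift h (z₀ + s • v)) (v.1, v.2.1, v.2.2, fderiv ℝ h (z₀ + s • v) v),
        fderiv ℝ X (lift h (z₀ + s • v)) (v.1, v.2.1, v.2.2, fderiv ℝ h (z₀ + s • v) v),
        fderiv ℝ Y (lift h (z₀ + s • v)) (v.1, v.2.1, v.2.2, fderiv ℝ h (z₀ + s • v) v))) (by
      filter_upwards [hkfirst v, hfirst U hU v, (hkUv v).eventuallyEq_nhds] with s ha hb hc
      exact ha.unique (hb.congr_of_eventuallyEq hc))
    have h5 := hsec.unique hUsec
    have hη' : fderiv ℝ (fderiv ℝ h) z₀ v v = η := (hj2 v).trans hη.symm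
    rw [hη'] at h5
    rw [← h5, heq]
    ring

/-! ### Linear algebra of the differential and of jet planes. -/

theorem fderiv_total_apply (f : Total → ℝ) (p : Total) (a b c d : ℝ) :
    fderiv ℝ f p (a, b, c, d) = a * fderiv ℝ f p (1, 0, 0, 0) + b * fderiv ℝ f p (0, 1, 0, 0)
      + c * fderiv ℝ f p (0, 0, 1, 0) + d * fderiv ℝ f p (0, 0, 0, 1) := by
  have : ((a, b, c, d) : Total) = a • (1, 0, 0, 0) + b • (0, 1, 0, 0) + c • (0, 0, 1, 0)
      + d • (0, 0, 0, 1) := by simp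
  rw [this]
  simp only [map_add, map_smul, smul_eq_mul]

/-- The differential of a point transformation is bijective. -/
theorem differential_bijective {β : ℝ} {Φ : OpenPartialHomeomorph Total Total}
    (hΦ : IsPointTransformation β Φ) {T X Y U : Total → ℝ}
    (hΦc : ∀ p, Φ p = (T p, X p, Y p, U p)) {p : Total} (hp : p ∈ Φ.source) :
    (∀ a b c d : ℝ, ∃ V : Total, fderiv ℝ T p V = a ∧ fderiv ℝ X p V = b ∧
      fderiv ℝ Y p V = c ∧ fderiv ℝ U p V = d) ∧
    ∀ V : Total, fderiv ℝ T p V = 0 → fderiv ℝ X p V = 0 → fderiv ℝ Y p V = 0 →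
      fderiv ℝ U p V = 0 → V = 0 := by
  have hΦat : DifferentiableAt ℝ Φ p :=
    (hΦ.contDiffOn.contDiffAt (Φ.open_source.mem_nhds hp)).differentiableAt (by simp)
  have hΨat : DifferentiableAt ℝ Φ.symm (Φ p) :=
    (hΦ.contDiffOn_symm.contDiffAt
      (Φ.open_target.mem_nhds (Φ.map_source hp))).differentiableAt (by simp)
  have hcomp : HasFDerivAt (fun q => Φ.symm (Φ q)) (ContinuousLinearMap.id ℝ Total) p := by
    refine (hasFDerivAt_id p).congr_of_eventuallyEq ?_
    exact eventually_of_mem (Φ.open_source.mem_nhds hp) fun q hq => Φ.left_inv hq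
  have h1 := (hΨat.hasFDerivAt.comp p hΦat.hasFDerivAt).unique hcomp
  have hinj : Function.Injective (fderiv ℝ Φ p) := fun v w hvw => by
    have h2 := congrArg (fun L : Total →L[ℝ] Total => L v) h1
    have h3 := congrArg (fun L : Total →L[ℝ] Total => L w) h1
    simp only [ContinuousLinearMap.comp_apply, ContinuousLinearMap.id_apply] at h2 h3
    rw [← h2, ← h3, hvw]
  have hsurj : Function.Surjective (fderiv ℝ Φ p) :=
    (LinearMap.injective_iff_surjective (f := (fderiv ℝ Φ p : Total →ₗ[ℝ] Total))).mp hinj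
  have hT : HasFDerivAt T (fderiv ℝ T p) p :=
    (hΦat.fst.congr_of_eventuallyEq (.of_forall fun q => by simp [hΦc])).hasFDerivAt
  have hX : HasFDerivAt X (fderiv ℝ X p) p :=
    (hΦat.snd.fst.congr_of_eventuallyEq (.of_forall fun q => by simp [hΦc])).hasFDerivAt
  have hY : HasFDerivAt Y (fderiv ℝ Y p) p :=
    (hΦat.snd.snd.fst.congr_of_eventuallyEq (.of_forall fun q => by simp [hΦc])).hasFDerivAt
  have hU : HasFDerivAt U (fderiv ℝ U p) p :=
    (hΦat.snd.snd.snd.congr_of_eventuallyEq (.of_forall fun q => by simp [hΦc])).hasFDerivAt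
  have hv : ∀ V, fderiv ℝ Φ p V
      = (fderiv ℝ T p V, fderiv ℝ X p V, fderiv ℝ Y p V, fderiv ℝ U p V) := fun V => by
    have h2 : (Φ : Total → Total) = fun q => (T q, X q, Y q, U q) := funext hΦc
    rw [h2, (hT.prodMk (hX.prodMk (hY.prodMk hU))).fderiv]
    rfl
  refine ⟨fun a b c d => ?_, fun V h1 h2 h3 h4 => ?_⟩
  · obtain ⟨V, hV⟩ := hsurj (a, b, c, d)
    rw [hv] at hV
    simp only [Prod.mk.injEq] at hV
    exact ⟨V, hV⟩
  · apply hinj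
    rw [hv, h1, h2, h3, h4, map_zero]
    rfl

/-- Most gradients are nondegenerate. -/
theorem exists_nondegenerate_jets {T X Y U : Total →L[ℝ] ℝ}
    (hsurj : ∀ a b c d : ℝ, ∃ V : Total, T V = a ∧ X V = b ∧ Y V = c ∧ U V = d)
    (hinj : ∀ V : Total, T V = 0 → X V = 0 → Y V = 0 → U V = 0 → V = 0) :
    ∃ c₁ c₂ ξ₁ ξ₂ : ℝ, ξ₁ ≠ ξ₂ ∧ ∀ ξ, ξ = ξ₁ ∨ ξ = ξ₂ →
      ∀ v : Base, T (jetVec c₁ c₂ ξ v) = 0 → X (jetVec c₁ c₂ ξ v) = 0 →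
        Y (jetVec c₁ c₂ ξ v) = 0 → v = 0 := by
  -- N spans the common kernel of T, X, Y. A gradient is degenerate only if N lies in its tangent
  -- plane, which is one affine condition on (c₁, ξ, c₂). The two good values of ξ share c₁, c₂ so
  -- that dependence on ξ can be tested later.
  obtain ⟨N, hT, hX, hY, hU⟩ := hsurj 0 0 0 1
  have hN : N ≠ 0 := by rintro rfl; simp at hU
  have key : ∀ c₁ c₂ ξ : ℝ, N.2.2.2 - (c₁ * N.1 + ξ * N.2.1 + c₂ * N.2.2.1) ≠ 0 →
      ∀ v : Base, T (jetVec c₁ c₂ ξ v) = 0 → X (jetVec c₁ c₂ ξ v) = 0 →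
        Y (jetVec c₁ c₂ ξ v) = 0 → v = 0 := by
    intro c₁ c₂ ξ hne v h1 h2 h3
    set s := U (jetVec c₁ c₂ ξ v) with hs
    have h4 : jetVec c₁ c₂ ξ v - s • N = 0 := by
      apply hinj <;> simp [h1, h2, h3, hT, hX, hY, hU, hs]
    obtain ⟨n₁, n₂, n₃, n₄⟩ := N
    obtain ⟨v₁, v₂, v₃⟩ := v
    simp only [jetVec, Prod.smul_mk, smul_eq_mul, Prod.mk_sub_mk, Prod.mk_eq_zero] at h4
    obtain ⟨a1, a2, a3, a4⟩ := h4
    have h5 : s * (n₄ - (c₁ * n₁ + ξ * n₂ + c₂ * n₃)) = 0 := by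
      linear_combination c₁ * a1 + ξ * a2 + c₂ * a3 - a4
    have h6 : s = 0 := by simpa [hne] using h5
    simp only [h6, zero_mul, sub_zero] at a1 a2 a3
    simp [a1, a2, a3]
  obtain ⟨n₁, n₂, n₃, n₄⟩ := N
  simp only at key
  by_cases h2 : n₂ = 0
  · have : ∃ c₁ c₂ : ℝ, n₄ - (c₁ * n₁ + c₂ * n₃) ≠ 0 := by
      by_cases h4 : n₄ = 0
      · by_cases h1 : n₁ = 0
        · have h3 : n₃ ≠ 0 := by rintro rfl; simp [h1, h2, h4] at hN
          exact ⟨0, 1, by simpa [h4] using h3⟩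
        · exact ⟨1, 0, by simpa [h4] using h1⟩
      · exact ⟨0, 0, by simpa using h4⟩
    obtain ⟨c₁, c₂, hc⟩ := this
    exact ⟨c₁, c₂, 0, 1, zero_ne_one, fun ξ _ => key c₁ c₂ ξ (by simpa [h2] using hc)⟩
  · have bad : ∀ ξ : ℝ, ξ ≠ n₄ / n₂ → n₄ - (0 * n₁ + ξ * n₂ + 0 * n₃) ≠ 0 := by
      intro ξ hξ h
      apply hξ
      field_simp
      linarith
    refine ⟨0, 0, n₄ / n₂ + 1, n₄ / n₂ + 2, by simp, fun ξ hξ => key 0 0 ξ (bad ξ ?_)⟩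
    rcases hξ with rfl | rfl <;> simp

theorem jetVec_surjective {T X Y : Total →L[ℝ] ℝ} {c₁ c₂ c₃ : ℝ}
    (hinj : ∀ v : Base, T (jetVec c₁ c₂ c₃ v) = 0 → X (jetVec c₁ c₂ c₃ v) = 0 →
        Y (jetVec c₁ c₂ c₃ v) = 0 → v = 0) (a b c : ℝ) :
    ∃ v : Base, T (jetVec c₁ c₂ c₃ v) = a ∧ X (jetVec c₁ c₂ c₃ v) = b ∧
      Y (jetVec c₁ c₂ c₃ v) = c := by
  let J : Base →ₗ[ℝ] Total :=
    { toFun := jetVec c₁ c₂ c₃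
      map_add' := fun v w => by simp [jetVec]; ring
      map_smul' := fun s v => by simp [jetVec]; ring }
  let L : Base →ₗ[ℝ] Base :=
    ((T : Total →ₗ[ℝ] ℝ).prod ((X : Total →ₗ[ℝ] ℝ).prod (Y : Total →ₗ[ℝ] ℝ))).comp J
  have hLv : ∀ v, L v = (T (jetVec c₁ c₂ c₃ v), X (jetVec c₁ c₂ c₃ v),
    Y (jetVec c₁ c₂ c₃ v)) := fun v => rfl
  have hL : Function.Injective L := (injective_iff_map_eq_zero L).mpr fun v hv => by
    rw [hLv] at hv
    simp only [Prod.mk_eq_zero] at hv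
    exact hinj v hv.1 hv.2.1 hv.2.2
  obtain ⟨v, hv⟩ := (LinearMap.injective_iff_surjective.mp hL) (a, b, c)
  rw [hLv] at hv
  simp only [Prod.mk.injEq] at hv
  exact ⟨v, hv⟩

/-- The multiplier of the contact form does not vanish. -/
theorem contact_multiplier_ne_zero {T X Y U : Total →L[ℝ] ℝ}
    (hsurj : ∀ a b c d : ℝ, ∃ V : Total, T V = a ∧ X V = b ∧ Y V = c ∧ U V = d)
    {c₁ c₂ c₃ qT qX qY : ℝ}
    (hq : ∀ v : Base, U (jetVec c₁ c₂ c₃ v) = qT * T (jetVec c₁ c₂ c₃ v)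
      + qX * X (jetVec c₁ c₂ c₃ v) + qY * Y (jetVec c₁ c₂ c₃ v)) :
    U (0, 0, 0, 1) - (qT * T (0, 0, 0, 1) + qX * X (0, 0, 0, 1) + qY * Y (0, 0, 0, 1)) ≠ 0 := by
  -- If the multiplier vanished, U - qT T - qX X - qY Y would vanish on the tangent plane and on
  -- ∂_u, hence everywhere, although some V has image (0, 0, 0, 1).
  intro h0
  obtain ⟨V, h1, h2, h3, h4⟩ := hsurj 0 0 0 1
  set v : Base := (V.1, V.2.1, V.2.2.1) with hv
  set s : ℝ := V.2.2.2 - (c₁ * V.1 + c₃ * V.2.1 + c₂ * V.2.2.1) with hs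
  have hV : V = jetVec c₁ c₂ c₃ v + s • (0, 0, 0, 1) := by
    simp [jetVec, hv, hs]
  rw [hV] at h1 h2 h3 h4
  simp only [map_add, map_smul, smul_eq_mul] at h1 h2 h3 h4
  rw [hq] at h4
  have : (0 : ℝ) = 1 := by
    linear_combination h4 - qT * h1 - qX * h2 - qY * h3 - s * h0
  exact zero_ne_one this

/-! ### Derivation of the determining equations. -/

section

variable {β : ℝ} {Φ : OpenPartialHomeomorph Total Total} {T X Y U : Total → ℝ}

/-- New `t` and `y` depend on the old `t` and `y` only. -/
theorem fderiv_x_u_eq_zero (hΦ : Φ ∈ pointSymmetryPseudogroup β)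
    (hΦc : ∀ p, Φ p = (T p, X p, Y p, U p)) {p : Total} (hp : p ∈ Φ.source)
    (hx : p.2.1 ≠ 0) (hX : X p ≠ 0) :
    (fderiv ℝ T p (0, 1, 0, 0) = 0 ∧ fderiv ℝ T p (0, 0, 0, 1) = 0) ∧
      fderiv ℝ Y p (0, 1, 0, 0) = 0 ∧ fderiv ℝ Y p (0, 0, 0, 1) = 0 := by
  obtain ⟨t, x, y, u⟩ := p
  obtain ⟨hsurj, hinj⟩ := differential_bijective hΦ.1 hΦc hp
  obtain ⟨c₁, c₂, ξ₁, ξ₂, hξ, hnd⟩ := exists_nondegenerate_jets hsurj hinj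
  have huη : ∀ (f : Total → ℝ) (η : ℝ), fderiv ℝ f (t, x, y, u) (0, 0, 0, η)
      = η * fderiv ℝ f (t, x, y, u) (0, 0, 0, 1) := fun f η => by
    rw [fderiv_total_apply]
    ring
  have key : ∀ ξ, ξ = ξ₁ ∨ ξ = ξ₂ → (fderiv ℝ T (t, x, y, u)) (0, 1, 0, ξ) = 0 ∧ (fderiv ℝ Y (t, x, y, u)) (0, 1, 0, ξ) = 0 := by
    intro ξ hξ'
    have hn := hnd ξ hξ'
    obtain ⟨v, hv1, hv2, hv3⟩ := jetVec_surjective hn 0 1 0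
    obtain ⟨qT, qX, qY, hq, hr⟩ := jet_relation hΦ hΦc hp hx c₁ c₂ ξ 0 0 hn
    have hW := contact_multiplier_ne_zero hsurj hq
    have hβ : |X (t, x, y, u)| ^ β ≠ 0 := (Real.rpow_pos_of_pos (abs_pos.mpr hX) β).ne'
    obtain ⟨η, hη⟩ : ∃ η : ℝ, η = |x| ^ (-β) * (c₁ + c₂ * x) * v.2.1 ^ 2 + 2 * 0 * v.1 ^ 2
      + 2 * 0 * v.2.2 ^ 2 := ⟨_, rfl⟩
    have hr0 := hr v hv1 hv2 hv3 η hη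
    -- The numbers qT, qX, qY depend on the 1-jet only. Changing e₁, e₂ therefore changes the
    -- relation only through η, whose coefficient is the nonzero contact multiplier. Hence v has no
    -- t- and no y-component.
    have hcmp : ∀ e₁ e₂ : ℝ, 2 * e₁ * v.1 ^ 2 + 2 * e₂ * v.2.2 ^ 2 = 0 := by
      intro e₁ e₂
      obtain ⟨qT', qX', qY', hq', hr'⟩ := jet_relation hΦ hΦc hp hx c₁ c₂ ξ e₁ e₂ hn
      have hqT : qT' = qT := by
        obtain ⟨w, h1, h2, h3⟩ := jetVec_surjective hn 1 0 0
        have := (hq' w).symm.trans (hq w)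
        rw [h1, h2, h3] at this
        linarith
      have hqX : qX' = qX := by
        obtain ⟨w, h1, h2, h3⟩ := jetVec_surjective hn 0 1 0
        have := (hq' w).symm.trans (hq w)
        rw [h1, h2, h3] at this
        linarith
      have hqY : qY' = qY := by
        obtain ⟨w, h1, h2, h3⟩ := jetVec_surjective hn 0 0 1
        have := (hq' w).symm.trans (hq w)
        rw [h1, h2, h3] at this
        linarith
      rw [hqT, hqX, hqY] at hr'
      obtain ⟨η', hη'⟩ : ∃ η : ℝ, η = |x| ^ (-β) * (c₁ + c₂ * x) * v.2.1 ^ 2 + 2 * e₁ * v.1 ^ 2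
        + 2 * e₂ * v.2.2 ^ 2 := ⟨_, rfl⟩
      have hr1 := hr' v hv1 hv2 hv3 η' hη'
      rw [hr0] at hr1
      have h2 := mul_left_cancel₀ hβ hr1
      rw [huη U η, huη U η', huη X η, huη X η', huη Y η, huη Y η', huη T η, huη T η'] at h2
      refine (mul_eq_zero.mp ?_).resolve_right hW
      linear_combination -h2 + (fderiv ℝ U (t, x, y, u) (0, 0, 0, 1)
        - (qT * fderiv ℝ T (t, x, y, u) (0, 0, 0, 1) + qX * fderiv ℝ X (t, x, y, u) (0, 0, 0, 1)
          + qY * fderiv ℝ Y (t, x, y, u) (0, 0, 0, 1))) * (hη - hη')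
    have hv1' : v.1 = 0 := by simpa using hcmp 1 0
    have hv3' : v.2.2 = 0 := by simpa using hcmp 0 1
    have hjv : jetVec c₁ c₂ ξ v = v.2.1 • (0, 1, 0, ξ) := by
      simp [jetVec, hv1', hv3', mul_comm]
    rw [hjv, map_smul, smul_eq_mul] at hv1 hv2 hv3
    have hne : v.2.1 ≠ 0 := by
      intro h
      simp [h] at hv2
    exact ⟨by simpa [hne] using hv1, by simpa [hne] using hv3⟩
  -- A linear form that kills (0, 1, 0, ξ) for two values of ξ kills ∂_x and ∂_u separately.
  have fin : ∀ f : Total →L[ℝ] ℝ, f (0, 1, 0, ξ₁) = 0 → f (0, 1, 0, ξ₂) = 0 →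
      f (0, 1, 0, 0) = 0 ∧ f (0, 0, 0, 1) = 0 := by
    intro f h1 h2
    have h3 : f (0, 0, 0, 1) = 0 := by
      have : ((0, 1, 0, ξ₁) : Total) - (0, 1, 0, ξ₂) = (ξ₁ - ξ₂) • (0, 0, 0, 1) := by simp
      have h4 := congrArg f this
      rw [map_sub, map_smul, h1, h2, sub_zero, smul_eq_mul] at h4
      exact (mul_eq_zero.mp h4.symm).resolve_left (sub_ne_zero.mpr hξ)
    refine ⟨?_, h3⟩
    have : ((0, 1, 0, ξ₁) : Total) = (0, 1, 0, 0) + ξ₁ • (0, 0, 0, 1) := by simp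
    rw [this, map_add, map_smul, h3] at h1
    simpa using h1
  exact ⟨fin (fderiv ℝ T (t, x, y, u)) (key ξ₁ (.inl rfl)).1 (key ξ₂ (.inr rfl)).1,
    fin (fderiv ℝ Y (t, x, y, u)) (key ξ₁ (.inl rfl)).2 (key ξ₂ (.inr rfl)).2⟩

end

/-- Directional derivative of a function on the `(t, x, y, u)`-space. -/
def pd (v : Total) (f : Total → ℝ) : Total → ℝ := fun p => fderiv ℝ f p v

/-- Partial derivative with respect to `t`. -/
local notation "dt" => pd (1, 0, 0, 0)

/-- Partial derivative with respect to `x`. -/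
local notation "dx" => pd (0, 1, 0, 0)

/-- Partial derivative with respect to `y`. -/
local notation "dy" => pd (0, 0, 1, 0)

/-- Partial derivative with respect to `u`. -/
local notation "du" => pd (0, 0, 0, 1)

/-- Splitting the transformed equation with respect to the parametric derivatives. -/
theorem split_determining_equation {x X ρ κ Tt Ty Yt Yy Xt Xx Xy Xu Ut Ux Uy Uu : ℝ}
    {U2 X2 : ℝ → ℝ} (hρ : ρ ≠ 0) (hκ : κ ≠ 0) (hΔ : Tt * Yy - Ty * Yt ≠ 0)
    (hX : Xx ≠ 0 ∨ Xu ≠ 0)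
    (H : ∀ c₁ c₂ ξ m : ℝ, m * (Xx + ξ * Xu) = 1 → ∃ qT qX qY : ℝ,
      Uu - qX * Xu ≠ 0 ∧
      Ut + c₁ * Uu = qT * Tt + qX * (Xt + c₁ * Xu) + qY * Yt ∧
      Ux + ξ * Uu = qX * (Xx + ξ * Xu) ∧
      Uy + c₂ * Uu = qT * Ty + qX * (Xy + c₂ * Xu) + qY * Yy ∧
      qT + X * qY
        = ρ * m ^ 2 * (U2 ξ - qX * X2 ξ + κ * (c₁ + c₂ * x) * (Uu - qX * Xu))) :
    Xu = 0 ∧ Xx ≠ 0 ∧ (Tt + x * Ty) * (ρ * κ) = Xx ^ 2 ∧ X * (Tt + x * Ty) = Yt + x * Yy ∧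
      ∀ ξ, κ * (Xx * (Ut + x * Uy) - (Ux + ξ * Uu) * (Xt + x * Xy))
        = Xx * U2 ξ - (Ux + ξ * Uu) * X2 ξ := by
  -- By Cramer's rule, p and r are the weights for which p times the t-equation plus r times the
  -- y-equation produces qT + X qY. This eliminates qT and qY. The parameter m is the reciprocal of
  -- the total x-derivative of X.
  set p : ℝ := (Yy - X * Ty) / (Tt * Yy - Ty * Yt) with hp
  set r : ℝ := (X * Tt - Yt) / (Tt * Yy - Ty * Yt) with hr
  have h1 : p * Tt + r * Ty = 1 := by rw [hp, hr, div_mul_eq_mul_div, div_mul_eq_mul_div, ← add_div, div_eq_iff hΔ]; ring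
  have h2 : p * Yt + r * Yy = X := by rw [hp, hr, div_mul_eq_mul_div, div_mul_eq_mul_div, ← add_div, div_eq_iff hΔ]; ring
  have key : ∀ ξ m : ℝ, m * (Xx + ξ * Xu) = 1 → ∃ qX : ℝ, qX = m * (Ux + ξ * Uu) ∧
      p = ρ * m ^ 2 * κ ∧ r = ρ * m ^ 2 * κ * x ∧
      p * (Ut - qX * Xt) + r * (Uy - qX * Xy) = ρ * m ^ 2 * (U2 ξ - qX * X2 ξ) := by
    intro ξ m hm
    have hmne : m ≠ 0 := left_ne_zero_of_mul_eq_one hm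
    -- Both sides are affine in c₁, c₂; the values at (0,0), (1,0), (0,1) give all coefficients.
    have hall : ∀ c₁ c₂ : ℝ, Uu - m * (Ux + ξ * Uu) * Xu ≠ 0 ∧
        p * (Ut - m * (Ux + ξ * Uu) * Xt) + r * (Uy - m * (Ux + ξ * Uu) * Xy)
          + (p * c₁ + r * c₂) * (Uu - m * (Ux + ξ * Uu) * Xu)
        = ρ * m ^ 2 * (U2 ξ - m * (Ux + ξ * Uu) * X2 ξ
          + κ * (c₁ + c₂ * x) * (Uu - m * (Ux + ξ * Uu) * Xu)) := by
      intro c₁ c₂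
      obtain ⟨qT, qX, qY, hW, e1, e2, e3, e4⟩ := H c₁ c₂ ξ m hm
      have hq : qX = m * (Ux + ξ * Uu) := by
        rw [e2]
        linear_combination -qX * hm
      rw [← hq]
      refine ⟨hW, ?_⟩
      rw [← e4]
      linear_combination p * e1 + r * e3 + qT * h1 + qY * h2
    have hW := (hall 0 0).1
    have e0 := (hall 0 0).2
    have e1 := (hall 1 0).2
    have e2 := (hall 0 1).2
    refine ⟨_, rfl, mul_right_cancel₀ hW ?_, mul_right_cancel₀ hW ?_, ?_⟩
    · linear_combination e1 - e0
    · linear_combination e2 - e0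
    · linear_combination e0
  -- If X_u ≠ 0, suitable slopes ξ realize m = 1 and m = 2, while p = ρ m² κ does not depend on m.
  have hXu : Xu = 0 := by
    by_contra hne
    obtain ⟨_, _, a1, _, _⟩ := key ((1 - Xx) / Xu) 1 (by field_simp; ring)
    obtain ⟨_, _, a2, _, _⟩ := key ((1 / 2 - Xx) / Xu) 2 (by field_simp; ring)
    have : ρ * κ = 0 := by linear_combination (a2 - a1) * (-1 / 3)
    exact mul_ne_zero hρ hκ this
  have hXx : Xx ≠ 0 := hX.resolve_right (not_not.mpr hXu)
  have hm : ∀ ξ, Xx⁻¹ * (Xx + ξ * Xu) = 1 := fun ξ => by rw [hXu]; field_simp; ring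
  obtain ⟨_, _, hp', hr', _⟩ := key 0 _ (hm 0)
  have hpX : p * Xx ^ 2 = ρ * κ := by rw [hp']; field_simp
  have hrp : r = x * p := by rw [hp', hr']; ring
  have hpne : p ≠ 0 := by
    intro h
    rw [h, zero_mul] at hpX
    exact mul_ne_zero hρ hκ hpX.symm
  have hP : p * (Tt + x * Ty) = 1 := by rw [← h1, hrp]; ring
  refine ⟨hXu, hXx, ?_, ?_, fun ξ => ?_⟩
  · rw [← hpX]; linear_combination Xx ^ 2 * hP
  · apply mul_left_cancel₀ hpne
    linear_combination X * hP - h2 + (Yy) * hrp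
  · obtain ⟨qX, hq, _, _, e⟩ := key ξ _ (hm ξ)
    have hq' : qX * Xx = Ux + ξ * Uu := by rw [hq]; field_simp
    have e' : p * Xx ^ 2 * (Ut - qX * Xt + x * (Uy - qX * Xy))
        = ρ * (U2 ξ - qX * X2 ξ) := by
      have : ρ * (Xx⁻¹) ^ 2 * Xx ^ 2 = ρ := by field_simp
      linear_combination Xx ^ 2 * e - Xx ^ 2 * (Uy - qX * Xy) * hrp
        + (U2 ξ - qX * X2 ξ) * this
    rw [hpX, mul_assoc] at e'
    have e'' := mul_left_cancel₀ hρ e'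
    rw [← hq']
    linear_combination Xx * e''

section

variable {β : ℝ} {Φ : OpenPartialHomeomorph Total Total} {T X Y U : Total → ℝ}

theorem contDiffAt_components (hΦ : IsPointTransformation β Φ)
    (hΦc : ∀ p, Φ p = (T p, X p, Y p, U p)) {p : Total} (hp : p ∈ Φ.source) :
    ContDiffAt ℝ ∞ T p ∧ ContDiffAt ℝ ∞ X p ∧ ContDiffAt ℝ ∞ Y p ∧ ContDiffAt ℝ ∞ U p := by
  have hΦat : ContDiffAt ℝ ∞ Φ p := hΦ.contDiffOn.contDiffAt (Φ.open_source.mem_nhds hp)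
  exact ⟨hΦat.fst.congr_of_eventuallyEq (.of_forall fun q => by simp [hΦc]),
    hΦat.snd.fst.congr_of_eventuallyEq (.of_forall fun q => by simp [hΦc]),
    hΦat.snd.snd.fst.congr_of_eventuallyEq (.of_forall fun q => by simp [hΦc]),
    hΦat.snd.snd.snd.congr_of_eventuallyEq (.of_forall fun q => by simp [hΦc])⟩

theorem jacobian_ty_ne_zero (hΦ : IsPointTransformation β Φ)
    (hΦc : ∀ p, Φ p = (T p, X p, Y p, U p)) {p : Total} (hp : p ∈ Φ.source)
    (hTx : dx T p = 0) (hTu : du T p = 0) (hYx : dx Y p = 0) (hYu : du Y p = 0) :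
    dt T p * dy Y p - dy T p * dt Y p ≠ 0 := by
  obtain ⟨hsurj, -⟩ := differential_bijective hΦ hΦc hp
  obtain ⟨⟨a, b, c, d⟩, h1, -, h2, -⟩ := hsurj 1 0 0 0
  obtain ⟨⟨a', b', c', d'⟩, h3, -, h4, -⟩ := hsurj 0 0 1 0
  rw [fderiv_total_apply] at h1 h2 h3 h4
  simp only [pd] at *
  rw [hTx, hTu] at h1 h3
  rw [hYx, hYu] at h2 h4
  simp only [mul_zero, add_zero] at h1 h2 h3 h4
  intro h0
  have : (1 : ℝ) = 0 := by
    linear_combination (a * c' - c * a') * h0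
      - (a' * fderiv ℝ Y p (1, 0, 0, 0) + c' * fderiv ℝ Y p (0, 0, 1, 0)) * h1
      + (a * fderiv ℝ Y p (1, 0, 0, 0) + c * fderiv ℝ Y p (0, 0, 1, 0)) * h3 - h4
  exact one_ne_zero this

theorem D2_vertical {f : Total → ℝ} {p : Total} (hf : ContDiffAt ℝ ∞ f p) (m s : ℝ) :
    D2 f p (0, m, 0, s) = m ^ 2 * dx (dx f) p + 2 * m * s * dx (du f) p
      + s ^ 2 * du (du f) p := by
  have h2 := hf.of_le two_le_infty
  have hv : ((0, m, 0, s) : Total) = m • (0, 1, 0, 0) + s • (0, 0, 0, 1) := by simp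
  have hc := fderiv_fderiv_comm h2 (0, 1, 0, 0) (0, 0, 0, 1)
  rw [fderiv_fderiv_apply h2, fderiv_fderiv_apply h2] at hc
  unfold pd
  rw [D2, hv, fderiv_fderiv_apply h2, fderiv_fderiv_apply h2, fderiv_fderiv_apply h2]
  simp only [map_add, map_smul, _root_.add_apply, _root_.smul_apply,
    smul_eq_mul]
  rw [hc]
  ring

/-- Because T and Y depend on t, y alone in a whole neighbourhood, their second derivatives in the
x- and u-directions vanish too, and the vector mapped to ∂_x̃ is (0, m, 0) with m (X_x + ξ X_u) = 1.
The jet relation then has the shape required by `split_determining_equation`. -/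
theorem determining_equations (hΦ : Φ ∈ pointSymmetryPseudogroup β)
    (hΦc : ∀ p, Φ p = (T p, X p, Y p, U p)) {p : Total} (hp : p ∈ Φ.source)
    (hx : p.2.1 ≠ 0) (hX : X p ≠ 0) :
    (dx T p = 0 ∧ du T p = 0 ∧ dx Y p = 0 ∧ du Y p = 0) ∧
    (dt T p * dy Y p - dy T p * dt Y p ≠ 0) ∧
    du X p = 0 ∧ dx X p ≠ 0 ∧
    (dt T p + p.2.1 * dy T p) * |X p| ^ β = dx X p ^ 2 * |p.2.1| ^ β ∧
    X p * (dt T p + p.2.1 * dy T p) = dt Y p + p.2.1 * dy Y p ∧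
    ∀ ξ : ℝ, dx X p * (dt U p + p.2.1 * dy U p)
        - (dx U p + ξ * du U p) * (dt X p + p.2.1 * dy X p)
      = |p.2.1| ^ β * (dx X p * (dx (dx U) p + 2 * ξ * dx (du U) p + ξ ^ 2 * du (du U) p)
        - (dx U p + ξ * du U p)
          * (dx (dx X) p + 2 * ξ * dx (du X) p + ξ ^ 2 * du (du X) p)) := by
  have hnear : ∀ᶠ q in 𝓝 p, (dx T q = 0 ∧ du T q = 0) ∧ dx Y q = 0 ∧ du Y q = 0 := by
    have h1 : ∀ᶠ q in 𝓝 p, X q ≠ 0 :=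
      (contDiffAt_components hΦ.1 hΦc hp).2.1.continuousAt.eventually_ne hX
    have h2 : ∀ᶠ q : Total in 𝓝 p, q.2.1 ≠ 0 :=
      (continuous_fst.comp continuous_snd).continuousAt.eventually_ne hx
    filter_upwards [h1, h2, Φ.open_source.mem_nhds hp] with q a b c
    exact fderiv_x_u_eq_zero hΦ hΦc c b a
  obtain ⟨sT, sX, sY, sU⟩ := contDiffAt_components hΦ.1 hΦc hp
  obtain ⟨⟨hTx, hTu⟩, hYx, hYu⟩ := hnear.self_of_nhds
  have hΔ := jacobian_ty_ne_zero hΦ.1 hΦc hp hTx hTu hYx hYu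
  have hzero : ∀ {f : Total → ℝ}, (∀ᶠ q in 𝓝 p, f q = 0) → ∀ v, pd v f p = 0 := by
    intro f hf v
    have : f =ᶠ[𝓝 p] fun _ => (0 : ℝ) := hf
    simp [pd, this.fderiv_eq]
  have hT2 : ∀ m s : ℝ, D2 T p (0, m, 0, s) = 0 := fun m s => by
    rw [D2_vertical sT, hzero (hnear.mono fun q h => h.1.1), hzero (hnear.mono fun q h => h.1.2),
      hzero (hnear.mono fun q h => h.1.2)]
    ring
  have hY2 : ∀ m s : ℝ, D2 Y p (0, m, 0, s) = 0 := fun m s => by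
    rw [D2_vertical sY, hzero (hnear.mono fun q h => h.2.1), hzero (hnear.mono fun q h => h.2.2),
      hzero (hnear.mono fun q h => h.2.2)]
    ring
  obtain ⟨t, x, y, u⟩ := p
  simp only at hx
  have hx' : 0 < |x| := abs_pos.mpr hx
  have hρ : |X (t, x, y, u)| ^ β ≠ 0 := (Real.rpow_pos_of_pos (abs_pos.mpr hX) β).ne'
  have hκ : |x| ^ (-β) ≠ 0 := (Real.rpow_pos_of_pos hx' _).ne'
  have hκ' : |x| ^ β * |x| ^ (-β) = 1 := by
    rw [← Real.rpow_add hx']; simp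
  obtain ⟨hsurj, hinj⟩ := differential_bijective hΦ.1 hΦc hp
  have hXne : dx X (t, x, y, u) ≠ 0 ∨ du X (t, x, y, u) ≠ 0 := by
    by_contra! h
    obtain ⟨V, -, a, -, -⟩ := hsurj 0 1 0 0
    have b : ∀ V : Total, fderiv ℝ T (t, x, y, u) V = 0 → fderiv ℝ Y (t, x, y, u) V = 0 →
        V.1 = 0 ∧ V.2.2.1 = 0 := by
      rintro ⟨v₁, v₂, v₃, v₄⟩ h1 h2
      rw [fderiv_total_apply] at h1 h2
      simp only [pd] at hTx hTu hYx hYu hΔ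
      rw [hTx, hTu] at h1
      rw [hYx, hYu] at h2
      constructor
      · refine (mul_eq_zero.mp ?_).resolve_right hΔ
        linear_combination fderiv ℝ Y (t, x, y, u) (0, 0, 1, 0) * h1
          - fderiv ℝ T (t, x, y, u) (0, 0, 1, 0) * h2
      · refine (mul_eq_zero.mp ?_).resolve_right hΔ
        linear_combination fderiv ℝ T (t, x, y, u) (1, 0, 0, 0) * h2
          - fderiv ℝ Y (t, x, y, u) (1, 0, 0, 0) * h1
    obtain ⟨⟨v₁, v₂, v₃, v₄⟩, a1, a2, a3, -⟩ := hsurj 0 1 0 0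
    obtain ⟨b1, b2⟩ := b _ a1 a3
    simp only at b1 b2
    rw [fderiv_total_apply] at a2
    simp only [pd] at h
    rw [h.1, h.2, b1, b2] at a2
    simp at a2
  have split := split_determining_equation (x := x) (X := X (t, x, y, u))
    (Xt := dt X (t, x, y, u)) (Xy := dy X (t, x, y, u)) (Ut := dt U (t, x, y, u))
    (Ux := dx U (t, x, y, u)) (Uy := dy U (t, x, y, u)) (Uu := du U (t, x, y, u))
    (U2 := fun ξ => dx (dx U) (t, x, y, u) + 2 * ξ * dx (du U) (t, x, y, u)
      + ξ ^ 2 * du (du U) (t, x, y, u))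
    (X2 := fun ξ => dx (dx X) (t, x, y, u) + 2 * ξ * dx (du X) (t, x, y, u)
      + ξ ^ 2 * du (du X) (t, x, y, u)) hρ hκ hΔ hXne ?_
  · obtain ⟨s1, s2, s3, s4, s5⟩ := split
    refine ⟨⟨hTx, hTu, hYx, hYu⟩, hΔ, s1, s2, ?_, s4, fun ξ => ?_⟩
    · linear_combination |x| ^ β * s3 - (dt T (t, x, y, u) + x * dy T (t, x, y, u))
        * |X (t, x, y, u)| ^ β * hκ'
    · linear_combination |x| ^ β * s5 ξ
        - (dx X (t, x, y, u) * (dt U (t, x, y, u) + x * dy U (t, x, y, u))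
        - (dx U (t, x, y, u) + ξ * du U (t, x, y, u)) * (dt X (t, x, y, u)
          + x * dy X (t, x, y, u))) * hκ'
  · intro c₁ c₂ ξ m hm
    have hn : ∀ v : Base, fderiv ℝ T (t, x, y, u) (jetVec c₁ c₂ ξ v) = 0 →
        fderiv ℝ X (t, x, y, u) (jetVec c₁ c₂ ξ v) = 0 →
        fderiv ℝ Y (t, x, y, u) (jetVec c₁ c₂ ξ v) = 0 → v = 0 := by
      rintro ⟨v₁, v₂, v₃⟩ h1 h2 h3
      simp only [jetVec] at h1 h2 h3
      rw [fderiv_total_apply] at h1 h2 h3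
      simp only [pd] at hTx hTu hYx hYu hΔ hm
      rw [hTx, hTu] at h1
      rw [hYx, hYu] at h3
      have e1 : v₁ = 0 := by
        refine (mul_eq_zero.mp ?_).resolve_right hΔ
        linear_combination fderiv ℝ Y (t, x, y, u) (0, 0, 1, 0) * h1
          - fderiv ℝ T (t, x, y, u) (0, 0, 1, 0) * h3
      have e3 : v₃ = 0 := by
        refine (mul_eq_zero.mp ?_).resolve_right hΔ
        linear_combination fderiv ℝ T (t, x, y, u) (1, 0, 0, 0) * h3
          - fderiv ℝ Y (t, x, y, u) (1, 0, 0, 0) * h1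
      rw [e1, e3] at h2
      have e2 : v₂ = 0 := by
        linear_combination m * h2 - v₂ * hm
      simp [e1, e2, e3]
    obtain ⟨qT, qX, qY, hq, hr⟩ := jet_relation hΦ hΦc hp hx c₁ c₂ ξ 0 0 hn
    have hW := contact_multiplier_ne_zero hsurj hq
    have hjet : jetVec c₁ c₂ ξ (0, m, 0) = (0, m, 0, m * ξ) := by simp [jetVec, mul_comm]
    have hr0 := hr (0, m, 0)
    rw [hjet] at hr0
    have hqt := hq (1, 0, 0)
    have hqx := hq (0, 1, 0)
    have hqy := hq (0, 0, 1)
    simp only [jetVec] at hqt hqx hqy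
    rw [fderiv_total_apply U, fderiv_total_apply T, fderiv_total_apply X,
      fderiv_total_apply Y] at hqt hqx hqy
    rw [fderiv_total_apply T, fderiv_total_apply X, fderiv_total_apply Y] at hr0
    simp only [pd] at hTx hTu hYx hYu hm ⊢
    simp only [hTx, hTu, hYx, hYu] at hW hqt hqx hqy hr0
    have hr1 := hr0 (by ring) (by linear_combination hm) (by ring) _ rfl
    rw [hT2, hY2, D2_vertical sU, D2_vertical sX, fderiv_total_apply T, fderiv_total_apply X,
      fderiv_total_apply Y, fderiv_total_apply U, hTu, hYu] at hr1
    simp only [pd] at hr1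
    refine ⟨qT, qX, qY, ?_, ?_, ?_, ?_, ?_⟩
    · intro h0
      apply hW
      linear_combination h0
    · linear_combination hqt
    · linear_combination hqx
    · linear_combination hqy
    · linear_combination hr1

end

/-! ### Directional derivatives and the reduced equation for U. -/

section

variable {f g : Total → ℝ} {p v w : Total}

theorem contDiffAt_pd (hf : ContDiffAt ℝ ∞ f p) (v : Total) : ContDiffAt ℝ ∞ (pd v f) p :=
  (hf.fderiv_right (m := ∞) (by simp)).clm_apply contDiffAt_const

theorem pd_comm (hf : ContDiffAt ℝ ∞ f p) (v w : Total) : pd v (pd w f) p = pd w (pd v f) p :=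
  fderiv_fderiv_comm (hf.of_le two_le_infty) w v

theorem pd_congr (h : f =ᶠ[𝓝 p] g) (v : Total) : pd v f p = pd v g p := by
  simp only [pd, h.fderiv_eq]

theorem pd_eq_zero (h : ∀ᶠ q in 𝓝 p, f q = 0) (v : Total) : pd v f p = 0 := by
  have h' : f =ᶠ[𝓝 p] fun _ => (0 : ℝ) := h
  simp [pd, h'.fderiv_eq]

theorem pd_pd_eq_zero (hf : ContDiffAt ℝ ∞ f p) (h : ∀ᶠ q in 𝓝 p, pd w f q = 0) (v : Total) :
    pd w (pd v f) p = 0 := by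
  rw [pd_comm hf]
  exact pd_eq_zero h v

theorem hasDerivAt_pd (hf : DifferentiableAt ℝ f p) (v : Total) :
    HasDerivAt (fun s : ℝ => f (p + s • v)) (pd v f p) 0 := by
  have hl : HasDerivAt (fun s : ℝ => p + s • v) v 0 := by
    simpa using ((hasDerivAt_id (0 : ℝ)).smul_const v).const_add p
  have hf' : HasFDerivAt f (fderiv ℝ f p) (p + (0 : ℝ) • v) := by
    rw [zero_smul, add_zero]; exact hf.hasFDerivAt
  exact hf'.comp_hasDerivAt 0 hl

theorem hasDerivAt_x (p v : Total) :
    HasDerivAt (fun s : ℝ => (p + s • v).2.1) v.2.1 0 := by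
  simpa using ((hasDerivAt_id (0 : ℝ)).mul_const v.2.1).const_add p.2.1

/-- Differentiates an identity that holds near p; this is how consequences of the determining
equations are extracted. -/
theorem deriv_eq_of_eventuallyEq {F G : Total → ℝ} {F' G' : ℝ}
    (h : ∀ᶠ q in 𝓝 p, F q = G q) (hF : HasDerivAt (fun s : ℝ => F (p + s • v)) F' 0)
    (hG : HasDerivAt (fun s : ℝ => G (p + s • v)) G' 0) : F' = G' := by
  have hc : Tendsto (fun s : ℝ => p + s • v) (𝓝 0) (𝓝 p) := by
    have : Continuous (fun s : ℝ => p + s • v) := by fun_prop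
    simpa using this.tendsto 0
  exact (hF.congr_of_eventuallyEq ((hc.eventually h).mono fun s hs => hs.symm)).unique hG

theorem fderiv_eq_zero_iff : fderiv ℝ f p = 0 ↔
    dt f p = 0 ∧ dx f p = 0 ∧ dy f p = 0 ∧ du f p = 0 := by
  constructor
  · intro h
    simp [pd, h]
  · rintro ⟨h1, h2, h3, h4⟩
    simp only [pd] at h1 h2 h3 h4
    apply ContinuousLinearMap.ext
    rintro ⟨a, b, c, d⟩
    rw [fderiv_total_apply, h1, h2, h3, h4]
    simp

theorem pd_x_mul (hf : DifferentiableAt ℝ f p) (v : Total) :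
    pd v (fun q => q.2.1 * f q) p = v.2.1 * f p + p.2.1 * pd v f p := by
  have h1 : DifferentiableAt ℝ (fun q : Total => q.2.1 * f q) p := by fun_prop
  have h2 := (hasDerivAt_x p v).mul (hasDerivAt_pd hf v)
  have h3 := (hasDerivAt_pd h1 v).unique h2
  simpa using h3

/-- A function satisfying the reduced determining equation is affine in `u` with constant
leading coefficient. -/
theorem fderiv_du_eq_zero {β : ℝ} {W : Total → ℝ} (hW : ∀ᶠ q in 𝓝 p, ContDiffAt ℝ ∞ W q)
    (h : ∀ᶠ q in 𝓝 p, ∀ ξ : ℝ, dt W q + q.2.1 * dy W q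
      = |q.2.1| ^ β * (dx (dx W) q + 2 * ξ * dx (du W) q + ξ ^ 2 * du (du W) q))
    (hx : p.2.1 ≠ 0) :
    fderiv ℝ (du W) p = 0 ∧ dt W p + p.2.1 * dy W p = |p.2.1| ^ β * dx (dx W) p := by
  have hxn : ∀ᶠ q : Total in 𝓝 p, q.2.1 ≠ 0 :=
    (continuous_fst.comp continuous_snd).continuousAt.eventually_ne hx
  -- The left side of `h` is free of ξ, so the values ξ = 0, 1, -1 kill the ξ- and ξ²-coefficients.
  have h1 : ∀ᶠ q in 𝓝 p, dx (du W) q = 0 ∧ du (du W) q = 0 := by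
    filter_upwards [h, hxn] with q hq hxq
    have hne : |q.2.1| ^ β ≠ 0 := (Real.rpow_pos_of_pos (abs_pos.mpr hxq) β).ne'
    have e1 := mul_left_cancel₀ hne ((hq 0).symm.trans (hq 1))
    have e2 := mul_left_cancel₀ hne ((hq 0).symm.trans (hq (-1)))
    constructor <;> linarith
  have h2 : ∀ᶠ q in 𝓝 p, dt W q + q.2.1 * dy W q = |q.2.1| ^ β * dx (dx W) q := by
    filter_upwards [h] with q hq
    simpa using hq 0
  have hWu : ∀ᶠ q in 𝓝 p, ContDiffAt ℝ ∞ (du W) q := hW.mono fun q hq => contDiffAt_pd hq _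
  have h3 : ∀ᶠ q in 𝓝 p, dt (du W) q + q.2.1 * dy (du W) q = 0 := by
    filter_upwards [h2.eventually_nhds, hW.eventually_nhds, h1.eventually_nhds]
      with q hq hWq' h1q
    have hWq := hWq'.self_of_nhds
    have d : ∀ {f : Total → ℝ}, ContDiffAt ℝ ∞ f q → DifferentiableAt ℝ f q :=
      fun hf => hf.differentiableAt (by simp)
    have hd1 := (hasDerivAt_pd (d (contDiffAt_pd hWq (1, 0, 0, 0))) (0, 0, 0, 1)).add
      ((hasDerivAt_x q (0, 0, 0, 1)).mul
        (hasDerivAt_pd (d (contDiffAt_pd hWq (0, 0, 1, 0))) (0, 0, 0, 1)))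
    have hd2 := (hasDerivAt_pd (d (contDiffAt_pd (contDiffAt_pd hWq (0, 1, 0, 0))
      (0, 1, 0, 0))) (0, 0, 0, 1)).const_mul (|q.2.1| ^ β)
    -- In the u-direction x does not move, so the factor |x|^β can be frozen and need not be
    -- differentiated.
    have hq' : ∀ᶠ r in 𝓝 q, r.2.1 = q.2.1 →
        dt W r + r.2.1 * dy W r = |q.2.1| ^ β * dx (dx W) r := by
      filter_upwards [hq] with r hr he
      rw [hr, he]
    have hc : Tendsto (fun s : ℝ => q + s • ((0, 0, 0, 1) : Total)) (𝓝 0) (𝓝 q) := by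
      have : Continuous (fun s : ℝ => q + s • ((0, 0, 0, 1) : Total)) := by fun_prop
      simpa using this.tendsto 0
    have he := (hd1.congr_of_eventuallyEq ((hc.eventually hq').mono fun s hs =>
      (hs (by simp)).symm)).unique hd2
    simp only [zero_smul, add_zero, zero_mul, zero_add] at he
    have e3 : du (dx (dx W)) q = 0 := by
      rw [pd_comm (contDiffAt_pd hWq _)]
      apply pd_eq_zero
      filter_upwards [hWq', h1q] with r hr h1r
      rw [pd_comm hr]
      exact h1r.1
    rw [pd_comm hWq, pd_comm hWq (0, 0, 0, 1) (0, 0, 1, 0), e3, mul_zero] at he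
    exact he
  have hWp := hWu.self_of_nhds
  have d : ∀ {f : Total → ℝ}, ContDiffAt ℝ ∞ f p → DifferentiableAt ℝ f p :=
    fun hf => hf.differentiableAt (by simp)
  have hxz : ∀ v, dx (pd v (du W)) p = 0 := fun v =>
    pd_pd_eq_zero hWp (h1.mono fun q hq => hq.1) v
  -- Since W_xu = 0 nearby, the x-derivative of W_tu + x W_yu = 0 is W_yu = 0.
  have h4 : dy (du W) p = 0 := by
    have hd := (hasDerivAt_pd (d (contDiffAt_pd hWp (1, 0, 0, 0))) (0, 1, 0, 0)).add
      ((hasDerivAt_x p (0, 1, 0, 0)).mul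
        (hasDerivAt_pd (d (contDiffAt_pd hWp (0, 0, 1, 0))) (0, 1, 0, 0)))
    have := deriv_eq_of_eventuallyEq (F := fun q => dt (du W) q + q.2.1 * dy (du W) q)
      (G := fun _ => 0) h3 hd (hasDerivAt_const _ _)
    rw [hxz, hxz] at this
    simpa using this
  have h5 : dt (du W) p = 0 := by
    have := h3.self_of_nhds
    simpa [h4] using this
  exact ⟨fderiv_eq_zero_iff.mpr ⟨h5, h1.self_of_nhds.1, h4, h1.self_of_nhds.2⟩,
    h2.self_of_nhds⟩

end

/-! ### The determining system and the dichotomy. -/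

/-- The determining equations of point symmetries on an open set off `x = 0` and `X = 0`. -/
structure DeterminingSystem (β : ℝ) (T X Y U : Total → ℝ) (O : Set Total) : Prop where
  isOpen : IsOpen O
  smoothT : ∀ p ∈ O, ContDiffAt ℝ ∞ T p
  smoothX : ∀ p ∈ O, ContDiffAt ℝ ∞ X p
  smoothY : ∀ p ∈ O, ContDiffAt ℝ ∞ Y p
  smoothU : ∀ p ∈ O, ContDiffAt ℝ ∞ U p
  x_ne : ∀ p ∈ O, p.2.1 ≠ 0
  X_ne : ∀ p ∈ O, X p ≠ 0
  dxT : ∀ p ∈ O, dx T p = 0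
  duT : ∀ p ∈ O, du T p = 0
  dxY : ∀ p ∈ O, dx Y p = 0
  duY : ∀ p ∈ O, du Y p = 0
  jac : ∀ p ∈ O, dt T p * dy Y p - dy T p * dt Y p ≠ 0
  duX : ∀ p ∈ O, du X p = 0
  dxX : ∀ p ∈ O, dx X p ≠ 0
  scale : ∀ p ∈ O, (dt T p + p.2.1 * dy T p) * |X p| ^ β = dx X p ^ 2 * |p.2.1| ^ β
  moebius : ∀ p ∈ O, X p * (dt T p + p.2.1 * dy T p) = dt Y p + p.2.1 * dy Y p
  residual : ∀ p ∈ O, ∀ ξ : ℝ, dx X p * (dt U p + p.2.1 * dy U p)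
        - (dx U p + ξ * du U p) * (dt X p + p.2.1 * dy X p)
      = |p.2.1| ^ β * (dx X p * (dx (dx U) p + 2 * ξ * dx (du U) p + ξ ^ 2 * du (du U) p)
        - (dx U p + ξ * du U p)
          * (dx (dx X) p + 2 * ξ * dx (du X) p + ξ ^ 2 * du (du X) p))

namespace DeterminingSystem

variable {β : ℝ} {T X Y U : Total → ℝ} {O : Set Total} {p : Total}

theorem eventually (_ : DeterminingSystem β T X Y U O) {P : Total → Prop}
    (hO : IsOpen O) (hP : ∀ p ∈ O, P p) (hp : p ∈ O) : ∀ᶠ q in 𝓝 p, P q :=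
  eventually_of_mem (hO.mem_nhds hp) hP

theorem differentiableAt_pd {f : Total → ℝ} (hf : ContDiffAt ℝ ∞ f p) (v : Total) :
    DifferentiableAt ℝ (pd v f) p := (contDiffAt_pd hf v).differentiableAt (by simp)

theorem dx_pd_T (h : DeterminingSystem β T X Y U O) (hp : p ∈ O) (v : Total) :
    dx (pd v T) p = 0 :=
  pd_pd_eq_zero (h.smoothT p hp) (h.eventually h.isOpen h.dxT hp) v

theorem du_pd_T (h : DeterminingSystem β T X Y U O) (hp : p ∈ O) (v : Total) :
    du (pd v T) p = 0 :=
  pd_pd_eq_zero (h.smoothT p hp) (h.eventually h.isOpen h.duT hp) v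

theorem dx_pd_Y (h : DeterminingSystem β T X Y U O) (hp : p ∈ O) (v : Total) :
    dx (pd v Y) p = 0 :=
  pd_pd_eq_zero (h.smoothY p hp) (h.eventually h.isOpen h.dxY hp) v

theorem du_pd_Y (h : DeterminingSystem β T X Y U O) (hp : p ∈ O) (v : Total) :
    du (pd v Y) p = 0 :=
  pd_pd_eq_zero (h.smoothY p hp) (h.eventually h.isOpen h.duY hp) v

theorem speed_pos (h : DeterminingSystem β T X Y U O) (hp : p ∈ O) :
    0 < dt T p + p.2.1 * dy T p := by
  have h1 : 0 < |X p| ^ β := Real.rpow_pos_of_pos (abs_pos.mpr (h.X_ne p hp)) β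
  have h2 : 0 < |p.2.1| ^ β := Real.rpow_pos_of_pos (abs_pos.mpr (h.x_ne p hp)) β
  have h3 : 0 < dx X p ^ 2 := by have := h.dxX p hp; positivity
  exact pos_of_mul_pos_left ((h.scale p hp).symm ▸ mul_pos h3 h2) h1.le

/-- The logarithmic form of the scaling equation. -/
theorem log_scale (h : DeterminingSystem β T X Y U O) (hp : p ∈ O) :
    Real.log (dt T p + p.2.1 * dy T p) + β * Real.log (X p)
      = 2 * Real.log (dx X p) + β * Real.log p.2.1 := by
  -- `Real.log` is log|·|, so the signs of x, X and X_x need no case distinction.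
  have h1 := congrArg Real.log (h.scale p hp)
  have hX := abs_pos.mpr (h.X_ne p hp)
  have hx := abs_pos.mpr (h.x_ne p hp)
  rw [Real.log_mul (h.speed_pos hp).ne' (Real.rpow_pos_of_pos hX β).ne',
    Real.log_mul (pow_ne_zero 2 (h.dxX p hp)) (Real.rpow_pos_of_pos hx β).ne',
    Real.log_rpow hX, Real.log_rpow hx, Real.log_abs, Real.log_abs, Real.log_pow] at h1
  exact_mod_cast h1

/-- This is the derivative of the Möbius map x ↦ (Y_t + x Y_y)/(T_t + x T_y), whose coefficients do
not depend on x. -/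
theorem dxX_mul_speed (h : DeterminingSystem β T X Y U O) (hp : p ∈ O) :
    dx X p * (dt T p + p.2.1 * dy T p) ^ 2 = dt T p * dy Y p - dy T p * dt Y p := by
  have hT := h.smoothT p hp
  have hY := h.smoothY p hp
  have hX := (h.smoothX p hp).differentiableAt (by simp)
  have d1 := (hasDerivAt_pd hX (0, 1, 0, 0)).mul
    ((hasDerivAt_pd (differentiableAt_pd hT (1, 0, 0, 0)) (0, 1, 0, 0)).add
      ((hasDerivAt_x p (0, 1, 0, 0)).mul
        (hasDerivAt_pd (differentiableAt_pd hT (0, 0, 1, 0)) (0, 1, 0, 0))))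
  have d2 := (hasDerivAt_pd (differentiableAt_pd hY (1, 0, 0, 0)) (0, 1, 0, 0)).add
      ((hasDerivAt_x p (0, 1, 0, 0)).mul
        (hasDerivAt_pd (differentiableAt_pd hY (0, 0, 1, 0)) (0, 1, 0, 0)))
  have e := deriv_eq_of_eventuallyEq (F := fun q => X q * (dt T q + q.2.1 * dy T q))
    (G := fun q => dt Y q + q.2.1 * dy Y q) (h.eventually h.isOpen h.moebius hp) d1 d2
  simp only [h.dx_pd_T hp, h.dx_pd_Y hp, zero_smul, add_zero, mul_zero, zero_add, one_mul,
    Pi.add_apply, Pi.mul_apply] at e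
  have e0 := h.moebius p hp
  linear_combination (dt T p + p.2.1 * dy T p) * e - dy T p * e0

/-- The logarithmic derivative of the scaling equation with respect to `x`. -/
theorem quadratic_relation (h : DeterminingSystem β T X Y U O) (hp : p ∈ O) :
    β * (dt Y p * dt T p) + (2 * β - 5) * (dy T p * dt Y p) * p.2.1
      + (β - 5) * (dy T p * dy Y p) * (p.2.1 * p.2.1) = 0 := by
  -- With P = T_t + x T_y, Q = Y_t + x Y_y and the Jacobian J, substituting X = Q/P and X_x = J/P²
  -- eliminates X. In x, P and Q are affine and J is constant.
  have hlog : ∀ᶠ q in 𝓝 p, (5 - β) * Real.log (dt T q + q.2.1 * dy T q)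
      + β * Real.log (dt Y q + q.2.1 * dy Y q)
      = 2 * Real.log (dt T q * dy Y q - dy T q * dt Y q) + β * Real.log q.2.1 := by
    refine h.eventually h.isOpen (fun q hq => ?_) hp
    have h1 := h.log_scale hq
    have hP := (h.speed_pos hq).ne'
    rw [← h.moebius q hq, ← h.dxX_mul_speed hq, Real.log_mul (h.X_ne q hq) hP,
      Real.log_mul (h.dxX q hq) (pow_ne_zero 2 hP), Real.log_pow]
    push_cast
    linear_combination h1
  have hT := h.smoothT p hp
  have hY := h.smoothY p hp
  have hP := (h.speed_pos hp).ne'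
  have hQ : dt Y p + p.2.1 * dy Y p ≠ 0 := by
    rw [← h.moebius p hp]; exact mul_ne_zero (h.X_ne p hp) hP
  have hx := h.x_ne p hp
  have a' := hasDerivAt_pd (differentiableAt_pd hT (1, 0, 0, 0)) (0, 1, 0, 0)
  have b' := hasDerivAt_pd (differentiableAt_pd hT (0, 0, 1, 0)) (0, 1, 0, 0)
  have c' := hasDerivAt_pd (differentiableAt_pd hY (1, 0, 0, 0)) (0, 1, 0, 0)
  have d' := hasDerivAt_pd (differentiableAt_pd hY (0, 0, 1, 0)) (0, 1, 0, 0)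
  have x' := hasDerivAt_x p (0, 1, 0, 0)
  rw [h.dx_pd_T hp] at a' b'
  rw [h.dx_pd_Y hp] at c' d'
  have l1 := (a'.add (x'.mul b')).log (by
    simpa only [zero_smul, add_zero, Pi.mul_apply, Pi.add_apply, Pi.sub_apply] using hP)
  have l2 := (c'.add (x'.mul d')).log (by
    simpa only [zero_smul, add_zero, Pi.mul_apply, Pi.add_apply, Pi.sub_apply] using hQ)
  have l3 := ((a'.mul d').sub (b'.mul c')).log (by
    simpa only [zero_smul, add_zero, Pi.mul_apply, Pi.add_apply, Pi.sub_apply] using h.jac p hp)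
  have l4 := x'.log (by simpa using hx)
  have e := deriv_eq_of_eventuallyEq hlog ((l1.const_mul (5 - β)).add (l2.const_mul β))
    ((l3.const_mul 2).add (l4.const_mul β))
  simp only [zero_smul, add_zero, Pi.mul_apply, Pi.add_apply, Pi.sub_apply] at e
  simp at e
  have hP' : dt T p + dy T p * p.2.1 ≠ 0 := by rwa [mul_comm (dy T p)]
  field_simp at e
  linear_combination -e

/-- Either the old `t` and `y` are not mixed, or they are interchanged. -/
theorem dichotomy (h : DeterminingSystem β T X Y U O) (h0 : β ≠ 0) (h5 : β ≠ 5) (hp : p ∈ O) :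
    (dy T p = 0 ∧ dt Y p = 0 ∧ dt T p ≠ 0) ∨
      (β = 5 / 2 ∧ dt T p = 0 ∧ dy Y p = 0 ∧ dy T p ≠ 0) := by
  -- The relation is a quadratic polynomial in x whose coefficients do not depend on x. Two
  -- x-derivatives isolate the coefficients one by one.
  have h2 : ∀ q ∈ O, (2 * β - 5) * (dy T q * dt Y q)
      + (β - 5) * (dy T q * dy Y q) * (2 * q.2.1) = 0 := by
    intro p hp
    have hT := h.smoothT p hp
    have hY := h.smoothY p hp
    have a' := hasDerivAt_pd (differentiableAt_pd hT (1, 0, 0, 0)) (0, 1, 0, 0)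
    have b' := hasDerivAt_pd (differentiableAt_pd hT (0, 0, 1, 0)) (0, 1, 0, 0)
    have c' := hasDerivAt_pd (differentiableAt_pd hY (1, 0, 0, 0)) (0, 1, 0, 0)
    have d' := hasDerivAt_pd (differentiableAt_pd hY (0, 0, 1, 0)) (0, 1, 0, 0)
    have x' := hasDerivAt_x p (0, 1, 0, 0)
    rw [h.dx_pd_T hp] at a' b'
    rw [h.dx_pd_Y hp] at c' d'
    have e := deriv_eq_of_eventuallyEq (h.eventually h.isOpen (fun q => h.quadratic_relation) hp)
      ((((c'.mul a').const_mul β).add (((b'.mul c').const_mul (2 * β - 5)).mul x')).add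
        (((b'.mul d').const_mul (β - 5)).mul (x'.mul x'))) (hasDerivAt_const _ _)
    simp only [zero_smul, add_zero, Pi.mul_apply] at e
    simp at e
    linear_combination e
  have h3 : (β - 5) * (dy T p * dy Y p) * 2 = 0 := by
    have hT := h.smoothT p hp
    have hY := h.smoothY p hp
    have b' := hasDerivAt_pd (differentiableAt_pd hT (0, 0, 1, 0)) (0, 1, 0, 0)
    have c' := hasDerivAt_pd (differentiableAt_pd hY (1, 0, 0, 0)) (0, 1, 0, 0)
    have d' := hasDerivAt_pd (differentiableAt_pd hY (0, 0, 1, 0)) (0, 1, 0, 0)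
    have x' := hasDerivAt_x p (0, 1, 0, 0)
    rw [h.dx_pd_T hp] at b'
    rw [h.dx_pd_Y hp] at c' d'
    have e := deriv_eq_of_eventuallyEq (h.eventually h.isOpen h2 hp)
      (((b'.mul c').const_mul (2 * β - 5)).add
        (((b'.mul d').const_mul (β - 5)).mul (x'.const_mul 2))) (hasDerivAt_const _ _)
    simp only [zero_smul, add_zero, Pi.mul_apply, mul_zero, zero_mul, zero_add, mul_one] at e
    exact e
  have e1 := h.quadratic_relation hp
  have e2 := h2 p hp
  have hJ := h.jac p hp
  have hbd : dy T p * dy Y p = 0 := by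
    have : β - 5 ≠ 0 := sub_ne_zero.mpr h5
    simpa [this] using h3
  rw [hbd] at e1 e2
  have hbc : (2 * β - 5) * (dy T p * dt Y p) = 0 := by linear_combination e2
  rw [hbc] at e1
  have hca : dt Y p * dt T p = 0 := by
    refine (mul_eq_zero.mp ?_).resolve_left h0
    linear_combination e1
  -- Of T_t Y_y and T_y Y_t one is nonzero by the Jacobian; the second possibility forces 2β - 5 =
  -- 0.
  by_cases hc : dt Y p = 0
  · left
    rw [hc, mul_zero, sub_zero] at hJ
    exact ⟨(mul_eq_zero.mp hbd).resolve_right (right_ne_zero_of_mul hJ), hc,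
      left_ne_zero_of_mul hJ⟩
  · right
    have ha := (mul_eq_zero.mp hca).resolve_left hc
    rw [ha, zero_mul, zero_sub, neg_ne_zero] at hJ
    have hb := left_ne_zero_of_mul hJ
    refine ⟨?_, ha, (mul_eq_zero.mp hbd).resolve_left hb, hb⟩
    have := (mul_eq_zero.mp hbc).resolve_right hJ
    linarith

end DeterminingSystem

/-! ### Solving the system in the scaling and inversion branches. -/

theorem pd_of_fderiv_eq_zero {f : Total → ℝ} {p : Total} (h : fderiv ℝ f p = 0) (v : Total) :
    pd v f p = 0 := by
  simp [pd, h]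

namespace DeterminingSystem

variable {β : ℝ} {T X Y U : Total → ℝ} {O O' : Set Total} {p : Total}

theorem mono (h : DeterminingSystem β T X Y U O) (hO : IsOpen O') (hs : O' ⊆ O) :
    DeterminingSystem β T X Y U O' where
  isOpen := hO
  smoothT p hp := h.smoothT p (hs hp)
  smoothX p hp := h.smoothX p (hs hp)
  smoothY p hp := h.smoothY p (hs hp)
  smoothU p hp := h.smoothU p (hs hp)
  x_ne p hp := h.x_ne p (hs hp)
  X_ne p hp := h.X_ne p (hs hp)
  dxT p hp := h.dxT p (hs hp)
  duT p hp := h.duT p (hs hp)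
  dxY p hp := h.dxY p (hs hp)
  duY p hp := h.duY p (hs hp)
  jac p hp := h.jac p (hs hp)
  duX p hp := h.duX p (hs hp)
  dxX p hp := h.dxX p (hs hp)
  scale p hp := h.scale p (hs hp)
  moebius p hp := h.moebius p (hs hp)
  residual p hp := h.residual p (hs hp)

/-- For T_y = Y_t = 0 the Möbius map is X = x Y_y/T_t, and in the scaling equation the powers of |x|
cancel, leaving T_t |X_x|^β = X_x². -/
theorem scaling_x (h : DeterminingSystem β T X Y U O) (hb : ∀ p ∈ O, dy T p = 0)
    (hc : ∀ p ∈ O, dt Y p = 0) (hp : p ∈ O) :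
    p.2.1 * dx X p = X p ∧ dy Y p = dx X p * dt T p ∧ 0 < dt T p ∧
      dt T p = |dx X p| ^ (2 - β) := by
  have e1 := h.moebius p hp
  have e2 := h.dxX_mul_speed hp
  have e3 := h.speed_pos hp
  have e4 := h.scale p hp
  rw [hb p hp, mul_zero, add_zero] at e1 e2 e3 e4
  rw [hc p hp, zero_add] at e1
  rw [zero_mul, sub_zero] at e2
  have e5 : dy Y p = dx X p * dt T p := by
    apply mul_left_cancel₀ e3.ne'
    linear_combination -e2
  have e6 : p.2.1 * dx X p = X p := by
    apply mul_right_cancel₀ e3.ne'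
    linear_combination -e1 - p.2.1 * e5
  refine ⟨e6, e5, e3, ?_⟩
  have hx := abs_pos.mpr (h.x_ne p hp)
  have hα := abs_pos.mpr (h.dxX p hp)
  rw [← e6, abs_mul, Real.mul_rpow hx.le hα.le] at e4
  have hxβ := (Real.rpow_pos_of_pos hx β).ne'
  have hαβ := (Real.rpow_pos_of_pos hα β).ne'
  have e7 : dt T p * |dx X p| ^ β = dx X p ^ 2 := by
    apply mul_right_cancel₀ hxβ
    linear_combination e4
  rw [Real.rpow_sub hα, eq_div_iff hαβ, e7]
  norm_num

/-- Separation of variables: T_t does not depend on y, nor Y_y on t, and `scaling_x` links them by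
(3-β) log T_t = (2-β) log|Y_y|. The t-derivative needs β ≠ 3 and the y-derivative needs β ≠ 2. -/
theorem scaling_constants (h : DeterminingSystem β T X Y U O) (h2 : β ≠ 2) (h3 : β ≠ 3)
    (hb : ∀ p ∈ O, dy T p = 0) (hc : ∀ p ∈ O, dt Y p = 0) (hp : p ∈ O) :
    fderiv ℝ (dt T) p = 0 ∧ fderiv ℝ (dy Y) p = 0 ∧ fderiv ℝ (dx X) p = 0 := by
  have hT := h.smoothT p hp
  have hY := h.smoothY p hp
  obtain ⟨-, hd, ha, -⟩ := h.scaling_x hb hc hp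
  have hd0 : dy Y p ≠ 0 := by rw [hd]; exact mul_ne_zero (h.dxX p hp) ha.ne'
  have hay : dy (dt T) p = 0 := pd_pd_eq_zero hT (h.eventually h.isOpen hb hp) _
  have hdt : dt (dy Y) p = 0 := pd_pd_eq_zero hY (h.eventually h.isOpen hc hp) _
  have hlog : ∀ q ∈ O, (3 - β) * Real.log (dt T q) = (2 - β) * Real.log (dy Y q) := by
    intro q hq
    obtain ⟨-, hd, ha, hα⟩ := h.scaling_x hb hc hq
    have hα0 := h.dxX q hq
    have e : Real.log (dt T q) = (2 - β) * Real.log (dx X q) := by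
      rw [hα, Real.log_rpow (abs_pos.mpr hα0), Real.log_abs]
    rw [hd, Real.log_mul hα0 ha.ne']
    linear_combination e
  have hderiv : ∀ v, (3 - β) * (pd v (dt T) p / dt T p) = (2 - β) * (pd v (dy Y) p / dy Y p) := by
    intro v
    have l1 := (hasDerivAt_pd (differentiableAt_pd hT (1, 0, 0, 0)) v).log
      (by rw [zero_smul, add_zero]; exact ha.ne')
    have l2 := (hasDerivAt_pd (differentiableAt_pd hY (0, 0, 1, 0)) v).log
      (by rw [zero_smul, add_zero]; exact hd0)
    have e := deriv_eq_of_eventuallyEq (h.eventually h.isOpen hlog hp)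
      (l1.const_mul (3 - β)) (l2.const_mul (2 - β))
    simpa only [zero_smul, add_zero] using e
  have h2' : 2 - β ≠ 0 := sub_ne_zero.mpr h2.symm
  have h3' : 3 - β ≠ 0 := sub_ne_zero.mpr h3.symm
  have hat : dt (dt T) p = 0 := by
    have := hderiv (1, 0, 0, 0)
    rw [hdt] at this
    simpa [h3', ha.ne'] using this
  have hdy : dy (dy Y) p = 0 := by
    have := hderiv (0, 0, 1, 0)
    rw [hay] at this
    simpa [h2', hd0] using this.symm
  have hA := fderiv_eq_zero_iff.mpr ⟨hat, h.dx_pd_T hp _, hay, h.du_pd_T hp _⟩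
  have hD := fderiv_eq_zero_iff.mpr ⟨hdt, h.dx_pd_Y hp _, hdy, h.du_pd_Y hp _⟩
  refine ⟨hA, hD, ContinuousLinearMap.ext fun v => ?_⟩
  have e := deriv_eq_of_eventuallyEq (F := dy Y) (G := fun q => dx X q * dt T q)
    (h.eventually h.isOpen (fun q hq => (h.scaling_x hb hc hq).2.1) hp)
    (hasDerivAt_pd (differentiableAt_pd hY (0, 0, 1, 0)) v)
    ((hasDerivAt_pd (differentiableAt_pd (h.smoothX p hp) (0, 1, 0, 0)) v).mul
      (hasDerivAt_pd (differentiableAt_pd hT (1, 0, 0, 0)) v))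
  simp only [zero_smul, add_zero] at e
  rw [pd_of_fderiv_eq_zero hA, pd_of_fderiv_eq_zero hD, mul_zero, add_zero] at e
  exact (mul_eq_zero.mp e.symm).resolve_right ha.ne'

theorem scaling_X (h : DeterminingSystem β T X Y U O) (h2 : β ≠ 2) (h3 : β ≠ 3)
    (hb : ∀ p ∈ O, dy T p = 0) (hc : ∀ p ∈ O, dt Y p = 0) (hp : p ∈ O) :
    dt X p = 0 ∧ dy X p = 0 := by
  have hX := h.smoothX p hp
  have key : ∀ v : Total, v.2.1 = 0 → pd v X p = 0 := by
    intro v hv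
    have e := deriv_eq_of_eventuallyEq (F := X) (G := fun q => q.2.1 * dx X q)
      (h.eventually h.isOpen (fun q hq => (h.scaling_x hb hc hq).1.symm) hp)
      (hasDerivAt_pd (hX.differentiableAt (by simp)) v)
      ((hasDerivAt_x p v).mul (hasDerivAt_pd (differentiableAt_pd hX (0, 1, 0, 0)) v))
    rw [pd_of_fderiv_eq_zero (h.scaling_constants h2 h3 hb hc hp).2.2, hv] at e
    simpa using e
  exact ⟨key _ rfl, key _ rfl⟩

theorem dx_du_X (h : DeterminingSystem β T X Y U O) (hp : p ∈ O) (v : Total) :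
    pd v (du X) p = 0 :=
  pd_eq_zero (h.eventually h.isOpen h.duX hp) v

theorem scaling_U (h : DeterminingSystem β T X Y U O) (h2 : β ≠ 2) (h3 : β ≠ 3)
    (hb : ∀ p ∈ O, dy T p = 0) (hc : ∀ p ∈ O, dt Y p = 0) (hp : p ∈ O) :
    fderiv ℝ (du U) p = 0 ∧ dt U p + p.2.1 * dy U p = |p.2.1| ^ β * dx (dx U) p := by
  refine fderiv_du_eq_zero (h.eventually h.isOpen h.smoothU hp)
    (h.eventually h.isOpen (fun q hq ξ => ?_) hp) (h.x_ne p hp)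
  have e := h.residual q hq ξ
  obtain ⟨e1, e2⟩ := h.scaling_X h2 h3 hb hc hq
  rw [e1, e2, h.dx_du_X hq, h.dx_du_X hq,
    pd_of_fderiv_eq_zero (h.scaling_constants h2 h3 hb hc hq).2.2] at e
  apply mul_left_cancel₀ (h.dxX q hq)
  linear_combination e

/-- For T_t = Y_y = 0 the Möbius map is X = Y_t/(x T_y). Positivity of T_t + x T_y gives T_y the
sign of x. -/
theorem inversion_x (h : DeterminingSystem β T X Y U O) (ha : ∀ p ∈ O, dt T p = 0)
    (hd : ∀ p ∈ O, dy Y p = 0) (hp : p ∈ O) :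
    p.2.1 * dx X p = -X p ∧ dt Y p = X p * p.2.1 * dy T p ∧ 0 < p.2.1 * dy T p := by
  have e1 := h.moebius p hp
  have e2 := h.dxX_mul_speed hp
  have e3 := h.speed_pos hp
  rw [ha p hp, zero_add] at e1 e2 e3
  rw [hd p hp, mul_zero, add_zero] at e1
  rw [zero_mul, zero_sub] at e2
  refine ⟨?_, by linear_combination -e1, e3⟩
  have hb : dy T p ≠ 0 := right_ne_zero_of_mul e3.ne'
  apply mul_right_cancel₀ (mul_ne_zero (h.x_ne p hp) (pow_ne_zero 2 hb))
  linear_combination e2 + dy T p * e1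

/-- Inserting X = Y_t/(x T_y) into the scaling equation with β = 5/2, all powers of x cancel and
|T_y Y_t| = 1 remains. -/
theorem inversion_product (h : DeterminingSystem (5 / 2) T X Y U O)
    (ha : ∀ p ∈ O, dt T p = 0) (hd : ∀ p ∈ O, dy Y p = 0) (hp : p ∈ O) :
    Real.log (dy T p) + Real.log (dt Y p) = 0 := by
  obtain ⟨e1, e2, e3⟩ := h.inversion_x ha hd hp
  have e4 := h.log_scale hp
  have hx := h.x_ne p hp
  have hX := h.X_ne p hp
  have hb : dy T p ≠ 0 := right_ne_zero_of_mul e3.ne'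
  rw [ha p hp, zero_add, Real.log_mul hx hb] at e4
  have e5 : Real.log p.2.1 + Real.log (dx X p) = Real.log (X p) := by
    rw [← Real.log_mul hx (h.dxX p hp), e1, Real.log_neg_eq_log]
  rw [e2, Real.log_mul (mul_ne_zero hX hx) hb, Real.log_mul hX hx]
  linear_combination 2 * e4 + 4 * e5

theorem inversion_constants (h : DeterminingSystem (5 / 2) T X Y U O)
    (ha : ∀ p ∈ O, dt T p = 0) (hd : ∀ p ∈ O, dy Y p = 0) (hp : p ∈ O) :
    fderiv ℝ (dy T) p = 0 ∧ fderiv ℝ (dt Y) p = 0 := by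
  have hT := h.smoothT p hp
  have hY := h.smoothY p hp
  obtain ⟨-, e2, e3⟩ := h.inversion_x ha hd hp
  have hb : dy T p ≠ 0 := right_ne_zero_of_mul e3.ne'
  have hc : dt Y p ≠ 0 := by
    rw [e2]; exact mul_ne_zero (mul_ne_zero (h.X_ne p hp) (h.x_ne p hp)) hb
  have hbt : dt (dy T) p = 0 := pd_pd_eq_zero hT (h.eventually h.isOpen ha hp) _
  have hcy : dy (dt Y) p = 0 := pd_pd_eq_zero hY (h.eventually h.isOpen hd hp) _
  have hderiv : ∀ v, pd v (dy T) p / dy T p + pd v (dt Y) p / dt Y p = 0 := by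
    intro v
    have l1 := (hasDerivAt_pd (differentiableAt_pd hT (0, 0, 1, 0)) v).log
      (by rw [zero_smul, add_zero]; exact hb)
    have l2 := (hasDerivAt_pd (differentiableAt_pd hY (1, 0, 0, 0)) v).log
      (by rw [zero_smul, add_zero]; exact hc)
    have e := deriv_eq_of_eventuallyEq
      (h.eventually h.isOpen (fun q hq => h.inversion_product ha hd hq) hp)
      (l1.add l2) (hasDerivAt_const _ _)
    simpa only [zero_smul, add_zero] using e
  have hby : dy (dy T) p = 0 := by
    have := hderiv (0, 0, 1, 0)
    rw [hcy] at this
    simpa [hb] using this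
  have hct : dt (dt Y) p = 0 := by
    have := hderiv (1, 0, 0, 0)
    rw [hbt] at this
    simpa [hc] using this
  exact ⟨fderiv_eq_zero_iff.mpr ⟨hbt, h.dx_pd_T hp _, hby, h.du_pd_T hp _⟩,
    fderiv_eq_zero_iff.mpr ⟨hct, h.dx_pd_Y hp _, hcy, h.du_pd_Y hp _⟩⟩

theorem inversion_X (h : DeterminingSystem (5 / 2) T X Y U O)
    (ha : ∀ p ∈ O, dt T p = 0) (hd : ∀ p ∈ O, dy Y p = 0) (hp : p ∈ O) :
    dt X p = 0 ∧ dy X p = 0 := by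
  have hX := h.smoothX p hp
  obtain ⟨hB, hC⟩ := h.inversion_constants ha hd hp
  obtain ⟨-, -, e3⟩ := h.inversion_x ha hd hp
  have key : ∀ v : Total, v.2.1 = 0 → pd v X p = 0 := by
    intro v hv
    have e := deriv_eq_of_eventuallyEq (F := dt Y) (G := fun q => X q * q.2.1 * dy T q)
      (h.eventually h.isOpen (fun q hq => (h.inversion_x ha hd hq).2.1) hp)
      (hasDerivAt_pd (differentiableAt_pd (h.smoothY p hp) (1, 0, 0, 0)) v)
      (((hasDerivAt_pd (hX.differentiableAt (by simp)) v).mul (hasDerivAt_x p v)).mul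
        (hasDerivAt_pd (differentiableAt_pd (h.smoothT p hp) (0, 0, 1, 0)) v))
    rw [pd_of_fderiv_eq_zero hB, pd_of_fderiv_eq_zero hC, hv] at e
    simp only [zero_smul, add_zero, mul_zero] at e
    refine (mul_eq_zero.mp ?_).resolve_right e3.ne'
    linear_combination -e
  exact ⟨key _ rfl, key _ rfl⟩

theorem inversion_dx_dx_X (h : DeterminingSystem β T X Y U O)
    (ha : ∀ p ∈ O, dt T p = 0) (hd : ∀ p ∈ O, dy Y p = 0) (hp : p ∈ O) :
    p.2.1 * dx (dx X) p = -2 * dx X p := by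
  have hX := h.smoothX p hp
  have e := deriv_eq_of_eventuallyEq (F := fun q => q.2.1 * dx X q) (G := fun q => -X q)
    (h.eventually h.isOpen (fun q hq => (h.inversion_x ha hd hq).1) hp)
    ((hasDerivAt_x p (0, 1, 0, 0)).mul
      (hasDerivAt_pd (differentiableAt_pd hX (0, 1, 0, 0)) (0, 1, 0, 0)))
    (hasDerivAt_pd (hX.differentiableAt (by simp)) (0, 1, 0, 0)).neg
  simp only [zero_smul, add_zero] at e
  linear_combination e

/-- Since x X_xx = -2 X_x, the residual equation has an extra term 2(U_x + ξ U_u)/x beside the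
second derivatives. Passing from U to xU absorbs it. -/
theorem inversion_U (h : DeterminingSystem (5 / 2) T X Y U O)
    (ha : ∀ p ∈ O, dt T p = 0) (hd : ∀ p ∈ O, dy Y p = 0) (hp : p ∈ O) :
    fderiv ℝ (du fun q => q.2.1 * U q) p = 0 ∧
      dt (fun q => q.2.1 * U q) p + p.2.1 * dy (fun q => q.2.1 * U q) p
        = |p.2.1| ^ (5 / 2 : ℝ) * dx (dx fun q => q.2.1 * U q) p := by
  have hxs : ∀ q : Total, ContDiffAt ℝ ∞ (fun q : Total => q.2.1) q := fun q => by fun_prop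
  refine fderiv_du_eq_zero
    (h.eventually h.isOpen (fun q hq => (hxs q).mul (h.smoothU q hq)) hp)
    (h.eventually h.isOpen (fun q hq ξ => ?_) hp) (h.x_ne p hp)
  have hU := h.smoothU q hq
  have e := h.residual q hq ξ
  obtain ⟨e1, e2⟩ := h.inversion_X ha hd hq
  have e3 := h.inversion_dx_dx_X ha hd hq
  rw [e1, e2, h.dx_du_X hq, h.dx_du_X hq] at e
  have hW : ∀ v, pd v (fun q => q.2.1 * U q)
      =ᶠ[𝓝 q] fun r => v.2.1 * U r + r.2.1 * pd v U r := fun v =>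
    h.eventually h.isOpen
      (fun r hr => pd_x_mul ((h.smoothU r hr).differentiableAt (by simp)) v) hq
  have hW2 : ∀ v w, pd w (pd v fun q => q.2.1 * U q) q
      = v.2.1 * pd w U q + (w.2.1 * pd v U q + q.2.1 * pd w (pd v U) q) := by
    intro v w
    rw [pd_congr (hW v) w]
    have d1 := hU.differentiableAt (n := ∞) (by simp)
    have d2 := differentiableAt_pd hU v
    have d3 : DifferentiableAt ℝ (fun r => v.2.1 * U r + r.2.1 * pd v U r) q := by fun_prop
    have := (hasDerivAt_pd d3 w).unique (((hasDerivAt_pd d1 w).const_mul v.2.1).add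
      ((hasDerivAt_x q w).mul (hasDerivAt_pd d2 w)))
    simpa only [zero_smul, add_zero] using this
  rw [(hW (1, 0, 0, 0)).self_of_nhds, (hW (0, 0, 1, 0)).self_of_nhds, hW2, hW2, hW2]
  have hx := h.x_ne q hq
  apply mul_left_cancel₀ (h.dxX q hq)
  linear_combination q.2.1 * e - |q.2.1| ^ (5 / 2 : ℝ) * (dx U q + ξ * du U q) * e3

end DeterminingSystem

/-! ### Extension by continuity and the form on a vertical domain. -/

/-- The second hypothesis says that p is in the closure of O. Identities known only for x ≠ 0 or X ≠
0 reach the excluded points in this way. -/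
theorem eq_zero_of_frequently {F : Total → ℝ} {p : Total} {O : Set Total}
    (hF : ContinuousAt F p) (hO : ∃ᶠ q in 𝓝 p, q ∈ O) (h : ∀ q ∈ O, F q = 0) : F p = 0 := by
  by_contra hne
  exact hO ((hF.eventually_ne hne).mono fun q hq hqO => hq (h q hqO))

/-- On a vertical domain, a function with constant `u`-derivative which satisfies the equation
with respect to `(t, x, y)` is the sum of a linear function of `u` and a solution. -/
theorem exists_solution_of_affine {β σ : ℝ} {W : Total → ℝ} {M : Set Total}
    (hM : IsVerticalDomain M) (hW : ∀ p ∈ M, ContDiffAt ℝ ∞ W p) (hσ : ∀ p ∈ M, du W p = σ)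
    (heq : ∀ p ∈ M, dt W p + p.2.1 * dy W p = |p.2.1| ^ β * dx (dx W) p) :
    ∃ f : Base → ℝ, IsSolutionOn β f (proj '' M) ∧
      ∀ t x y u : ℝ, (t, x, y, u) ∈ M → W (t, x, y, u) = σ * u + f (t, x, y) := by
  classical
  -- Connectedness of the fibres is needed here: on a fibre W - σu has zero derivative, and a gap
  -- could separate different constants.
  have hfib : ∀ t x y u u' : ℝ, (t, x, y, u) ∈ M → (t, x, y, u') ∈ M →
      W (t, x, y, u) - σ * u = W (t, x, y, u') - σ * u' := by
    intro t x y u u' hu hu'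
    have ho : IsOpen {u : ℝ | (t, x, y, u) ∈ M} := hM.isOpen.preimage (by fun_prop)
    have hd : ∀ s ∈ {u : ℝ | (t, x, y, u) ∈ M},
        HasDerivAt (fun s => W (t, x, y, s) - σ * s) 0 s := by
      intro s hs
      have h1 : HasDerivAt (fun s : ℝ => ((t, x, y, s) : Total)) (0, 0, 0, 1) s :=
        (hasDerivAt_const s t).prodMk ((hasDerivAt_const s x).prodMk
          ((hasDerivAt_const s y).prodMk (hasDerivAt_id s)))
      have h2 := ((hW _ hs).differentiableAt (by simp)).hasFDerivAt.comp_hasDerivAt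
        (f := fun s : ℝ => ((t, x, y, s) : Total)) s h1
      have h3 := h2.sub ((hasDerivAt_id s).const_mul σ)
      have h4 := hσ _ hs
      simp only [pd] at h4
      exact h3.congr_deriv (by rw [h4]; simp)
    exact ho.is_const_of_deriv_eq_zero (hM.fibre t x y)
      (fun s hs => (hd s hs).differentiableAt.differentiableWithinAt)
      (fun s hs => (hd s hs).deriv) hu hu'
  -- The height u is chosen arbitrarily, but by `hfib` the value does not depend on it. With u
  -- frozen, f is locally W(·, u) - σu, hence smooth.
  set f : Base → ℝ := fun z =>
    if h : ∃ u, (z.1, z.2.1, z.2.2, u) ∈ M then W (z.1, z.2.1, z.2.2, h.choose) - σ * h.choose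
    else 0 with hf
  have hfW : ∀ (z : Base) (u : ℝ), (z.1, z.2.1, z.2.2, u) ∈ M →
      f z = W (z.1, z.2.1, z.2.2, u) - σ * u := by
    intro z u hu
    have hex : ∃ u, (z.1, z.2.1, z.2.2, u) ∈ M := ⟨u, hu⟩
    simp only [hf, dif_pos hex]
    exact hfib _ _ _ _ _ hex.choose_spec hu
  have hι : ∀ u : ℝ, ContDiff ℝ ∞ (fun z : Base => ((z.1, z.2.1, z.2.2, u) : Total)) :=
    fun u => by fun_prop
  have hloc : ∀ (z : Base) (u : ℝ), (z.1, z.2.1, z.2.2, u) ∈ M →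
      f =ᶠ[𝓝 z] fun z => W (z.1, z.2.1, z.2.2, u) - σ * u := by
    intro z u hu
    have : ∀ᶠ w : Base in 𝓝 z, (w.1, w.2.1, w.2.2, u) ∈ M :=
      (hι u).continuous.continuousAt.eventually (hM.isOpen.mem_nhds hu)
    exact this.mono fun w hw => hfW w u hw
  refine ⟨f, ⟨?_, ?_⟩, fun t x y u hu => ?_⟩
  · rintro _ ⟨⟨t, x, y, u⟩, hp, rfl⟩
    have h1 : ContDiffAt ℝ ∞ (fun z : Base => W (z.1, z.2.1, z.2.2, u) - σ * u) (t, x, y) :=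
      ((hW _ hp).comp (t, x, y) (hι u).contDiffAt).sub contDiffAt_const
    exact (h1.congr_of_eventuallyEq (hloc (t, x, y) u hp)).contDiffWithinAt
  · rintro t x y ⟨⟨t', x', y', u⟩, hp, he⟩
    simp only [proj, Prod.mk.injEq] at he
    obtain ⟨rfl, rfl, rfl⟩ := he
    have hl := hloc (t', x', y') u hp
    have d : ∀ {g : Total → ℝ} {q : Total}, ContDiffAt ℝ ∞ g q → DifferentiableAt ℝ g q :=
      fun hg => hg.differentiableAt (by simp)
    have l1 : HasDerivAt (fun s : ℝ => ((s, x', y', u) : Total)) (1, 0, 0, 0) t' :=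
      (hasDerivAt_id t').prodMk ((hasDerivAt_const _ _).prodMk
        ((hasDerivAt_const _ _).prodMk (hasDerivAt_const _ _)))
    have l2 : HasDerivAt (fun s : ℝ => ((t', x', s, u) : Total)) (0, 0, 1, 0) y' :=
      (hasDerivAt_const _ _).prodMk ((hasDerivAt_const _ _).prodMk
        ((hasDerivAt_id _).prodMk (hasDerivAt_const _ _)))
    have l3 : ∀ s : ℝ, HasDerivAt (fun s : ℝ => ((t', s, y', u) : Total)) (0, 1, 0, 0) s :=
      fun s => (hasDerivAt_const _ _).prodMk ((hasDerivAt_id _).prodMk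
        ((hasDerivAt_const _ _).prodMk (hasDerivAt_const _ _)))
    have e1 : HasDerivAt (fun s => f (s, x', y')) (dt W (t', x', y', u)) t' := by
      have h1 := (((d (hW _ hp)).hasFDerivAt.comp_hasDerivAt
        (f := fun s : ℝ => ((s, x', y', u) : Total)) t' l1)).sub_const (σ * u)
      have hc : ContinuousAt (fun s : ℝ => ((s, x', y') : Base)) t' := by fun_prop
      exact h1.congr_of_eventuallyEq (hc.eventually hl)
    have e2 : HasDerivAt (fun s => f (t', x', s)) (dy W (t', x', y', u)) y' := by
      have h1 := (((d (hW _ hp)).hasFDerivAt.comp_hasDerivAt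
        (f := fun s : ℝ => ((t', x', s, u) : Total)) y' l2)).sub_const (σ * u)
      have hc : ContinuousAt (fun s : ℝ => ((t', x', s) : Base)) y' := by fun_prop
      exact h1.congr_of_eventuallyEq (hc.eventually hl)
    have hc : ContinuousAt (fun s : ℝ => ((t', s, y') : Base)) x' := by fun_prop
    have hc4 : ContinuousAt (fun s : ℝ => ((t', s, y', u) : Total)) x' := by fun_prop
    have e3 : deriv (fun s => f (t', s, y')) =ᶠ[𝓝 x'] fun s => dx W (t', s, y', u) := by
      filter_upwards [hc4.eventually (hM.isOpen.mem_nhds hp)] with s hs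
      have h1 := (((d (hW _ hs)).hasFDerivAt.comp_hasDerivAt
        (f := fun s : ℝ => ((t', s, y', u) : Total)) s (l3 s))).sub_const (σ * u)
      have hcs : ContinuousAt (fun s : ℝ => ((t', s, y') : Base)) s := by fun_prop
      exact (h1.congr_of_eventuallyEq (hcs.eventually (hloc (t', s, y') u hs))).deriv
    have e4 : HasDerivAt (fun s => dx W (t', s, y', u)) (dx (dx W) (t', x', y', u)) x' :=
      (d (contDiffAt_pd (hW _ hp) (0, 1, 0, 0))).hasFDerivAt.comp_hasDerivAt
        (f := fun s : ℝ => ((t', s, y', u) : Total)) x' (l3 x')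
    rw [e1.deriv, e2.deriv, e3.deriv_eq, e4.deriv]
    exact heq _ hp
  · have := hfW (t, x, y) u hu
    simp only at this
    rw [this]
    ring

section

variable {β : ℝ} {Φ : OpenPartialHomeomorph Total Total} {T X Y U : Total → ℝ}

theorem pseudogroup_determiningSystem (hΦ : Φ ∈ pointSymmetryPseudogroup β)
    (hΦc : ∀ p, Φ p = (T p, X p, Y p, U p)) :
    DeterminingSystem β T X Y U {p | p ∈ Φ.source ∧ p.2.1 ≠ 0 ∧ X p ≠ 0} := by
  have hD := fun (p : Total) (hp : p ∈ {p | p ∈ Φ.source ∧ p.2.1 ≠ 0 ∧ X p ≠ 0}) =>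
    determining_equations hΦ hΦc hp.1 hp.2.1 hp.2.2
  have hs := fun (p : Total) (hp : p ∈ {p | p ∈ Φ.source ∧ p.2.1 ≠ 0 ∧ X p ≠ 0}) =>
    contDiffAt_components hΦ.1 hΦc hp.1
  refine ⟨?_, fun p hp => (hs p hp).1, fun p hp => (hs p hp).2.1, fun p hp => (hs p hp).2.2.1,
    fun p hp => (hs p hp).2.2.2, fun p hp => hp.2.1, fun p hp => hp.2.2,
    fun p hp => (hD p hp).1.1, fun p hp => (hD p hp).1.2.1, fun p hp => (hD p hp).1.2.2.1,
    fun p hp => (hD p hp).1.2.2.2, fun p hp => (hD p hp).2.1, fun p hp => (hD p hp).2.2.1,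
    fun p hp => (hD p hp).2.2.2.1, fun p hp => (hD p hp).2.2.2.2.1,
    fun p hp => (hD p hp).2.2.2.2.2.1, fun p hp => (hD p hp).2.2.2.2.2.2⟩
  rw [isOpen_iff_mem_nhds]
  rintro p ⟨h1, h2, h3⟩
  have h4 : ∀ᶠ q in 𝓝 p, X q ≠ 0 :=
    (contDiffAt_components hΦ.1 hΦc h1).2.1.continuousAt.eventually_ne h3
  have h5 : ∀ᶠ q : Total in 𝓝 p, q.2.1 ≠ 0 :=
    (continuous_fst.comp continuous_snd).continuousAt.eventually_ne h2
  filter_upwards [h4, h5, Φ.open_source.mem_nhds h1] with q a b c using ⟨c, b, a⟩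

/-- The set where the scaling branch holds is cut out by an open condition, and so is the set
where the inversion branch holds. -/
theorem DeterminingSystem.branches {O : Set Total} (h : DeterminingSystem β T X Y U O)
    (h0 : β ≠ 0) (h2 : β ≠ 2) (h3 : β ≠ 3) (h5 : β ≠ 5) {p : Total} (hp : p ∈ O) :
    dt X p = 0 ∧ dy X p = 0 ∧ (p.2.1 * dx X p) ^ 2 = X p ^ 2 ∧
      (dy T p ≠ 0 → dy T p ^ 2 * |p.2.1 * X p| = 1) := by
  -- The branch lemmas need one alternative on an open set. On T_t ≠ 0 the dichotomy always gives
  -- the scaling branch, on T_y ≠ 0 always the inversion branch.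
  have ho : ∀ v w, IsOpen {q | q ∈ O ∧ pd v T q ≠ w} := by
    intro v w
    rw [isOpen_iff_mem_nhds]
    rintro q ⟨a, b⟩
    filter_upwards [h.isOpen.mem_nhds a,
      (contDiffAt_pd (h.smoothT q a) v).continuousAt.eventually_ne b] with r hr hr'
    exact ⟨hr, hr'⟩
  rcases h.dichotomy h0 h5 hp with ⟨hb, hc, ha⟩ | ⟨rfl, ha, hd, hb⟩
  · have h' := h.mono (ho (1, 0, 0, 0) 0) fun q hq => hq.1
    have hbc : ∀ q ∈ {q | q ∈ O ∧ dt T q ≠ 0}, dy T q = 0 ∧ dt Y q = 0 := fun q hq => by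
      rcases h.dichotomy h0 h5 hq.1 with hh | hh
      · exact ⟨hh.1, hh.2.1⟩
      · exact absurd hh.2.1 hq.2
    have hp' : p ∈ {q | q ∈ O ∧ dt T q ≠ 0} := ⟨hp, ha⟩
    obtain ⟨e1, e2⟩ := h'.scaling_X h2 h3 (fun q hq => (hbc q hq).1)
      (fun q hq => (hbc q hq).2) hp'
    have e3 := (h'.scaling_x (fun q hq => (hbc q hq).1) (fun q hq => (hbc q hq).2) hp').1
    exact ⟨e1, e2, by rw [e3], fun hne => absurd hb hne⟩
  · have h' := h.mono (ho (0, 0, 1, 0) 0) fun q hq => hq.1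
    have had : ∀ q ∈ {q | q ∈ O ∧ dy T q ≠ 0}, dt T q = 0 ∧ dy Y q = 0 := fun q hq => by
      rcases h.dichotomy h0 h5 hq.1 with hh | hh
      · exact absurd hh.1 hq.2
      · exact ⟨hh.2.1, hh.2.2.1⟩
    have hp' : p ∈ {q | q ∈ O ∧ dy T q ≠ 0} := ⟨hp, hb⟩
    obtain ⟨e1, e2⟩ := h'.inversion_X (fun q hq => (had q hq).1) (fun q hq => (had q hq).2) hp'
    obtain ⟨e3, e4, e5⟩ :=
      h'.inversion_x (fun q hq => (had q hq).1) (fun q hq => (had q hq).2) hp'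
    refine ⟨e1, e2, by rw [e3, neg_sq], fun _ => ?_⟩
    have e6 := h'.inversion_product (fun q hq => (had q hq).1) (fun q hq => (had q hq).2) hp'
    have hc : dt Y p ≠ 0 := by
      rw [e4]; exact mul_ne_zero (mul_ne_zero (h.X_ne p hp) (h.x_ne p hp)) hb
    rw [← Real.log_mul hb hc, ← Real.log_abs] at e6
    have e7 := Real.eq_one_of_pos_of_log_eq_zero (abs_pos.mpr (mul_ne_zero hb hc)) e6
    rw [e4] at e7
    rwa [show dy T p * (X p * p.2.1 * dy T p) = dy T p ^ 2 * (p.2.1 * X p) by ring, abs_mul,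
      abs_of_nonneg (sq_nonneg (dy T p))] at e7

/-- A point symmetry maps points off `x = 0` to points off `x = 0`. -/
theorem X_ne_zero_of_x_ne_zero (hΦ : Φ ∈ pointSymmetryPseudogroup β)
    (hΦc : ∀ p, Φ p = (T p, X p, Y p, U p))
    (h0 : β ≠ 0) (h2 : β ≠ 2) (h3 : β ≠ 3) (h5 : β ≠ 5) {p : Total} (hp : p ∈ Φ.source)
    (hx : p.2.1 ≠ 0) : X p ≠ 0 := by
  intro hX
  have hD := pseudogroup_determiningSystem hΦ hΦc
  have hs := (contDiffAt_components hΦ.1 hΦc hp).2.1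
  obtain ⟨⟨a, b, c, d⟩, -, hV, -, -⟩ := (differential_bijective hΦ.1 hΦc hp).1 0 1 0 0
  rw [fderiv_total_apply] at hV
  -- Otherwise X would vanish identically near p, against the surjectivity of the differential.
  have hfreq : ∃ᶠ q in 𝓝 p, q ∈ {p | p ∈ Φ.source ∧ p.2.1 ≠ 0 ∧ X p ≠ 0} := by
    intro hno
    have hz : ∀ᶠ q in 𝓝 p, X q = 0 := by
      have h5 : ∀ᶠ q : Total in 𝓝 p, q.2.1 ≠ 0 :=
        (continuous_fst.comp continuous_snd).continuousAt.eventually_ne hx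
      filter_upwards [hno, h5, Φ.open_source.mem_nhds hp] with q a b c
      by_contra hne
      exact a ⟨c, b, hne⟩
    have := fun v => pd_eq_zero hz v
    simp only [pd] at this
    rw [this, this, this, this] at hV
    simp at hV
  have hcont : ∀ v, ContinuousAt (pd v X) p := fun v => (contDiffAt_pd hs v).continuousAt
  have hcx : ContinuousAt (fun q : Total => q.2.1) p := by fun_prop
  have hcX : ContinuousAt X p := hs.continuousAt
  -- X_t = X_y = X_u = 0 and (x X_x)² = X² hold in both branches. In the limit at X = 0 they make
  -- all of dX vanish.
  have e1 := eq_zero_of_frequently (hcont (1, 0, 0, 0)) hfreq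
    fun q hq => (hD.branches h0 h2 h3 h5 hq).1
  have e2 := eq_zero_of_frequently (hcont (0, 0, 1, 0)) hfreq
    fun q hq => (hD.branches h0 h2 h3 h5 hq).2.1
  have e3 := eq_zero_of_frequently (hcont (0, 0, 0, 1)) hfreq fun q hq => hD.duX q hq
  have e4 := eq_zero_of_frequently (F := fun q => (q.2.1 * dx X q) ^ 2 - X q ^ 2)
    (((hcx.mul (hcont (0, 1, 0, 0))).pow 2).sub (hcX.pow 2)) hfreq
    fun q hq => sub_eq_zero.mpr (hD.branches h0 h2 h3 h5 hq).2.2.1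
  rw [hX] at e4
  have e5 : dx X p = 0 := by simpa [hx] using e4
  simp only [pd] at e1 e2 e3 e5
  rw [e1, e2, e3, e5] at hV
  simp at hV

end

theorem frequently_x_ne_zero (p : Total) : ∃ᶠ q : Total in 𝓝 p, q.2.1 ≠ 0 := by
  intro h
  have h' : ∀ᶠ q : Total in 𝓝 p, q.2.1 = 0 := h.mono fun q hq => not_not.mp hq
  have := deriv_eq_of_eventuallyEq h' (hasDerivAt_x p (0, 1, 0, 0)) (hasDerivAt_const _ _)
  simp at this

theorem eqOn_const_of_pd_eq_zero {F : Total → ℝ} {M : Set Total} (ho : IsOpen M)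
    (hc : IsPreconnected M) (hF : ∀ p ∈ M, ContDiffAt ℝ ∞ F p)
    (h : ∀ p ∈ M, ∀ v, pd v F p = 0) {p q : Total} (hp : p ∈ M) (hq : q ∈ M) : F p = F q :=
  ho.is_const_of_fderiv_eq_zero hc
    (fun r hr => ((hF r hr).differentiableAt (by simp)).differentiableWithinAt)
    (fun r hr => ContinuousLinearMap.ext fun v => h r hr v) hp hq

theorem eq_linear_add_const {F : Total → ℝ} {M : Set Total} (ho : IsOpen M)
    (hc : IsPreconnected M) (hF : ∀ p ∈ M, ContDiffAt ℝ ∞ F p) {a c : ℝ}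
    (h : ∀ p ∈ M, dt F p = a ∧ dx F p = 0 ∧ dy F p = c ∧ du F p = 0) :
    ∃ b : ℝ, ∀ p ∈ M, F p = a * p.1 + c * p.2.2.1 + b := by
  let L : Total →L[ℝ] ℝ := a • ContinuousLinearMap.fst ℝ ℝ (ℝ × ℝ × ℝ)
    + c • (ContinuousLinearMap.fst ℝ ℝ ℝ ∘L ContinuousLinearMap.snd ℝ ℝ (ℝ × ℝ)
      ∘L ContinuousLinearMap.snd ℝ ℝ (ℝ × ℝ × ℝ))
  obtain ⟨b, hb⟩ := ho.exists_eq_add_of_fderiv_eq hc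
    (fun r hr => ((hF r hr).differentiableAt (by simp)).differentiableWithinAt)
    L.differentiable.differentiableOn (g := L) (fun r hr => by
      obtain ⟨h1, h2, h3, h4⟩ := h r hr
      simp only [pd] at h1 h2 h3 h4
      rw [L.fderiv]
      apply ContinuousLinearMap.ext
      rintro ⟨v₁, v₂, v₃, v₄⟩
      rw [fderiv_total_apply, h1, h2, h3, h4]
      simp [L]
      ring)
  exact ⟨b, fun p hp => by rw [hb hp]; simp [L]⟩

section

variable {β : ℝ} {Φ : OpenPartialHomeomorph Total Total} {T X Y U : Total → ℝ} {M : Set Total}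

theorem hasScalingForm_of_dy_T_eq_zero (hΦ : Φ ∈ pointSymmetryPseudogroup β)
    (hΦc : ∀ p, Φ p = (T p, X p, Y p, U p))
    (h0 : β ≠ 0) (h2 : β ≠ 2) (h3 : β ≠ 3) (h5 : β ≠ 5) (hMs : M ⊆ Φ.source)
    (hM : IsVerticalDomain M) (hb : ∀ p ∈ M, p.2.1 ≠ 0 → dy T p = 0) :
    HasScalingForm β Φ M := by
  set O : Set Total := {p | p ∈ M ∧ p.2.1 ≠ 0} with hO
  have hOo : IsOpen O := hM.isOpen.inter (isOpen_ne.preimage (by fun_prop))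
  have hX0 : ∀ p ∈ M, p.2.1 ≠ 0 → X p ≠ 0 := fun p hp hx =>
    X_ne_zero_of_x_ne_zero hΦ hΦc h0 h2 h3 h5 (hMs hp) hx
  have hD : DeterminingSystem β T X Y U O :=
    (pseudogroup_determiningSystem hΦ hΦc).mono hOo
      fun p hp => ⟨hMs hp.1, hp.2, hX0 p hp.1 hp.2⟩
  have hbO : ∀ p ∈ O, dy T p = 0 := fun p hp => hb p hp.1 hp.2
  have hcO : ∀ p ∈ O, dt Y p = 0 := fun p hp => by
    rcases hD.dichotomy h0 h5 hp with h | h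
    · exact h.2.1
    · exact absurd (hbO p hp) h.2.2.2
  have hfreq : ∀ p ∈ M, ∃ᶠ q in 𝓝 p, q ∈ O := fun p hp =>
    ((frequently_x_ne_zero p).and_eventually (hM.isOpen.mem_nhds hp)).mono
      fun q hq => ⟨hq.2, hq.1⟩
  have hsT := fun (p : Total) (hp : p ∈ M) => (contDiffAt_components hΦ.1 hΦc (hMs hp)).1
  have hsX := fun (p : Total) (hp : p ∈ M) => (contDiffAt_components hΦ.1 hΦc (hMs hp)).2.1
  have hsY := fun (p : Total) (hp : p ∈ M) => (contDiffAt_components hΦ.1 hΦc (hMs hp)).2.2.1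
  have hsU := fun (p : Total) (hp : p ∈ M) => (contDiffAt_components hΦ.1 hΦc (hMs hp)).2.2.2
  have ext : ∀ {F : Total → ℝ}, (∀ p ∈ M, ContinuousAt F p) → (∀ p ∈ O, F p = 0) →
      ∀ p ∈ M, F p = 0 := fun hF h p hp => eq_zero_of_frequently (hF p hp) (hfreq p hp) h
  have cpd : ∀ {F : Total → ℝ}, (∀ p ∈ M, ContDiffAt ℝ ∞ F p) → ∀ v, ∀ p ∈ M,
      ContinuousAt (pd v F) p := fun hF v p hp => (contDiffAt_pd (hF p hp) v).continuousAt
  -- O may be disconnected, so the gradient is first extended by zero to M by continuity, and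
  -- constancy is deduced on the connected set M.
  have const : ∀ {F : Total → ℝ}, (∀ p ∈ M, ContDiffAt ℝ ∞ F p) →
      (∀ p ∈ O, fderiv ℝ F p = 0) → ∀ p ∈ M, ∀ q ∈ M, F p = F q := fun hF h p hp q hq =>
    eqOn_const_of_pd_eq_zero hM.isOpen hM.isConnected.isPreconnected hF
      (fun r hr v => ext (cpd hF v) (fun s hs => pd_of_fderiv_eq_zero (h s hs) v) r hr) hp hq
  obtain ⟨p₀, hp₀⟩ := hM.isConnected.nonempty
  obtain ⟨p₁, hp₁⟩ := (hfreq p₀ hp₀).exists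
  have hK := fun p (hp : p ∈ O) => hD.scaling_constants h2 h3 hbO hcO hp
  have hTt : ∀ p ∈ M, dt T p = dt T p₁ := fun p hp =>
    const (fun q hq => contDiffAt_pd (hsT q hq) _) (fun q hq => (hK q hq).1) p hp p₁ hp₁.1
  have hYy : ∀ p ∈ M, dy Y p = dy Y p₁ := fun p hp =>
    const (fun q hq => contDiffAt_pd (hsY q hq) _) (fun q hq => (hK q hq).2.1) p hp p₁ hp₁.1
  have hXx : ∀ p ∈ M, dx X p = dx X p₁ := fun p hp =>
    const (fun q hq => contDiffAt_pd (hsX q hq) _) (fun q hq => (hK q hq).2.2) p hp p₁ hp₁.1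
  have hUu : ∀ p ∈ M, du U p = du U p₁ := fun p hp =>
    const (fun q hq => contDiffAt_pd (hsU q hq) _)
      (fun q hq => (hD.scaling_U h2 h3 hbO hcO hq).1) p hp p₁ hp₁.1
  obtain ⟨-, hd₁, ha₁, hα₁⟩ := hD.scaling_x hbO hcO hp₁
  obtain ⟨a, ha⟩ := eq_linear_add_const hM.isOpen hM.isConnected.isPreconnected hsT
    (a := dt T p₁) (c := 0) fun p hp => ⟨hTt p hp, ext (cpd hsT _) hD.dxT p hp,
      ext (cpd hsT _) hbO p hp, ext (cpd hsT _) hD.duT p hp⟩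
  obtain ⟨b, hb⟩ := eq_linear_add_const hM.isOpen hM.isConnected.isPreconnected hsY
    (a := 0) (c := dy Y p₁) fun p hp => ⟨ext (cpd hsY _) hcO p hp, ext (cpd hsY _) hD.dxY p hp,
      hYy p hp, ext (cpd hsY _) hD.duY p hp⟩
  have hcx : ∀ p : Total, ContinuousAt (fun q : Total => q.2.1) p := fun p => by fun_prop
  have hX : ∀ p ∈ M, p.2.1 * dx X p - X p = 0 :=
    ext (fun p hp => ((hcx p).mul (cpd hsX _ p hp)).sub (hsX p hp).continuousAt)
      fun p hp => sub_eq_zero.mpr (hD.scaling_x hbO hcO hp).1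
  have hUeq : ∀ p ∈ M, dt U p + p.2.1 * dy U p = |p.2.1| ^ β * dx (dx U) p := by
    intro p hp
    by_cases hx : p.2.1 = 0
    · have hβ : 0 < β := ((hΦ.1.source_subset (hMs hp)).resolve_right (not_not.mpr hx)).lt_of_ne'
        h0
      refine sub_eq_zero.mp (eq_zero_of_frequently
        (F := fun p => dt U p + p.2.1 * dy U p - |p.2.1| ^ β * dx (dx U) p) ?_ (hfreq p hp)
        fun q hq => sub_eq_zero.mpr (hD.scaling_U h2 h3 hbO hcO hq).2)
      refine ((cpd hsU _ p hp).add ((hcx p).mul (cpd hsU _ p hp))).sub (ContinuousAt.mul ?_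
        (cpd (fun q hq => contDiffAt_pd (hsU q hq) _) _ p hp))
      exact (hcx p).abs.rpow_const (.inr hβ.le)
    · exact (hD.scaling_U h2 h3 hbO hcO ⟨hp, hx⟩).2
  obtain ⟨f, hf, hfU⟩ := exists_solution_of_affine hM hsU hUu hUeq
  have hσ : du U p₁ ≠ 0 := by
    intro hz
    have := (differential_bijective hΦ.1 hΦc (hMs hp₁.1)).2 (0, 0, 0, 1) (hD.duT p₁ hp₁)
      (hD.duX p₁ hp₁) (hD.duY p₁ hp₁) hz
    simp at this
  refine ⟨dx X p₁, du U p₁, a, b, f, hD.dxX p₁ hp₁, hσ, hf, fun t x y u hp => ?_⟩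
  rw [hΦc, ha _ hp, hb _ hp, hfU _ _ _ _ hp, ← hα₁, hd₁]
  have hXp := hX _ hp
  rw [hXx _ hp] at hXp
  simp only at hXp ⊢
  rw [← sub_eq_zero.mp hXp]
  simp only [Prod.mk.injEq]
  exact ⟨by ring, by ring, by ring, trivial⟩

theorem hasInversionForm_of_dy_T_ne_zero (hΦ : Φ ∈ pointSymmetryPseudogroup (5 / 2))
    (hΦc : ∀ p, Φ p = (T p, X p, Y p, U p)) (hMs : M ⊆ Φ.source)
    (hM : IsVerticalDomain M) (hx : ∀ p ∈ M, p.2.1 ≠ 0) (hb : ∀ p ∈ M, dy T p ≠ 0) :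
    HasInversionForm (5 / 2) Φ M := by
  have hD : DeterminingSystem (5 / 2) T X Y U M :=
    (pseudogroup_determiningSystem hΦ hΦc).mono hM.isOpen
      fun p hp => ⟨hMs hp, hx p hp, X_ne_zero_of_x_ne_zero hΦ hΦc (by norm_num) (by norm_num)
        (by norm_num) (by norm_num) (hMs hp) (hx p hp)⟩
  have had : ∀ p ∈ M, dt T p = 0 ∧ dy Y p = 0 := fun p hp => by
    rcases hD.dichotomy (by norm_num) (by norm_num) hp with h | h
    · exact absurd h.1 (hb p hp)
    · exact ⟨h.2.1, h.2.2.1⟩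
  have haM : ∀ p ∈ M, dt T p = 0 := fun p hp => (had p hp).1
  have hdM : ∀ p ∈ M, dy Y p = 0 := fun p hp => (had p hp).2
  have const : ∀ {F : Total → ℝ}, (∀ p ∈ M, ContDiffAt ℝ ∞ F p) →
      (∀ p ∈ M, fderiv ℝ F p = 0) → ∀ p ∈ M, ∀ q ∈ M, F p = F q := fun hF h p hp q hq =>
    eqOn_const_of_pd_eq_zero hM.isOpen hM.isConnected.isPreconnected hF
      (fun r hr v => pd_of_fderiv_eq_zero (h r hr) v) hp hq
  obtain ⟨p₁, hp₁⟩ := hM.isConnected.nonempty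
  have hK := fun p (hp : p ∈ M) => hD.inversion_constants haM hdM hp
  have hTy : ∀ p ∈ M, dy T p = dy T p₁ := fun p hp =>
    const (fun q hq => contDiffAt_pd (hD.smoothT q hq) _) (fun q hq => (hK q hq).1) p hp p₁ hp₁
  have hYt : ∀ p ∈ M, dt Y p = dt Y p₁ := fun p hp =>
    const (fun q hq => contDiffAt_pd (hD.smoothY q hq) _) (fun q hq => (hK q hq).2) p hp p₁ hp₁
  have hxs : ∀ q : Total, ContDiffAt ℝ ∞ (fun q : Total => q.2.1) q := fun q => by fun_prop
  have hW : ∀ p ∈ M, ContDiffAt ℝ ∞ (fun q => q.2.1 * U q) p := fun p hp =>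
    (hxs p).mul (hD.smoothU p hp)
  have hWu : ∀ p ∈ M, du (fun q => q.2.1 * U q) p = du (fun q => q.2.1 * U q) p₁ := fun p hp =>
    const (fun q hq => contDiffAt_pd (hW q hq) _)
      (fun q hq => (hD.inversion_U haM hdM hq).1) p hp p₁ hp₁
  obtain ⟨a, ha⟩ := eq_linear_add_const hM.isOpen hM.isConnected.isPreconnected hD.smoothT
    (a := 0) (c := dy T p₁) fun p hp => ⟨haM p hp, hD.dxT p hp, hTy p hp, hD.duT p hp⟩
  obtain ⟨b, hbY⟩ := eq_linear_add_const hM.isOpen hM.isConnected.isPreconnected hD.smoothY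
    (a := dt Y p₁) (c := 0) fun p hp => ⟨hYt p hp, hD.dxY p hp, hdM p hp, hD.duY p hp⟩
  obtain ⟨f, hf, hfU⟩ := exists_solution_of_affine hM hW hWu
    fun p hp => (hD.inversion_U haM hdM hp).2
  have hb₁ := hb p₁ hp₁
  have hc₁ : dt Y p₁ ≠ 0 := by
    rw [(hD.inversion_x haM hdM hp₁).2.1]
    exact mul_ne_zero (mul_ne_zero (hD.X_ne p₁ hp₁) (hx p₁ hp₁)) hb₁
  have hσ : du (fun q => q.2.1 * U q) p₁ ≠ 0 := by
    rw [pd_x_mul ((hD.smoothU p₁ hp₁).differentiableAt (by simp))]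
    simp only [zero_mul, zero_add]
    refine mul_ne_zero (hx p₁ hp₁) fun hz => ?_
    have := (differential_bijective hΦ.1 hΦc (hMs hp₁)).2 (0, 0, 0, 1) (hD.duT p₁ hp₁)
      (hD.duX p₁ hp₁) (hD.duY p₁ hp₁) hz
    simp at this
  have hlog := hD.inversion_product haM hdM hp₁
  set B := dy T p₁ with hB
  set C := dt Y p₁ with hC
  -- The constant α is Y_t/T_y. From |T_y Y_t| = 1 follows |α|^(-1/2) = |T_y|, and the sign of T_y
  -- is that of x.
  have hscale : |C / B| ^ (2 - 5 / 2 : ℝ) = |B| := by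
    have hα : 0 < |C / B| := abs_pos.mpr (div_ne_zero hc₁ hb₁)
    apply Real.log_injOn_pos (Real.rpow_pos_of_pos hα _) (abs_pos.mpr hb₁)
    rw [Real.log_rpow hα, Real.log_abs, Real.log_abs, Real.log_div hc₁ hb₁]
    linear_combination (-1 / 2) * hlog
  refine ⟨C / B, _, a, b, f, div_ne_zero hc₁ hb₁, hσ, hf, fun t x y u hp => ⟨hx _ hp, ?_⟩⟩
  have hx' : x ≠ 0 := hx _ hp
  have hsign : Real.sign x * |B| = B := by
    have h1 := (hD.inversion_x haM hdM hp).2.2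
    rw [hTy _ hp] at h1
    rcases pos_and_pos_or_neg_and_neg_of_mul_pos h1 with ⟨h2, h3⟩ | ⟨h2, h3⟩
    · rw [Real.sign_of_pos h2, abs_of_pos h3, one_mul]
    · rw [Real.sign_of_neg h2, abs_of_neg h3]; ring
  have hX : X (t, x, y, u) = C / B / x := by
    have h1 := (hD.inversion_x haM hdM hp).2.1
    rw [hYt _ hp, hTy _ hp] at h1
    simp only at h1
    field_simp
    linear_combination -h1
  have hU := hfU _ _ _ _ hp
  simp only at hU
  rw [hΦc, ha _ hp, hbY _ hp, hX, hscale, hsign]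
  simp only [Prod.mk.injEq, true_and]
  refine ⟨by ring, ?_, ?_⟩
  · have : Real.sign x * (C / B * |B|) = C := by
      rw [mul_left_comm, hsign]; field_simp
    rw [this]
    ring
  · rw [← hU]
    field_simp

/-- For x ≠ 0 the continuous quantity T_y²|xX| is 0 in the scaling branch and 1 in the inversion
branch, and at x = 0 it is 0. Hence both branches are open in M, and connectedness selects one. In
the inversion branch M misses x = 0. -/
theorem hasForm_of_mem_pseudogroup (hΦ : Φ ∈ pointSymmetryPseudogroup β)
    (h0 : β ≠ 0) (h2 : β ≠ 2) (h3 : β ≠ 3) (h5 : β ≠ 5) (hMs : M ⊆ Φ.source)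
    (hM : IsVerticalDomain M) :
    HasScalingForm β Φ M ∨ (β = 5 / 2 ∧ HasInversionForm β Φ M) := by
  obtain ⟨T, X, Y, U, hΦc⟩ : ∃ T X Y U : Total → ℝ, ∀ p, Φ p = (T p, X p, Y p, U p) :=
    ⟨fun p => (Φ p).1, fun p => (Φ p).2.1, fun p => (Φ p).2.2.1, fun p => (Φ p).2.2.2,
      fun p => rfl⟩
  have hD := pseudogroup_determiningSystem hΦ hΦc
  have hsT := fun (p : Total) (hp : p ∈ M) => (contDiffAt_components hΦ.1 hΦc (hMs hp)).1
  have hsX := fun (p : Total) (hp : p ∈ M) => (contDiffAt_components hΦ.1 hΦc (hMs hp)).2.1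
  have hG : ∀ p ∈ M, p.2.1 ≠ 0 → p ∈ {p | p ∈ Φ.source ∧ p.2.1 ≠ 0 ∧ X p ≠ 0} :=
    fun p hp hx => ⟨hMs hp, hx, X_ne_zero_of_x_ne_zero hΦ hΦc h0 h2 h3 h5 (hMs hp) hx⟩
  set S₁ : Set Total := {p | p ∈ M ∧ dy T p ^ 2 * |p.2.1 * X p| < 1} with hS₁
  set S₂ : Set Total := {p | p ∈ M ∧ p.2.1 ≠ 0 ∧ dy T p ≠ 0} with hS₂
  have hcx : ∀ p : Total, ContinuousAt (fun q : Total => q.2.1) p := fun p => by fun_prop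
  have ho₁ : IsOpen S₁ := by
    rw [isOpen_iff_mem_nhds]
    rintro p ⟨a, b⟩
    have hc : ContinuousAt (fun p => dy T p ^ 2 * |p.2.1 * X p|) p :=
      ((contDiffAt_pd (hsT p a) _).continuousAt.pow 2).mul
        ((hcx p).mul (hsX p a).continuousAt).abs
    filter_upwards [hM.isOpen.mem_nhds a, hc.eventually_lt_const b] with q hq hq'
      using ⟨hq, hq'⟩
  have ho₂ : IsOpen S₂ := by
    rw [isOpen_iff_mem_nhds]
    rintro p ⟨a, b, c⟩
    filter_upwards [hM.isOpen.mem_nhds a, (hcx p).eventually_ne b,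
      (contDiffAt_pd (hsT p a) _).continuousAt.eventually_ne c] with q h1 h2 h3
      using ⟨h1, h2, h3⟩
  have hdisj : Disjoint S₁ S₂ := by
    rw [Set.disjoint_left]
    rintro p ⟨a, b⟩ ⟨-, c, d⟩
    rw [(hD.branches h0 h2 h3 h5 (hG p a c)).2.2.2 d] at b
    exact lt_irrefl _ b
  have hcov : M ⊆ S₁ ∪ S₂ := by
    intro p hp
    by_cases hx : p.2.1 = 0
    · exact .inl ⟨hp, by simp [hx]⟩
    · by_cases hT : dy T p = 0
      · exact .inl ⟨hp, by simp [hT]⟩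
      · exact .inr ⟨hp, hx, hT⟩
  rcases hM.isConnected.isPreconnected.subset_or_subset ho₁ ho₂ hdisj hcov with hsub | hsub
  · left
    refine hasScalingForm_of_dy_T_eq_zero hΦ hΦc h0 h2 h3 h5 hMs hM fun p hp hx => ?_
    by_contra hne
    exact Set.disjoint_left.mp hdisj (hsub hp) ⟨hp, hx, hne⟩
  · right
    obtain ⟨p₁, hp₁⟩ := hM.isConnected.nonempty
    have hβ : β = 5 / 2 := by
      rcases hD.dichotomy h0 h5 (hG p₁ hp₁ (hsub hp₁).2.1) with h | h
      · exact absurd h.1 (hsub hp₁).2.2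
      · exact h.1
    subst hβ
    exact ⟨rfl, hasInversionForm_of_dy_T_ne_zero hΦ hΦc hMs hM (fun p hp => (hsub hp).2.1)
      fun p hp => (hsub hp).2.2⟩

end

/-! ### Converse: the listed forms preserve solutions. -/

/-- The differential operator `∂_t + x ∂_y - |x|^β ∂_x²`. -/
def operator (β : ℝ) (g : Base → ℝ) (z : Base) : ℝ :=
  deriv (fun s => g (s, z.2.1, z.2.2)) z.1 + z.2.1 * deriv (fun s => g (z.1, z.2.1, s)) z.2.2
    - |z.2.1| ^ β * deriv (deriv (fun s => g (z.1, s, z.2.2))) z.2.1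

theorem operator_congr {β : ℝ} {g g' : Base → ℝ} {z : Base} (h : g =ᶠ[𝓝 z] g') :
    operator β g z = operator β g' z := by
  obtain ⟨t, x, y⟩ := z
  have h1 : Tendsto (fun s : ℝ => ((s, x, y) : Base)) (𝓝 t) (𝓝 (t, x, y)) :=
    ContinuousAt.tendsto (f := fun s : ℝ => ((s, x, y) : Base)) (by fun_prop)
  have h2 : Tendsto (fun s : ℝ => ((t, x, s) : Base)) (𝓝 y) (𝓝 (t, x, y)) :=
    ContinuousAt.tendsto (f := fun s : ℝ => ((t, x, s) : Base)) (by fun_prop)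
  have h3 : Tendsto (fun s : ℝ => ((t, s, y) : Base)) (𝓝 x) (𝓝 (t, x, y)) :=
    ContinuousAt.tendsto (f := fun s : ℝ => ((t, s, y) : Base)) (by fun_prop)
  have e1 : (fun s => g (s, x, y)) =ᶠ[𝓝 t] fun s => g' (s, x, y) := h1.eventually h
  have e2 : (fun s => g (t, x, s)) =ᶠ[𝓝 y] fun s => g' (t, x, s) := h2.eventually h
  have e3 : (fun s => g (t, s, y)) =ᶠ[𝓝 x] fun s => g' (t, s, y) := h3.eventually h
  simp only [operator, e1.deriv_eq, e2.deriv_eq, e3.deriv.deriv_eq]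

theorem deriv_deriv_const_mul_add {u v : ℝ → ℝ} {x : ℝ} (hu : ContDiffAt ℝ 2 u x)
    (hv : ContDiffAt ℝ 2 v x) (σ : ℝ) :
    deriv (deriv fun s => σ * u s + v s) x = σ * deriv (deriv u) x + deriv (deriv v) x := by
  have key : ∀ w : ℝ → ℝ, ContDiffAt ℝ 2 w x →
      (∀ᶠ s in 𝓝 x, DifferentiableAt ℝ w s) ∧ DifferentiableAt ℝ (deriv w) x := by
    intro w hw
    refine ⟨(hw.eventually (by simp)).mono fun s hs => hs.differentiableAt (by simp), ?_⟩
    have h1 : ContDiffAt ℝ 1 (fderiv ℝ w) x := hw.fderiv_right (by norm_num)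
    exact (h1.differentiableAt (by simp)).clm_apply (differentiableAt_const 1)
  obtain ⟨u1, u2⟩ := key u hu
  obtain ⟨v1, v2⟩ := key v hv
  have e : (deriv fun s => σ * u s + v s) =ᶠ[𝓝 x] fun s => σ * deriv u s + deriv v s := by
    filter_upwards [u1, v1] with s a b
    exact ((a.hasDerivAt.const_mul σ).add b.hasDerivAt).deriv
  rw [e.deriv_eq]
  exact ((u2.hasDerivAt.const_mul σ).add v2.hasDerivAt).deriv

theorem operator_linear {β σ : ℝ} {h f : Base → ℝ} {z : Base} (hh : ContDiffAt ℝ ∞ h z)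
    (hf : ContDiffAt ℝ ∞ f z) :
    operator β (fun w => σ * h w + f w) z = σ * operator β h z + operator β f z := by
  obtain ⟨t, x, y⟩ := z
  have dh := hh.differentiableAt (by simp)
  have df := hf.differentiableAt (by simp)
  have hl : ContDiffAt ℝ 2 (fun s : ℝ => ((t, s, y) : Base)) x := by fun_prop
  have e3 := deriv_deriv_const_mul_add (u := fun s => h (t, s, y)) (v := fun s => f (t, s, y))
    ((hh.of_le two_le_infty).comp x hl) ((hf.of_le two_le_infty).comp x hl) σ
  have e1 := (((deriv_line_t dh).const_mul σ).add (deriv_line_t df)).deriv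
  have e2 := (((deriv_line_y dh).const_mul σ).add (deriv_line_y df)).deriv
  rw [← (deriv_line_t dh).deriv, ← (deriv_line_t df).deriv] at e1
  rw [← (deriv_line_y dh).deriv, ← (deriv_line_y df).deriv] at e2
  simp only [operator]
  rw [e3]
  erw [e1, e2]
  ring

/-- The weights balance because |α|^(2-β)|α|^β = α². The chain rule of `deriv` for affine
substitutions holds without differentiability, so k may be arbitrary. -/
theorem operator_scaling {β α : ℝ} (hα : α ≠ 0) (a b : ℝ) (k : Base → ℝ) (t x y : ℝ) :
    operator β (fun z => k (|α| ^ (2 - β) * z.1 + a, α * z.2.1, α * |α| ^ (2 - β) * z.2.2 + b))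
        (t, x, y)
      = |α| ^ (2 - β) *
        operator β k (|α| ^ (2 - β) * t + a, α * x, α * |α| ^ (2 - β) * y + b) := by
  have hA : |α| ^ (2 - β) * |α| ^ β = α ^ 2 := by
    rw [← Real.rpow_add (abs_pos.mpr hα), sub_add_cancel, Real.rpow_two, sq_abs]
  have affine : ∀ (K : ℝ → ℝ) (c e s : ℝ),
      deriv (fun s => K (c * s + e)) s = c * deriv K (c * s + e) := by
    intro K c e s
    have h1 := deriv_comp_mul_left (f := fun s => K (s + e)) c s
    rw [deriv_comp_add_const] at h1
    simpa using h1
  have lin : ∀ (K : ℝ → ℝ) (c s : ℝ), deriv (fun s => K (c * s)) s = c * deriv K (c * s) := by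
    intro K c s
    simpa using deriv_comp_mul_left (f := K) c s
  set A := |α| ^ (2 - β) with hAdef
  simp only [operator]
  rw [affine (fun s => k (s, α * x, α * A * y + b)) A a t,
    affine (fun s => k (A * t + a, α * x, s)) (α * A) b y,
    show (deriv fun s => k (A * t + a, α * s, α * A * y + b))
      = fun s => α * deriv (fun s => k (A * t + a, s, α * A * y + b)) (α * s) from
      funext fun s => lin (fun s => k (A * t + a, s, α * A * y + b)) α s,
    deriv_const_mul_field, lin (deriv fun s => k (A * t + a, s, α * A * y + b)) α x,
    abs_mul, Real.mul_rpow (abs_nonneg α) (abs_nonneg x)]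
  linear_combination |x| ^ β
    * deriv (deriv fun s => k (A * t + a, s, α * A * y + b)) (α * x) * hA

/-- The first derivative is K - (α/s)K', and in its derivative the K' terms cancel; the factor s
serves this purpose. -/
theorem deriv_deriv_inversion {K : ℝ → ℝ} {α x : ℝ} (hx : x ≠ 0)
    (hK : ContDiffAt ℝ 2 K (α / x)) :
    deriv (deriv fun s => s * K (α / s)) x = α ^ 2 / x ^ 3 * deriv (deriv K) (α / x) := by
  have hq : ∀ s : ℝ, s ≠ 0 → HasDerivAt (fun s => α / s) (-α / s ^ 2) s := fun s hs => by
    exact ((hasDerivAt_const s α).div (hasDerivAt_id s) hs).congr_deriv (by simp)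
  have h1 : ∀ᶠ s in 𝓝 (α / x), DifferentiableAt ℝ K s :=
    (hK.eventually (by simp)).mono fun s hs => hs.differentiableAt (by simp)
  have h2 : DifferentiableAt ℝ (deriv K) (α / x) := by
    have h1 : ContDiffAt ℝ 1 (fderiv ℝ K) (α / x) := hK.fderiv_right (by norm_num)
    exact (h1.differentiableAt (by simp)).clm_apply (differentiableAt_const 1)
  have hxn : ∀ᶠ s in 𝓝 x, s ≠ 0 := eventually_ne_nhds hx
  have e : (deriv fun s => s * K (α / s))
      =ᶠ[𝓝 x] fun s => K (α / s) - α / s * deriv K (α / s) := by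
    filter_upwards [(hq x hx).continuousAt.eventually h1, hxn] with s a b
    have := (hasDerivAt_id s).mul (a.hasDerivAt.comp s (hq s b))
    refine this.deriv.trans ?_
    simp only [Function.comp_apply, id]
    field_simp
    ring
  rw [e.deriv_eq]
  have d1 := h1.self_of_nhds.hasDerivAt.comp x (hq x hx)
  have d2 := (hq x hx).mul (h2.hasDerivAt.comp x (hq x hx))
  refine (d1.sub d2).deriv.trans ?_
  simp only [Function.comp_apply]
  field_simp
  ring

/-- Exchanging t and y works because |x|^(5/2)|x|^(5/2) = sgn(x) x⁵. The sign is a fixed number s,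
since it is locally constant off x = 0. -/
theorem operator_inversion {α : ℝ} (hα : α ≠ 0) (a b : ℝ) {k : Base → ℝ} {s t x y : ℝ}
    (hx : x ≠ 0) (hs : s = Real.sign x)
    (hk : ContDiffAt ℝ ∞ k (s * |α| ^ (2 - 5 / 2 : ℝ) * y + a, α / x,
      s * (α * |α| ^ (2 - 5 / 2 : ℝ)) * t + b)) :
    operator (5 / 2) (fun z => z.2.1 * k (s * |α| ^ (2 - 5 / 2 : ℝ) * z.2.2 + a, α / z.2.1,
      s * (α * |α| ^ (2 - 5 / 2 : ℝ)) * z.1 + b)) (t, x, y)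
      = s * |α| ^ (2 - 5 / 2 : ℝ) * x ^ 2 *
        operator (5 / 2) k (s * |α| ^ (2 - 5 / 2 : ℝ) * y + a, α / x,
          s * (α * |α| ^ (2 - 5 / 2 : ℝ)) * t + b) := by
  have affine : ∀ (K : ℝ → ℝ) (c e s : ℝ),
      deriv (fun s => K (c * s + e)) s = c * deriv K (c * s + e) := by
    intro K c e s
    have h1 := deriv_comp_mul_left (f := fun s => K (s + e)) c s
    rw [deriv_comp_add_const] at h1
    simpa using h1
  have hA : |α| ^ (2 - 5 / 2 : ℝ) * |α| ^ (5 / 2 : ℝ) = α ^ 2 := by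
    rw [← Real.rpow_add (abs_pos.mpr hα), sub_add_cancel, Real.rpow_two, sq_abs]
  have hX : |x| ^ (5 / 2 : ℝ) * |x| ^ (5 / 2 : ℝ) = s * x ^ 5 := by
    rw [← Real.rpow_add (abs_pos.mpr hx), show (5 / 2 : ℝ) + 5 / 2 = (5 : ℕ) by norm_num,
      Real.rpow_natCast, hs]
    rcases hx.lt_or_gt with h | h
    · rw [Real.sign_of_neg h, abs_of_neg h]; ring
    · rw [Real.sign_of_pos h, abs_of_pos h]; ring
  have hs2 : s * s = 1 := by
    rw [hs]
    rcases hx.lt_or_gt with h | h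
    · rw [Real.sign_of_neg h]; ring
    · rw [Real.sign_of_pos h]; ring
  have hxβ : |x| ^ (5 / 2 : ℝ) ≠ 0 := (Real.rpow_pos_of_pos (abs_pos.mpr hx) _).ne'
  set A := |α| ^ (2 - 5 / 2 : ℝ) with hAdef
  have hl : ContDiffAt ℝ 2 (fun r : ℝ => ((s * A * y + a, r, s * (α * A) * t + b) : Base))
    (α / x) := by fun_prop
  simp only [operator]
  rw [deriv_const_mul_field, deriv_const_mul_field,
    affine (fun r => k (s * A * y + a, α / x, r)) (s * (α * A)) b t,
    affine (fun r => k (r, α / x, s * (α * A) * t + b)) (s * A) a y,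
    deriv_deriv_inversion (K := fun r => k (s * A * y + a, r, s * (α * A) * t + b)) hx
      ((hk.of_le two_le_infty).comp (α / x) hl),
    abs_div, Real.div_rpow (abs_nonneg α) (abs_nonneg x)]
  have key : |x| ^ (5 / 2 : ℝ) * (α ^ 2 / x ^ 3)
      = s * A * x ^ 2 * (|α| ^ (5 / 2 : ℝ) / |x| ^ (5 / 2 : ℝ)) := by
    rw [mul_div_assoc', mul_div_assoc', div_eq_div_iff (pow_ne_zero 3 hx) hxβ]
    linear_combination α ^ 2 * hX - s * x ^ 5 * hA
  have hαx : x * (s * (α * A)) = s * A * x ^ 2 * (α / x) := by field_simp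
  linear_combination deriv (fun r => k (s * A * y + a, α / x, r)) (s * (α * A) * t + b) * hαx
    - deriv (deriv fun r => k (s * A * y + a, r, s * (α * A) * t + b)) (α / x) * key

theorem isVerticalDomain_ball (p : Total) {r : ℝ} (hr : 0 < r) :
    IsVerticalDomain (Metric.ball p r) where
  isOpen := Metric.isOpen_ball
  isConnected := ⟨⟨p, Metric.mem_ball_self hr⟩, (convex_ball p r).isPreconnected⟩
  fibre t x y := by
    apply Convex.isPreconnected
    intro u hu u' hu' a b ha hb hab
    have := convex_ball p r hu hu' ha hb hab
    simp only [Prod.smul_mk, Prod.mk_add_mk, smul_eq_mul, ← add_mul, hab, one_mul] at this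
    exact this

theorem isSolutionOn_iff_operator {β : ℝ} {h : Base → ℝ} {Ω : Set Base} :
    IsSolutionOn β h Ω ↔ ContDiffOn ℝ ∞ h Ω ∧ ∀ z ∈ Ω, operator β h z = 0 := by
  refine and_congr_right fun _ => ⟨fun H z hz => sub_eq_zero.mpr (H _ _ _ hz),
    fun H t x y hz => sub_eq_zero.mp (H _ hz)⟩

/-- On a ball around a point of the graph the form says that σh + f is k composed with the base map,
times x for an inversion. As f is annihilated, the operator on h at a point and on k at its image
agree up to nonzero factors. Only balls are used, which are vertical domains. -/
theorem preservesSolutions_of_forms {β : ℝ} {Φ : OpenPartialHomeomorph Total Total}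
    (H : ∀ M : Set Total, M ⊆ Φ.source → IsVerticalDomain M →
      HasScalingForm β Φ M ∨ (β = 5 / 2 ∧ HasInversionForm β Φ M)) :
    PreservesSolutions β Φ := by
  intro Ω Ω' h k hΩ hΩ' hh hk hsrc himg
  have core : ∀ z ∈ Ω, ∀ z' ∈ Ω', Φ (lift h z) = lift k z' →
      (operator β h z = 0 ↔ operator β k z' = 0) := by
    rintro ⟨t, x, y⟩ hz z' hz' he
    have hp : lift h (t, x, y) ∈ Φ.source := hsrc ⟨_, hz, rfl⟩
    obtain ⟨r, hr, hball⟩ := Metric.isOpen_iff.mp Φ.open_source _ hp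
    have hpM : lift h (t, x, y) ∈ Metric.ball (lift h (t, x, y)) r := Metric.mem_ball_self hr
    have hMo : IsOpen (Metric.ball (lift h (t, x, y)) r) := Metric.isOpen_ball
    have hform := H _ hball (isVerticalDomain_ball _ hr)
    set M := Metric.ball (lift h (t, x, y)) r with hM
    have hhat := hh.contDiffAt (hΩ.mem_nhds hz)
    have hlc : ContinuousAt (lift h) (t, x, y) :=
      ((contDiffOn_lift hh).contDiffAt (hΩ.mem_nhds hz)).continuousAt
    have hnear : ∀ᶠ z in 𝓝 ((t, x, y) : Base), lift h z ∈ M ∧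
        ∃ w ∈ Ω', Φ (lift h z) = lift k w := by
      filter_upwards [hlc.eventually (hMo.mem_nhds hpM), hΩ.mem_nhds hz] with z h1 h2
      refine ⟨h1, ?_⟩
      have : Φ (lift h z) ∈ graphOver k Ω' := himg ▸ mem_image_of_mem _ ⟨z, h2, rfl⟩
      obtain ⟨w, hw, hwe⟩ := this
      exact ⟨w, hw, hwe.symm⟩
    have hpO : IsOpen (proj '' M) := by
      rw [isOpen_iff_mem_nhds]
      rintro _ ⟨⟨t', x', y', u'⟩, hq, rfl⟩
      have hc : ContinuousAt (fun z : Base => ((z.1, z.2.1, z.2.2, u') : Total)) (t', x', y') := by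
        fun_prop
      exact mem_of_superset (hc.preimage_mem_nhds (hMo.mem_nhds hq)) fun z hz => ⟨_, hz, rfl⟩
    have hzM : ((t, x, y) : Base) ∈ proj '' M := ⟨_, hpM, rfl⟩
    rcases hform with ⟨α, σ, a, b, f, hα, hσ, hf, hΦ⟩ | ⟨rfl, α, σ, a, b, f, hα, hσ, hf, hΦ⟩
    · rw [isSolutionOn_iff_operator] at hf
      have hfat := hf.1.contDiffAt (hpO.mem_nhds hzM)
      have hkg : (fun z : Base => σ * h z + f z) =ᶠ[𝓝 (t, x, y)] fun z =>
          k (|α| ^ (2 - β) * z.1 + a, α * z.2.1, α * |α| ^ (2 - β) * z.2.2 + b) := by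
        filter_upwards [hnear] with z ⟨h1, w, hw, hwe⟩
        have h2 := hΦ z.1 z.2.1 z.2.2 (h z) h1
        have h3 := hwe.symm.trans h2
        simp only [lift, Prod.mk.injEq] at h3
        rw [← h3.1, ← h3.2.1, ← h3.2.2.1]
        exact h3.2.2.2.symm
      have hz'e : z' = (|α| ^ (2 - β) * t + a, α * x, α * |α| ^ (2 - β) * y + b) := by
        have h3 := he.symm.trans (hΦ t x y _ hpM)
        simp only [lift, Prod.mk.injEq] at h3
        rw [← h3.1, ← h3.2.1, ← h3.2.2.1]
      have e1 := operator_congr (β := β) hkg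
      rw [operator_linear hhat hfat, hf.2 _ hzM, add_zero, operator_scaling hα, ← hz'e] at e1
      have hA : |α| ^ (2 - β) ≠ 0 := (Real.rpow_pos_of_pos (abs_pos.mpr hα) _).ne'
      constructor
      · intro h0
        rw [h0, mul_zero] at e1
        exact (mul_eq_zero.mp e1.symm).resolve_left hA
      · intro h0
        rw [h0, mul_zero] at e1
        exact (mul_eq_zero.mp e1).resolve_left hσ
    · rw [isSolutionOn_iff_operator] at hf
      have hfat := hf.1.contDiffAt (hpO.mem_nhds hzM)
      have hx : x ≠ 0 := (hΦ t x y _ hpM).1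
      obtain ⟨s, hs⟩ : ∃ s, s = Real.sign x := ⟨_, rfl⟩
      have hsz : ∀ᶠ z : Base in 𝓝 (t, x, y), z.2.1 ≠ 0 ∧ Real.sign z.2.1 = s := by
        have hc : ContinuousAt (fun z : Base => z.2.1) (t, x, y) := by fun_prop
        rcases hx.lt_or_gt with h0 | h0
        · filter_upwards [hc.eventually_lt_const h0] with z hz
          exact ⟨hz.ne, by rw [hs, Real.sign_of_neg hz, Real.sign_of_neg h0]⟩
        · filter_upwards [hc.eventually_const_lt h0] with z hz
          exact ⟨hz.ne', by rw [hs, Real.sign_of_pos hz, Real.sign_of_pos h0]⟩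
      have hkg : (fun z : Base => σ * h z + f z) =ᶠ[𝓝 (t, x, y)] fun z =>
          z.2.1 * k (s * |α| ^ (2 - 5 / 2 : ℝ) * z.2.2 + a, α / z.2.1,
            s * (α * |α| ^ (2 - 5 / 2 : ℝ)) * z.1 + b) := by
        filter_upwards [hnear, hsz] with z ⟨h1, w, hw, hwe⟩ ⟨hz0, hzs⟩
        have h2 := (hΦ z.1 z.2.1 z.2.2 (h z) h1).2
        have h3 := hwe.symm.trans h2
        simp only [lift, Prod.mk.injEq] at h3
        rw [← hzs, ← h3.1, ← h3.2.1, ← h3.2.2.1]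
        have h4 : k w = (σ * h z + f z) / z.2.1 := h3.2.2.2
        have h5 : k (w.1, w.2.1, w.2.2) = k w := rfl
        rw [h5, h4]
        field_simp
      have hz'e : z' = (s * |α| ^ (2 - 5 / 2 : ℝ) * y + a, α / x,
          s * (α * |α| ^ (2 - 5 / 2 : ℝ)) * t + b) := by
        have h3 := he.symm.trans (hΦ t x y _ hpM).2
        simp only [lift, Prod.mk.injEq] at h3
        rw [hs, ← h3.1, ← h3.2.1, ← h3.2.2.1]
      have e1 := operator_congr (β := 5 / 2) hkg
      rw [operator_linear hhat hfat, hf.2 _ hzM, add_zero, operator_inversion hα a b hx hs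
        (by rw [← hz'e]; exact hk.contDiffAt (hΩ'.mem_nhds hz')), ← hz'e] at e1
      have hA : s * |α| ^ (2 - 5 / 2 : ℝ) * x ^ 2 ≠ 0 := by
        have h1 : |α| ^ (2 - 5 / 2 : ℝ) ≠ 0 := (Real.rpow_pos_of_pos (abs_pos.mpr hα) _).ne'
        have h2 : s ≠ 0 := by rw [hs]; exact Real.sign_eq_zero_iff.not.mpr hx
        exact mul_ne_zero (mul_ne_zero h2 h1) (pow_ne_zero 2 hx)
      constructor
      · intro h0
        rw [h0, mul_zero] at e1
        exact (mul_eq_zero.mp e1.symm).resolve_left hA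
      · intro h0
        rw [h0, mul_zero] at e1
        exact (mul_eq_zero.mp e1).resolve_left hσ
  rw [isSolutionOn_iff_operator, isSolutionOn_iff_operator]
  constructor
  · rintro ⟨-, h1⟩
    refine ⟨hk, fun z' hz' => ?_⟩
    have : lift k z' ∈ Φ '' graphOver h Ω := himg.symm ▸ ⟨z', hz', rfl⟩
    obtain ⟨_, ⟨z, hz, rfl⟩, he⟩ := this
    exact (core z hz z' hz' he).mp (h1 z hz)
  · rintro ⟨-, h1⟩
    refine ⟨hh, fun z hz => ?_⟩
    have : Φ (lift h z) ∈ graphOver k Ω' := himg ▸ mem_image_of_mem _ ⟨z, hz, rfl⟩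
    obtain ⟨z', hz', he⟩ := this
    exact (core z hz z' hz' he.symm).mpr (h1 z' hz')

end UltraparabolicSymmetry

end

/-! ### Assembly of the two statements. -/

theorem mainTheorem7 :
    (∀ β : ℝ, β ≠ 0 → β ≠ 2 → β ≠ 5 / 2 → β ≠ 3 → β ≠ 5 →
      ∀ Φ : OpenPartialHomeomorph UltraparabolicSymmetry.Total UltraparabolicSymmetry.Total,
        Φ ∈ UltraparabolicSymmetry.pointSymmetryPseudogroup β ↔
          UltraparabolicSymmetry.IsPointTransformation β Φ ∧
            ∀ M : Set UltraparabolicSymmetry.Total, M ⊆ Φ.source →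
              UltraparabolicSymmetry.IsVerticalDomain M →
                UltraparabolicSymmetry.HasScalingForm β Φ M) ∧
    (∀ Φ : OpenPartialHomeomorph UltraparabolicSymmetry.Total UltraparabolicSymmetry.Total,
        Φ ∈ UltraparabolicSymmetry.pointSymmetryPseudogroup (5 / 2) ↔
          UltraparabolicSymmetry.IsPointTransformation (5 / 2) Φ ∧
            ∀ M : Set UltraparabolicSymmetry.Total, M ⊆ Φ.source →
              UltraparabolicSymmetry.IsVerticalDomain M →
                (UltraparabolicSymmetry.HasScalingForm (5 / 2) Φ M ∨
                  UltraparabolicSymmetry.HasInversionForm (5 / 2) Φ M)) := by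
  open UltraparabolicSymmetry in
  refine ⟨fun β h0 h2 h52 h3 h5 Φ => ⟨fun hΦ => ⟨hΦ.1, fun M hMs hM => ?_⟩,
    fun h => ⟨h.1, preservesSolutions_of_forms fun M hMs hM => .inl (h.2 M hMs hM)⟩⟩,
    fun Φ => ⟨fun hΦ => ⟨hΦ.1, fun M hMs hM => ?_⟩,
    fun h => ⟨h.1, preservesSolutions_of_forms fun M hMs hM =>
      (h.2 M hMs hM).imp_right fun h => ⟨rfl, h⟩⟩⟩⟩
  · exact (hasForm_of_mem_pseudogroup hΦ h0 h2 h3 h5 hMs hM).resolve_right fun h => h52 h.1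
  · exact (hasForm_of_mem_pseudogroup hΦ (by norm_num) (by norm_num) (by norm_num) (by norm_num)
      hMs hM).imp_right And.right
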